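/- Let $m\ge 1$, and let $\sigma_m$ be the area of the unit sphere $S^{m-1}\subset\mathbb{R}^m$. For $\lambda\in\mathbb{C}$ let $T_\lambda=\mathrm{Fp}\,r^\lambda\in\mathcal{S}'(\mathbb{R}^m)$, $r=|x|$, be the distribution $$\langle T_\lambda,\varphi\rangle=\sigma_m\,\big\langle \mathrm{Fp}\,r_+^{\lambda+m-1},\Sigma^{(0)}[\varphi]\big\rangle,\qquad \Sigma^{(0)}[\varphi](r)=\frac1{\sigma_m}\int_{S^{m-1}}\varphi(r\omega)\,dS(\omega),$$ where $\mathrm{Fp}$ is the (Hadamard) finite part, and let $$T^*_\lambda=\pi^{\frac{\lambda+m}{2}}\frac{T_\lambda}{\Gamma\left(\frac{\lambda+m}{2}\right)}\quad(\lambda\ne -m-2l,\ l\in\mathbb{N}_0),\qquad T^*_{-m-2l}=\frac{\pi^{\frac m2-l}}{2^{2l}\,\Gamma\left(\frac m2+l\right)}(-\Delta_m)^l\delta\quad(l\in\mathbb{N}_0).$$ For $\beta\in\mathbb{C}$, $\beta\neq-\frac m2-n$ $(n\in\mathbb{N}_0)$, put $$(-\Delta_m)^\beta\delta=2^{2\beta}\,\frac{\Gamma\left(\frac{m+2\beta}{2}\right)}{\pi^{\frac{m-2\beta}{2}}}\,T^*_{-m-2\beta},$$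 and let $(-\Delta_m)^\beta[f]=(-\Delta_m)^\beta\delta * f$ for every $f\in\mathcal{S}'(\mathbb{R}^m)$ that is convolvable with this kernel. Here $S,T\in\mathcal{S}'(\mathbb{R}^m)$ are called convolvable if for all $\varphi\in\mathcal{S}(\mathbb{R}^m)$ the product of the function $x\mapsto\langle S_y,\varphi(x+y)\rangle$ with $T$ is an integrable distribution (an element of $\mathcal{D}'_{L^1}$); then $\langle S*T,\varphi\rangle$ is the value of this product at the constant function $1$. Let $\beta\in\mathbb{C}\setminus\{\pm\frac m2,\pm\frac{m+2}2,\pm\frac{m+4}2,\ldots\}$. Then $(-\Delta_m)^\beta\delta$ and $(-\Delta_m)^{-\beta}\delta$ are convolvable, and $$(-\Delta_m)^\beta\delta*(-\Delta_m)^{-\beta}\delta=\delta .$$ Hence $K_\beta=(-\Delta_m)^{-\beta}\delta$ is a fundamental solution of the operator $(-\Delta_m)^\beta$, i.e. $(-\Delta_m)^\beta[K_\beta]=\delta$. -/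

import Mathlib

open MeasureTheory Set Filter Topology
open scoped SchwartzMap Laplacian

namespace RieszDist

/-- Euclidean space of dimension `m`. -/
abbrev Eucl (m : ℕ) := EuclideanSpace ℝ (Fin m)

/-- The surface measure on the unit sphere of Euclidean space. -/
noncomputable abbrev sphereMeasure (m : ℕ) : Measure (Metric.sphere (0 : Eucl m) 1) :=
  (volume : Measure (Eucl m)).toSphere

/-- The area `σ_m` of the unit sphere. -/
noncomputable def sphereArea (m : ℕ) : ℝ := (sphereMeasure m).real univ

/-- The spherical mean of `φ`, i.e. `(1/σ_m) ∫ φ(r ω) dS(ω)`, as a function of `r ∈ ℝ`. -/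
noncomputable def sphericalMean {m : ℕ} (φ : 𝓢(Eucl m, ℂ)) (r : ℝ) : ℂ :=
  ((sphereArea m)⁻¹ : ℝ) • ∫ ω, φ (r • (ω : Eucl m)) ∂(sphereMeasure m)

/-- The finite part distribution `Fp r₊^μ` applied to a function `ψ` which is smooth on the
closed half-line. Taylor's polynomial of `ψ` at the origin, of degree `< n` with
`n = ⌈-Re μ⌉₊`, is subtracted on `(0, 1)` and the divergent integrals `∫₀¹ r^(μ+k) dr` are
replaced by their finite parts `1/(μ+k+1)`. If `μ + k + 1 = 0`, the
finite part of `∫₀¹ r^(-1) dr` is `0`, in accordance with division by zero. -/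
noncomputable def finitePart (μ : ℂ) (ψ : ℝ → ℂ) : ℂ :=
  (∫ r in Ioc (0 : ℝ) 1, (r : ℂ) ^ μ *
      (ψ r - ∑ k ∈ Finset.range ⌈-μ.re⌉₊, iteratedDeriv k ψ 0 / (k.factorial : ℂ) * (r : ℂ) ^ k))
    + (∫ r in Ioi (1 : ℝ), (r : ℂ) ^ μ * ψ r)
    + ∑ k ∈ Finset.range ⌈-μ.re⌉₊, iteratedDeriv k ψ 0 / (k.factorial : ℂ) / (μ + k + 1)

section Continuity

variable {m : ℕ}

/-- The `k`-th derivative of `r ↦ φ(r ω)`. -/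
noncomputable def rayDeriv (φ : 𝓢(Eucl m, ℂ)) (k : ℕ) (r : ℝ)
    (ω : Metric.sphere (0 : Eucl m) 1) : ℂ :=
  iteratedFDeriv ℝ k φ (r • (ω : Eucl m)) (fun _ => (ω : Eucl m))

theorem iteratedDeriv_ray (φ : 𝓢(Eucl m, ℂ)) (k : ℕ) (ω : Metric.sphere (0 : Eucl m) 1) :
    iteratedDeriv k (fun s : ℝ => φ (s • (ω : Eucl m))) = fun r => rayDeriv φ k r ω := by
  funext r
  have h := ContinuousLinearMap.iteratedFDeriv_comp_right (i := k)
    (ContinuousLinearMap.toSpanSingleton ℝ (ω : Eucl m)) (f := φ) (φ.smooth ⊤) r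
    (by exact_mod_cast le_top)
  have h2 : (fun s : ℝ => φ (s • (ω : Eucl m))) =
      φ ∘ (ContinuousLinearMap.toSpanSingleton ℝ (ω : Eucl m)) := by
    funext s; simp [ContinuousLinearMap.toSpanSingleton_apply]
  rw [iteratedDeriv_eq_iteratedFDeriv, h2, h]
  simp [rayDeriv, ContinuousLinearMap.toSpanSingleton_apply]

theorem contDiff_ray (φ : 𝓢(Eucl m, ℂ)) (ω : Metric.sphere (0 : Eucl m) 1) :
    ContDiff ℝ ((⊤ : ℕ∞) : WithTop ℕ∞) (fun s : ℝ => φ (s • (ω : Eucl m))) :=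
  (φ.smooth ⊤).comp (by fun_prop)

theorem hasDerivAt_rayDeriv (φ : 𝓢(Eucl m, ℂ)) (k : ℕ) (r : ℝ)
    (ω : Metric.sphere (0 : Eucl m) 1) :
    HasDerivAt (fun s => rayDeriv φ k s ω) (rayDeriv φ (k + 1) r ω) r := by
  have h1 : rayDeriv φ (k + 1) r ω =
      deriv (iteratedDeriv k (fun s : ℝ => φ (s • (ω : Eucl m)))) r := by
    rw [← iteratedDeriv_succ, iteratedDeriv_ray]
  rw [h1, ← iteratedDeriv_ray]
  exact (((contDiff_ray φ ω).differentiable_iteratedDeriv k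
    (by exact_mod_cast WithTop.coe_lt_top _)) r).hasDerivAt

theorem norm_rayDeriv_le (φ : 𝓢(Eucl m, ℂ)) (k : ℕ) (r : ℝ)
    (ω : Metric.sphere (0 : Eucl m) 1) :
    ‖rayDeriv φ k r ω‖ ≤ ‖iteratedFDeriv ℝ k φ (r • (ω : Eucl m))‖ := by
  have h := (iteratedFDeriv ℝ k φ (r • (ω : Eucl m))).le_opNorm (fun _ => (ω : Eucl m))
  simpa [rayDeriv] using h

theorem continuous_rayDeriv (φ : 𝓢(Eucl m, ℂ)) (k : ℕ) (r : ℝ) :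
    Continuous (fun ω => rayDeriv φ k r ω) := by
  have h : Continuous (iteratedFDeriv ℝ k φ) :=
    (φ.smooth ⊤).continuous_iteratedFDeriv (by exact_mod_cast le_top)
  unfold rayDeriv
  fun_prop

theorem integrable_rayDeriv (φ : 𝓢(Eucl m, ℂ)) (k : ℕ) (r : ℝ) :
    Integrable (fun ω => rayDeriv φ k r ω) (sphereMeasure m) :=
  Integrable.of_bound (continuous_rayDeriv φ k r).aestronglyMeasurable
    (SchwartzMap.seminorm ℝ 0 k φ)
    (Eventually.of_forall fun ω => (norm_rayDeriv_le φ k r ω).trans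
      (φ.norm_iteratedFDeriv_le_seminorm ℝ k _))

theorem hasDerivAt_integral_rayDeriv (φ : 𝓢(Eucl m, ℂ)) (k : ℕ) (r : ℝ) :
    HasDerivAt (fun s => ∫ ω, rayDeriv φ k s ω ∂(sphereMeasure m))
      (∫ ω, rayDeriv φ (k + 1) r ω ∂(sphereMeasure m)) r :=
  (hasDerivAt_integral_of_dominated_loc_of_deriv_le (s := univ)
    (bound := fun _ => SchwartzMap.seminorm ℝ 0 (k + 1) φ) univ_mem
    (Eventually.of_forall fun s => (continuous_rayDeriv φ k s).aestronglyMeasurable)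
    (integrable_rayDeriv φ k r) (continuous_rayDeriv φ (k + 1) r).aestronglyMeasurable
    (Eventually.of_forall fun ω s _ => (norm_rayDeriv_le φ (k + 1) s ω).trans
      (φ.norm_iteratedFDeriv_le_seminorm ℝ (k + 1) _))
    (integrable_const _)
    (Eventually.of_forall fun ω s _ => hasDerivAt_rayDeriv φ k s ω)).2

theorem iteratedDeriv_sphericalMean (φ : 𝓢(Eucl m, ℂ)) (k : ℕ) :
    iteratedDeriv k (sphericalMean φ) =
      fun r => ((sphereArea m)⁻¹ : ℝ) • ∫ ω, rayDeriv φ k r ω ∂(sphereMeasure m) := by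
  induction k with
  | zero => funext r; simp [sphericalMean, rayDeriv]
  | succ k ih =>
    rw [iteratedDeriv_succ, ih]
    funext r
    exact ((hasDerivAt_integral_rayDeriv φ k r).const_smul ((sphereArea m)⁻¹ : ℝ)).deriv

theorem contDiff_sphericalMean (φ : 𝓢(Eucl m, ℂ)) : ContDiff ℝ ((⊤ : ℕ∞) : WithTop ℕ∞) (sphericalMean φ) := by
  refine contDiff_of_differentiable_iteratedDeriv fun k _ => ?_
  rw [iteratedDeriv_sphericalMean]
  intro r
  exact ((hasDerivAt_integral_rayDeriv φ k r).const_smul ((sphereArea m)⁻¹ : ℝ)).differentiableAt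

/-- A bound for means over the sphere. -/
theorem norm_mean_le {f : Metric.sphere (0 : Eucl m) 1 → ℂ} {C : ℝ} (hC : 0 ≤ C)
    (h : ∀ ω, ‖f ω‖ ≤ C) : ‖((sphereArea m)⁻¹ : ℝ) • ∫ ω, f ω ∂(sphereMeasure m)‖ ≤ C := by
  have h1 := norm_integral_le_of_norm_le_const (μ := sphereMeasure m) (Eventually.of_forall h)
  have h0 : 0 ≤ sphereArea m := measureReal_nonneg
  rw [norm_smul, norm_inv, Real.norm_of_nonneg h0]
  calc (sphereArea m)⁻¹ * ‖∫ ω, f ω ∂(sphereMeasure m)‖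
      ≤ (sphereArea m)⁻¹ * (C * sphereArea m) := by
        gcongr; exact h1
    _ = C * ((sphereArea m)⁻¹ * sphereArea m) := by ring
    _ ≤ C * 1 := by gcongr; exact inv_mul_le_one
    _ = C := mul_one C

/-- The seminorm that controls `Fp r₊^μ` on spherical means. -/
noncomputable def ctrl (K n : ℕ) (φ : 𝓢(Eucl m, ℂ)) : ℝ :=
  2 ^ K * (Finset.Iic (K, n)).sup (schwartzSeminormFamily ℂ (Eucl m) ℂ) φ

theorem ctrl_nonneg (K n : ℕ) (φ : 𝓢(Eucl m, ℂ)) : 0 ≤ ctrl K n φ :=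
  mul_nonneg (by positivity) (apply_nonneg _ _)

theorem norm_iteratedDeriv_sphericalMean_le {K n k : ℕ} (hk : k ≤ n) (φ : 𝓢(Eucl m, ℂ)) (r : ℝ) :
    ‖iteratedDeriv k (sphericalMean φ) r‖ ≤ ctrl K n φ := by
  rw [iteratedDeriv_sphericalMean]
  refine norm_mean_le (ctrl_nonneg K n φ) fun ω => (norm_rayDeriv_le φ k r ω).trans ?_
  have := SchwartzMap.one_add_le_sup_seminorm_apply (𝕜 := ℂ) (m := (K, n)) (k := 0) (n := k)
    (Nat.zero_le _) hk φ (r • (ω : Eucl m))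
  rwa [pow_zero, one_mul] at this

theorem norm_sphericalMean_le (K n : ℕ) (φ : 𝓢(Eucl m, ℂ)) {r : ℝ} (hr : 0 < r) :
    ‖sphericalMean φ r‖ ≤ ctrl K n φ / r ^ K := by
  refine norm_mean_le (div_nonneg (ctrl_nonneg K n φ) (by positivity)) fun ω => ?_
  have := SchwartzMap.one_add_le_sup_seminorm_apply (𝕜 := ℂ) (m := (K, n)) (k := K) (n := 0)
    le_rfl (Nat.zero_le _) φ (r • (ω : Eucl m))
  rw [norm_iteratedFDeriv_zero, norm_smul, Real.norm_of_nonneg hr.le] at this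
  simp only [norm_eq_of_mem_sphere, mul_one] at this
  rw [le_div_iff₀ (by positivity), mul_comm]
  refine le_trans ?_ this
  gcongr
  linarith

theorem norm_sub_taylor_le (K n : ℕ) (φ : 𝓢(Eucl m, ℂ)) {r : ℝ} (hr : r ∈ Ioc (0 : ℝ) 1) :
    ‖sphericalMean φ r - ∑ k ∈ Finset.range n,
      iteratedDeriv k (sphericalMean φ) 0 / (k.factorial : ℂ) * (r : ℂ) ^ k‖
      ≤ ctrl K n φ * r ^ n := by
  cases n with
  | zero =>
    have := norm_iteratedDeriv_sphericalMean_le (K := K) (le_refl 0) φ r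
    simpa using this
  | succ n =>
    have hd : ∀ (k : ℕ), ∀ y ∈ Icc (0 : ℝ) 1,
        iteratedDerivWithin k (sphericalMean φ) (Icc 0 1) y =
          iteratedDeriv k (sphericalMean φ) y := fun k y hy =>
      iteratedDerivWithin_eq_iteratedDeriv (uniqueDiffOn_Icc zero_lt_one)
        ((contDiff_sphericalMean φ).of_le (by exact_mod_cast le_top)).contDiffAt hy
    have h := taylor_mean_remainder_bound (f := sphericalMean φ) (a := 0) (b := 1)
      (C := ctrl K (n + 1) φ) (x := r) (n := n) zero_le_one
      ((contDiff_sphericalMean φ).of_le (by exact_mod_cast le_top)).contDiffOn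
      ⟨hr.1.le, hr.2⟩ (fun y hy => by
        rw [hd _ y hy]; exact norm_iteratedDeriv_sphericalMean_le le_rfl φ y)
    rw [taylor_within_apply] at h
    have e : ∑ k ∈ Finset.range (n + 1),
        iteratedDeriv k (sphericalMean φ) 0 / (k.factorial : ℂ) * (r : ℂ) ^ k =
        ∑ k ∈ Finset.range (n + 1), ((k.factorial : ℝ)⁻¹ * (r - 0) ^ k) •
          iteratedDerivWithin k (sphericalMean φ) (Icc 0 1) 0 := by
      refine Finset.sum_congr rfl fun k _ => ?_
      rw [hd k 0 ⟨le_rfl, zero_le_one⟩, Complex.real_smul]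
      push_cast
      ring
    rw [e]
    refine h.trans ?_
    rw [sub_zero]
    refine div_le_self (mul_nonneg (ctrl_nonneg _ _ _) (pow_nonneg hr.1.le _)) ?_
    exact_mod_cast n.factorial_pos

/-- The integrand near the origin is bounded. -/
theorem norm_inner_le (μ : ℂ) (K : ℕ) (φ : 𝓢(Eucl m, ℂ)) {r : ℝ} (hr : r ∈ Ioc (0 : ℝ) 1) :
    ‖(r : ℂ) ^ μ * (sphericalMean φ r - ∑ k ∈ Finset.range ⌈-μ.re⌉₊,
      iteratedDeriv k (sphericalMean φ) 0 / (k.factorial : ℂ) * (r : ℂ) ^ k)‖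
      ≤ ctrl K ⌈-μ.re⌉₊ φ := by
  rw [norm_mul, Complex.norm_cpow_eq_rpow_re_of_pos hr.1]
  have h1 := norm_sub_taylor_le K ⌈-μ.re⌉₊ φ hr
  have h2 : r ^ μ.re * r ^ ⌈-μ.re⌉₊ ≤ 1 := by
    rw [← Real.rpow_natCast, ← Real.rpow_add hr.1]
    refine Real.rpow_le_one hr.1.le hr.2 ?_
    have := Nat.le_ceil (-μ.re)
    linarith
  calc _ ≤ r ^ μ.re * (ctrl K ⌈-μ.re⌉₊ φ * r ^ ⌈-μ.re⌉₊) := by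
        gcongr
        exact Real.rpow_nonneg hr.1.le _
    _ = ctrl K ⌈-μ.re⌉₊ φ * (r ^ μ.re * r ^ ⌈-μ.re⌉₊) := by ring
    _ ≤ ctrl K ⌈-μ.re⌉₊ φ * 1 := by
        gcongr
        exact ctrl_nonneg _ _ _
    _ = _ := mul_one _

/-- The integrand at infinity has an integrable majorant. -/
theorem norm_outer_le (μ : ℂ) (n : ℕ) (φ : 𝓢(Eucl m, ℂ)) {r : ℝ} (hr : r ∈ Ioi (1 : ℝ)) :
    ‖(r : ℂ) ^ μ * sphericalMean φ r‖ ≤ ctrl (⌈μ.re⌉₊ + 2) n φ * r ^ (-2 : ℝ) := by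
  have h0 : (0 : ℝ) < r := zero_lt_one.trans hr
  rw [norm_mul, Complex.norm_cpow_eq_rpow_re_of_pos h0]
  have h1 := norm_sphericalMean_le (⌈μ.re⌉₊ + 2) n φ h0
  have h2 : r ^ μ.re / r ^ (⌈μ.re⌉₊ + 2) ≤ r ^ (-2 : ℝ) := by
    rw [← Real.rpow_natCast, ← Real.rpow_sub h0]
    refine Real.rpow_le_rpow_of_exponent_le (le_of_lt hr) ?_
    have := Nat.le_ceil μ.re
    push_cast
    linarith
  calc _ ≤ r ^ μ.re * (ctrl (⌈μ.re⌉₊ + 2) n φ / r ^ (⌈μ.re⌉₊ + 2)) := by gcongr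
    _ = ctrl (⌈μ.re⌉₊ + 2) n φ * (r ^ μ.re / r ^ (⌈μ.re⌉₊ + 2)) := by ring
    _ ≤ _ := by
        gcongr
        exact ctrl_nonneg _ _ _

theorem measurable_cpow (μ : ℂ) : Measurable (fun r : ℝ => (r : ℂ) ^ μ) :=
  Complex.measurable_ofReal.pow_const μ

theorem integrableOn_inner (μ : ℂ) (φ : 𝓢(Eucl m, ℂ)) :
    IntegrableOn (fun r : ℝ => (r : ℂ) ^ μ * (sphericalMean φ r -
      ∑ k ∈ Finset.range ⌈-μ.re⌉₊,
        iteratedDeriv k (sphericalMean φ) 0 / (k.factorial : ℂ) * (r : ℂ) ^ k)) (Ioc 0 1) := by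
  refine Integrable.of_bound ?_ (ctrl 0 ⌈-μ.re⌉₊ φ)
    ((ae_restrict_iff' measurableSet_Ioc).2 (Eventually.of_forall fun r hr => norm_inner_le μ 0 φ hr))
  refine ((measurable_cpow μ).aestronglyMeasurable).mul (Continuous.aestronglyMeasurable ?_)
  have := (contDiff_sphericalMean φ).continuous
  fun_prop

theorem integrableOn_outer (μ : ℂ) (φ : 𝓢(Eucl m, ℂ)) :
    IntegrableOn (fun r : ℝ => (r : ℂ) ^ μ * sphericalMean φ r) (Ioi 1) := by
  have h : IntegrableOn (fun r : ℝ => ctrl (⌈μ.re⌉₊ + 2) 0 φ * r ^ (-2 : ℝ)) (Ioi 1) :=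
    (integrableOn_Ioi_rpow_of_lt (by norm_num) zero_lt_one).const_mul _
  refine Integrable.mono' h ?_
    ((ae_restrict_iff' measurableSet_Ioi).2 (Eventually.of_forall fun r hr => norm_outer_le μ 0 φ hr))
  exact ((measurable_cpow μ).aestronglyMeasurable).mul
    (contDiff_sphericalMean φ).continuous.aestronglyMeasurable

theorem sphericalMean_add (φ ψ : 𝓢(Eucl m, ℂ)) :
    sphericalMean (φ + ψ) = sphericalMean φ + sphericalMean ψ := by
  funext r
  have h1 := integrable_rayDeriv φ 0 r
  have h2 := integrable_rayDeriv ψ 0 r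
  simp only [rayDeriv, iteratedFDeriv_zero_apply] at h1 h2
  simp only [sphericalMean, add_apply, Pi.add_apply]
  rw [integral_add h1 h2, smul_add]

theorem sphericalMean_smul (c : ℂ) (φ : 𝓢(Eucl m, ℂ)) :
    sphericalMean (c • φ) = c • sphericalMean φ := by
  funext r
  simp only [sphericalMean, smul_apply, Pi.smul_apply]
  rw [integral_smul, smul_comm]

theorem finitePart_add (μ : ℂ) (φ ψ : 𝓢(Eucl m, ℂ)) :
    finitePart μ (sphericalMean (φ + ψ)) =
      finitePart μ (sphericalMean φ) + finitePart μ (sphericalMean ψ) := by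
  have hd : ∀ k, iteratedDeriv k (sphericalMean (φ + ψ)) 0 =
      iteratedDeriv k (sphericalMean φ) 0 + iteratedDeriv k (sphericalMean ψ) 0 := fun k => by
    rw [sphericalMean_add, iteratedDeriv_add
      ((contDiff_sphericalMean φ).of_le (by exact_mod_cast le_top)).contDiffAt
      ((contDiff_sphericalMean ψ).of_le (by exact_mod_cast le_top)).contDiffAt]
  have e1 := integral_add (integrableOn_inner μ φ) (integrableOn_inner μ ψ)
  have e2 := integral_add (integrableOn_outer μ φ) (integrableOn_outer μ ψ)
  simp only [finitePart, hd]
  rw [add_add_add_comm, add_add_add_comm (∫ r in Ioc (0 : ℝ) 1, _), ← e1, ← e2,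
    ← Finset.sum_add_distrib]
  congr 1
  · congr 1
    · refine integral_congr_ae (Eventually.of_forall fun r => ?_)
      simp only [sphericalMean_add, Pi.add_apply, add_div, add_mul, Finset.sum_add_distrib]
      ring
    · refine integral_congr_ae (Eventually.of_forall fun r => ?_)
      simp only [sphericalMean_add, Pi.add_apply]
      ring
  · exact Finset.sum_congr rfl fun k _ => by ring

theorem finitePart_smul (μ : ℂ) (c : ℂ) (φ : 𝓢(Eucl m, ℂ)) :
    finitePart μ (sphericalMean (c • φ)) = c * finitePart μ (sphericalMean φ) := by
  have hd : ∀ k, iteratedDeriv k (sphericalMean (c • φ)) 0 =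
      c * iteratedDeriv k (sphericalMean φ) 0 := fun k => by
    rw [sphericalMean_smul, iteratedDeriv_const_smul_field, smul_eq_mul]
  simp only [finitePart, hd]
  rw [sphericalMean_smul, mul_add, mul_add, ← integral_const_mul, ← integral_const_mul,
    Finset.mul_sum]
  congr 1
  · congr 1
    · refine integral_congr_ae (Eventually.of_forall fun r => ?_)
      simp only [Pi.smul_apply, smul_eq_mul]
      rw [mul_left_comm, mul_sub c, Finset.mul_sum]
      congr 2
      exact Finset.sum_congr rfl fun k _ => by ring
    · refine integral_congr_ae (Eventually.of_forall fun r => ?_)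
      simp only [Pi.smul_apply, smul_eq_mul]
      ring
  · exact Finset.sum_congr rfl fun k _ => by ring

theorem norm_finitePart_le (μ : ℂ) : ∃ C : ℝ, 0 ≤ C ∧ ∀ φ : 𝓢(Eucl m, ℂ),
    ‖finitePart μ (sphericalMean φ)‖ ≤ C * ctrl (⌈μ.re⌉₊ + 2) ⌈-μ.re⌉₊ φ := by
  refine ⟨1 + (∫ r in Ioi (1 : ℝ), r ^ (-2 : ℝ)) +
    ∑ k ∈ Finset.range ⌈-μ.re⌉₊, ‖(k.factorial : ℂ)‖⁻¹ * ‖μ + k + 1‖⁻¹, ?_, fun φ => ?_⟩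
  · have : 0 ≤ ∫ r in Ioi (1 : ℝ), r ^ (-2 : ℝ) := setIntegral_nonneg measurableSet_Ioi
      fun r hr => Real.rpow_nonneg (zero_le_one.trans (le_of_lt hr)) _
    positivity
  set P := ctrl (⌈μ.re⌉₊ + 2) ⌈-μ.re⌉₊ φ with hP
  rw [add_mul, add_mul]
  unfold finitePart
  refine (norm_add_le _ _).trans (add_le_add ((norm_add_le _ _).trans (add_le_add ?_ ?_)) ?_)
  · have h := norm_setIntegral_le_of_norm_le_const (μ := volume) (s := Ioc (0 : ℝ) 1)
      (by simp) (fun r hr => norm_inner_le μ (⌈μ.re⌉₊ + 2) φ hr)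
    simpa [mul_comm] using h
  · have hi : IntegrableOn (fun r : ℝ => P * r ^ (-2 : ℝ)) (Ioi 1) :=
      (integrableOn_Ioi_rpow_of_lt (by norm_num) zero_lt_one).const_mul _
    have h := norm_integral_le_of_norm_le hi
      ((ae_restrict_iff' measurableSet_Ioi).2
        (Eventually.of_forall fun r hr => norm_outer_le μ ⌈-μ.re⌉₊ φ hr))
    rwa [integral_const_mul, mul_comm] at h
  · rw [Finset.sum_mul]
    refine (norm_sum_le _ _).trans (Finset.sum_le_sum fun k hk => ?_)
    have h := norm_iteratedDeriv_sphericalMean_le (K := ⌈μ.re⌉₊ + 2)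
      (le_of_lt (Finset.mem_range.1 hk)) φ 0
    rw [norm_div, norm_div, div_eq_mul_inv, div_eq_mul_inv, mul_assoc, mul_comm]
    gcongr

end Continuity

/-- The radial distribution `T_λ = Fp r^λ`, acting by `σ_m ⟨Fp r₊^(λ+m-1), Σ⁽⁰⁾[φ]⟩`. -/
noncomputable def radialDist (m : ℕ) (lam : ℂ) : 𝓢'(Eucl m, ℂ) :=
  ContinuousLinearMap.toPointwiseConvergenceCLM _ _ _ _ <|
    SchwartzMap.mkCLMtoNormedSpace (𝕜 := ℂ) (σ := RingHom.id ℂ)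
      (fun φ : 𝓢(Eucl m, ℂ) =>
        (sphereArea m : ℂ) * finitePart (lam + m - 1) (sphericalMean φ))
      (fun φ ψ => by rw [finitePart_add, mul_add])
      (fun c φ => by rw [finitePart_smul]; simp only [RingHom.id_apply, smul_eq_mul]; ring)
      (by
        obtain ⟨C, hC, h⟩ := norm_finitePart_le (m := m) (lam + m - 1)
        refine ⟨Finset.Iic (⌈(lam + m - 1).re⌉₊ + 2, ⌈-(lam + m - 1).re⌉₊), ‖(sphereArea m : ℂ)‖ * (C * 2 ^ (⌈(lam + m - 1).re⌉₊ + 2)), by positivity,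
          fun φ => ?_⟩
        rw [norm_mul, mul_assoc]
        gcongr
        refine (h φ).trans (le_of_eq ?_)
        rw [ctrl, mul_assoc])

theorem radialDist_apply (m : ℕ) (lam : ℂ) (φ : 𝓢(Eucl m, ℂ)) :
    radialDist m lam φ =
      (sphereArea m : ℂ) * finitePart (lam + m - 1) (sphericalMean φ) := rfl

/-- The distribution `(-Δ)^l δ` for a natural number `l`. -/
noncomputable def negLaplacianDelta (m l : ℕ) : 𝓢'(Eucl m, ℂ) :=
  (fun f : 𝓢'(Eucl m, ℂ) => -Δ f)^[l] (TemperedDistribution.delta 0)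

open Classical in
/-- The normalized radial distribution `T*_λ`. For `λ ≠ -m-2l` it is
`π^((λ+m)/2) T_λ / Γ((λ+m)/2)`, while
`T*_(-m-2l) = π^(m/2-l) / (2^(2l) Γ(m/2+l)) (-Δ)^l δ` for `l = 0, 1, 2, …`. -/
noncomputable def normRadialDist (m : ℕ) (lam : ℂ) : 𝓢'(Eucl m, ℂ) :=
  if h : ∃ l : ℕ, lam = -(m : ℂ) - 2 * l then
    ((Real.pi : ℂ) ^ ((m : ℂ) / 2 - h.choose) /
      (2 ^ (2 * h.choose) * Complex.Gamma ((m : ℂ) / 2 + h.choose))) •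
        negLaplacianDelta m h.choose
  else
    ((Real.pi : ℂ) ^ ((lam + m) / 2) / Complex.Gamma ((lam + m) / 2)) • radialDist m lam

/-- The convolution kernel `(-Δ)^β δ` of the complex power `(-Δ)^β` of the Laplace operator, for
`β ≠ -m/2, -m/2-1, …`, i.e.
`2^(2β) Γ((m+2β)/2) / π^((m-2β)/2) T*_(-m-2β)`. -/
noncomputable def laplacePowDelta (m : ℕ) (β : ℂ) : 𝓢'(Eucl m, ℂ) :=
  ((2 : ℂ) ^ (2 * β) * (Complex.Gamma (((m : ℂ) + 2 * β) / 2) /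
    (Real.pi : ℂ) ^ (((m : ℂ) - 2 * β) / 2))) • normRadialDist m (-(m : ℂ) - 2 * β)

/-- The regularization `x ↦ ⟨S_y, φ(x + y)⟩` of the distribution `S`. -/
noncomputable def regularization {m : ℕ} (S : 𝓢'(Eucl m, ℂ)) (φ : 𝓢(Eucl m, ℂ)) (x : Eucl m) : ℂ :=
  S (SchwartzMap.compSubConstCLM ℂ (-x) φ)

/-- Integrable distributions (the space `𝓓'_{L¹}`): those that are continuous for the topology of
uniform convergence of all derivatives. -/
def IsIntegrableDist {m : ℕ} (U : 𝓢'(Eucl m, ℂ)) : Prop :=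
  ∃ (k : ℕ) (C : ℝ), ∀ φ : 𝓢(Eucl m, ℂ),
    ‖U φ‖ ≤ C * ∑ j ∈ Finset.range (k + 1), SchwartzMap.seminorm ℂ 0 j φ

/-- Approximate units: sequences of compactly supported test functions, each derivative of which is
bounded uniformly along the sequence, and which on every ball are eventually equal to `1`. -/
def IsApproxUnit {m : ℕ} (χ : ℕ → 𝓢(Eucl m, ℂ)) : Prop :=
  (∀ n, HasCompactSupport (χ n)) ∧
  (∀ j, ∃ C : ℝ, ∀ n, SchwartzMap.seminorm ℂ 0 j (χ n) ≤ C) ∧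
  (∀ R : ℝ, ∀ᶠ n in atTop, ∀ x : Eucl m, ‖x‖ ≤ R → χ n x = 1)

/-- `⟨U, 1⟩ = c`: the integrable distribution `U` takes the value `c` at the constant function `1`,
where `⟨U, 1⟩` is the limit of `⟨U, χ_n⟩` for every approximate unit `χ`. -/
def HasIntegral {m : ℕ} (U : 𝓢'(Eucl m, ℂ)) (c : ℂ) : Prop :=
  IsIntegrableDist U ∧
    ∀ χ : ℕ → 𝓢(Eucl m, ℂ), IsApproxUnit χ → Tendsto (fun n => U (χ n)) atTop (𝓝 c)

/-- The tempered distributions `S` and `T` are convolvable and `S ∗ T = V`. That is, for each test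
function `φ` the product of the regularization `x ↦ ⟨S_y, φ(x + y)⟩` (a smooth function of
temperate growth) with `T` is an integrable distribution, and its pairing with the constant
function `1` is `⟨V, φ⟩`. -/
def IsConvolution {m : ℕ} (S T V : 𝓢'(Eucl m, ℂ)) : Prop :=
  ∀ φ : 𝓢(Eucl m, ℂ), (regularization S φ).HasTemperateGrowth ∧
    HasIntegral (TemperedDistribution.smulLeftCLM ℂ (regularization S φ) T) (V φ)

/-- `(-Δ)^β [f] = g`, where `(-Δ)^β [f] = (-Δ)^β δ ∗ f`. -/
def IsLaplacePow (m : ℕ) (β : ℂ) (f g : 𝓢'(Eucl m, ℂ)) : Prop :=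
  IsConvolution (laplacePowDelta m β) f g

/-- `K` is a fundamental solution of the operator `(-Δ)^β`. -/
def IsFundamentalSolution (m : ℕ) (β : ℂ) (K : 𝓢'(Eucl m, ℂ)) : Prop :=
  IsLaplacePow m β K (TemperedDistribution.delta 0)

/-- The Riesz kernel `K_β = (-Δ)^(-β) δ`. -/
noncomputable def rieszKernel (m : ℕ) (β : ℂ) : 𝓢'(Eucl m, ℂ) := laplacePowDelta m (-β)

end RieszDist

/-! On the Fourier side the kernel of $(-\Delta)^\beta$ is multiplication by $(2\pi|\xi|)^{2\beta}$,
so the two symbols cancel. One of them is singular at the origin, and the convolution is a limit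
along approximate units, so the cancellation has to be proved for regularized integrals.

Convolvability is a matter of size. Each kernel is a finite-order functional near the origin plus
something dominated by $|x|^{-m-2\operatorname{Re}\beta}$ away from it
(`isControlled_laplacePowDelta`). By Peetre's inequality its regularization $\psi$ is then
$O((1+|x|)^{-m-2\operatorname{Re}\beta})$. The exponents for $\beta$ and $-\beta$ add up to
$-2m<-m$, so the product of $\psi$ with the other kernel is an integrable distribution
(`isIntegrableDist_of_isControlled`).

The value at $1$ rests on the formula $\int|x|^\lambda\,\widehat
f=c(\lambda)\int|\xi|^{-m-\lambda}f$ for $-m<\operatorname{Re}\lambda<0$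
(`integral_norm_cpow_mul_fourier`), obtained by writing powers as Mellin transforms of Gaussians.
Both sides continue holomorphically in $\lambda$, with singularities on the real axis only, so an
identity theorem on strips (`eq_of_eqOn_strip`) extends the formula. For Schwartz functions this
gives the symbol of $(-\Delta)^\alpha\delta$ when $\operatorname{Re}\alpha\ge0$
(`laplacePowDelta_eq_integral_fourier`). For the regularization $\psi=\mathcal
F^{-1}\big((2\pi|\xi|)^{2\alpha}\widehat\varphi\big)$, which is in general not Schwartz, it gives
the central identity that the Riesz kernel sends $\psi$ to $\varphi(0)$
(`rieszConst_mul_rieszFunctional`).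

For $\operatorname{Re}\beta\ge0$, $\beta\ne0$, the approximate units pass to the limit in this
identity directly (`tendsto_smulLeftCLM_regularization`). For $\operatorname{Re}\beta<0$ the roles
are exchanged: the regularized kernel is a locally integrable function $c|y|^{-m+2\alpha}$ with
$\alpha=-\beta$. Fubini on the Fourier side moves the other kernel under the $y$-integral, and
dominated convergence leads back to the same identity (`tendsto_smulLeftCLM_regularization_neg`).
For $\beta=0$ both kernels are $\delta$. -/

namespace RieszDist

/-! ### Holomorphic parameter integrals and the identity theorem on strips. -/

theorem rpow_le_add_rpow {w a b s : ℝ} (hw : 0 < w) (ha : a ≤ s) (hb : s ≤ b) :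
    w ^ s ≤ w ^ a + w ^ b := by
  rcases le_total 1 w with h | h
  · exact (Real.rpow_le_rpow_of_exponent_le h hb).trans
      (le_add_of_nonneg_left (Real.rpow_nonneg hw.le _))
  · exact (Real.rpow_le_rpow_of_exponent_ge hw h ha).trans
      (le_add_of_nonneg_right (Real.rpow_nonneg hw.le _))

/-- The two endpoint exponents dominate every exponent between them: where $w\ge1$ the larger one
wins, where $w\le1$ the smaller one. -/
theorem integrable_cpow_mul {X : Type*} [MeasurableSpace X] {ν : Measure X} {w : X → ℝ}
    {g : X → ℂ} (hw : Measurable w) (hw0 : ∀ᵐ x ∂ν, 0 < w x) (hg : AEStronglyMeasurable g ν)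
    {a b : ℝ} (ha : Integrable (fun x => w x ^ a * ‖g x‖) ν)
    (hb : Integrable (fun x => w x ^ b * ‖g x‖) ν) {z : ℂ} (haz : a ≤ z.re) (hzb : z.re ≤ b) :
    Integrable (fun x => (w x : ℂ) ^ z * g x) ν := by
  refine Integrable.mono' (ha.add hb) (AEStronglyMeasurable.mul ?_ hg) ?_
  · exact ((Complex.measurable_ofReal.comp hw).pow_const z).aestronglyMeasurable
  · filter_upwards [hw0] with x hx
    rw [norm_mul, Complex.norm_cpow_eq_rpow_re_of_pos hx, Pi.add_apply, ← add_mul]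
    exact mul_le_mul_of_nonneg_right (rpow_le_add_rpow hx haz hzb) (norm_nonneg _)

/-- Integrals `∫ w(x)^z g(x) dν(x)` are holomorphic in the interior of their strip of absolute
convergence. -/
theorem differentiableAt_integral_cpow {X : Type*} [MeasurableSpace X] {ν : Measure X} {w : X → ℝ}
    {g : X → ℂ} (hw : Measurable w) (hw0 : ∀ᵐ x ∂ν, 0 < w x) (hg : AEStronglyMeasurable g ν)
    {a b : ℝ} (ha : Integrable (fun x => w x ^ a * ‖g x‖) ν)
    (hb : Integrable (fun x => w x ^ b * ‖g x‖) ν) {z₀ : ℂ} (haz : a < z₀.re) (hzb : z₀.re < b) :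
    DifferentiableAt ℂ (fun z : ℂ => ∫ x, (w x : ℂ) ^ z * g x ∂ν) z₀ := by
  -- The margin $2\varepsilon$ is spent twice: $\varepsilon$ for the neighbourhood of $z_0$ and
  -- $\varepsilon$ for the Cauchy circles around its points.
  obtain ⟨ε, hε, h1, h2⟩ : ∃ ε : ℝ, 0 < ε ∧ a ≤ z₀.re - 2 * ε ∧ z₀.re + 2 * ε ≤ b := by
    refine ⟨min (z₀.re - a) (b - z₀.re) / 2, by
      have := sub_pos.2 haz; have := sub_pos.2 hzb; positivity, ?_, ?_⟩
    · have := min_le_left (z₀.re - a) (b - z₀.re); linarith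
    · have := min_le_right (z₀.re - a) (b - z₀.re); linarith
  have hm : ∀ z : ℂ, AEStronglyMeasurable (fun x => (w x : ℂ) ^ z * g x) ν := fun z =>
    ((Complex.measurable_ofReal.comp hw).pow_const z).aestronglyMeasurable.mul hg
  refine (hasDerivAt_integral_of_dominated_loc_of_deriv_le (s := Metric.ball z₀ ε)
    (F' := fun z x => (w x : ℂ) ^ z * Complex.log (w x) * g x)
    (bound := fun x => (w x ^ a * ‖g x‖ + w x ^ b * ‖g x‖) / ε)
    (Metric.ball_mem_nhds _ hε) (Eventually.of_forall hm)
    (integrable_cpow_mul hw hw0 hg ha hb haz.le hzb.le) ?_ ?_ ((ha.add hb).div_const ε)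
    ?_).2.differentiableAt
  · refine AEStronglyMeasurable.mul (Measurable.aestronglyMeasurable ?_) hg
    exact ((Complex.measurable_ofReal.comp hw).pow_const z₀).mul
      (Complex.measurable_log.comp (Complex.measurable_ofReal.comp hw))
  · filter_upwards [hw0] with x hx z hz
    have hx' : (w x : ℂ) ≠ 0 := by exact_mod_cast hx.ne'
    have hd : HasDerivAt (fun z : ℂ => (w x : ℂ) ^ z) ((w x : ℂ) ^ z * Complex.log (w x)) z := by
      simpa using (hasDerivAt_id z).const_cpow (c := (w x : ℂ)) (Or.inl hx')
    have hD : Differentiable ℂ (fun z : ℂ => (w x : ℂ) ^ z) :=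
      fun z => ((hasDerivAt_id z).const_cpow (c := (w x : ℂ)) (Or.inl hx')).differentiableAt
    -- Cauchy's estimate on a circle of radius $\varepsilon$ bounds $w^z\log w$ by endpoint powers,
    -- so the logarithm needs no separate estimate.
    have hb := Complex.norm_deriv_le_of_forall_mem_sphere_norm_le (c := z) (C := w x ^ a + w x ^ b)
      hε hD.diffContOnCl fun z' hz' => by
        rw [Complex.norm_cpow_eq_rpow_re_of_pos hx]
        have e1 : |z'.re - z.re| ≤ ε := by
          rw [← Complex.sub_re]
          exact (Complex.abs_re_le_norm _).trans_eq (mem_sphere_iff_norm.1 hz')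
        have e2 : |z.re - z₀.re| ≤ ε := by
          rw [← Complex.sub_re]
          exact (Complex.abs_re_le_norm _).trans (mem_ball_iff_norm.1 hz).le
        rw [abs_le] at e1 e2
        exact rpow_le_add_rpow hx (by linarith) (by linarith)
    rw [hd.deriv] at hb
    rw [norm_mul, ← add_mul, mul_div_right_comm]
    exact mul_le_mul_of_nonneg_right hb (norm_nonneg _)
  · filter_upwards [hw0] with x hx z hz
    have hx' : (w x : ℂ) ≠ 0 := by exact_mod_cast hx.ne'
    simpa using ((hasDerivAt_id z).const_cpow (c := (w x : ℂ)) (Or.inl hx')).mul_const (g x)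

/-- A half-strip. -/
theorem eqOn_halfStrip {f g : ℂ → ℂ} {a b c d s : ℝ} (hac : a ≤ c) (hcd : c < d) (hdb : d ≤ b)
    (hs : s ≠ 0)
    (hf : ∀ z : ℂ, a < z.re → z.re < b → z.im ≠ 0 → DifferentiableAt ℂ f z)
    (hg : ∀ z : ℂ, a < z.re → z.re < b → z.im ≠ 0 → DifferentiableAt ℂ g z)
    (h : ∀ z : ℂ, c < z.re → z.re < d → f z = g z) {z : ℂ} (hz1 : a < z.re) (hz2 : z.re < b)
    (hz3 : 0 < s * z.im) : f z = g z := by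
  set U : Set ℂ := {z | a < z.re} ∩ {z | z.re < b} ∩ {z | 0 < s * z.im} with hU
  have hUo : IsOpen U := by
    refine ((isOpen_lt continuous_const Complex.continuous_re).inter
      (isOpen_lt Complex.continuous_re continuous_const)).inter
      (isOpen_lt continuous_const (continuous_const.mul Complex.continuous_im))
  have hUc : Convex ℝ U := by
    refine ((convex_halfSpace_re_gt a).inter (convex_halfSpace_re_lt b)).inter ?_
    exact convex_halfSpace_gt (f := fun z : ℂ => s * z.im)
      ⟨fun x y => by simp [mul_add], fun c x => by simp; ring⟩ 0
  have him : ∀ z ∈ U, z.im ≠ 0 := fun z hz h0 => by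
    have := hz.2
    simp [h0] at this
  have hfa : AnalyticOnNhd ℂ f U := DifferentiableOn.analyticOnNhd
    (fun z hz => (hf z hz.1.1 hz.1.2 (him z hz)).differentiableWithinAt) hUo
  have hga : AnalyticOnNhd ℂ g U := DifferentiableOn.analyticOnNhd
    (fun z hz => (hg z hz.1.1 hz.1.2 (him z hz)).differentiableWithinAt) hUo
  -- The imaginary part $s$ puts the base point on the correct side of the real axis, since $s\cdot
  -- s>0$.
  set z₀ : ℂ := ⟨(c + d) / 2, s⟩ with hz₀
  have hz₀U : z₀ ∈ U := by
    refine ⟨⟨?_, ?_⟩, ?_⟩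
    · change a < (c + d) / 2; linarith
    · change (c + d) / 2 < b; linarith
    · change 0 < s * s; exact mul_self_pos.2 hs
  refine hfa.eqOn_of_preconnected_of_eventuallyEq hga hUc.isPreconnected hz₀U ?_ ⟨⟨hz1, hz2⟩, hz3⟩
  have h1 : {z : ℂ | c < z.re} ∈ 𝓝 z₀ :=
    (isOpen_lt continuous_const Complex.continuous_re).mem_nhds (by
      change c < (c + d) / 2; linarith)
  have h2 : {z : ℂ | z.re < d} ∈ 𝓝 z₀ :=
    (isOpen_lt Complex.continuous_re continuous_const).mem_nhds (by
      change (c + d) / 2 < d; linarith)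
  filter_upwards [h1, h2] with z hz1 hz2 using h z hz1 hz2

/-- The identity theorem on a strip, for functions that may have singularities on the real axis. -/
theorem eq_of_eqOn_strip {f g : ℂ → ℂ} {a b c d : ℝ} (hac : a ≤ c) (hcd : c < d) (hdb : d ≤ b)
    (hf : ∀ z : ℂ, a < z.re → z.re < b → z.im ≠ 0 → DifferentiableAt ℂ f z)
    (hg : ∀ z : ℂ, a < z.re → z.re < b → z.im ≠ 0 → DifferentiableAt ℂ g z)
    (h : ∀ z : ℂ, c < z.re → z.re < d → f z = g z) {z : ℂ} (hz1 : a < z.re) (hz2 : z.re < b)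
    (hfz : ContinuousAt f z) (hgz : ContinuousAt g z) : f z = g z := by
  -- The point $z$ is approached vertically, away from the real axis on its own side (from above if
  -- $z$ is real). The identity holds along the path, and continuity at $z$ finishes.
  have key : ∀ t : ℝ, 0 < t → f (z + t * (if 0 ≤ z.im then Complex.I else -Complex.I)) =
      g (z + t * (if 0 ≤ z.im then Complex.I else -Complex.I)) := by
    intro t ht
    split_ifs with h0
    · refine eqOn_halfStrip (s := 1) hac hcd hdb one_ne_zero hf hg h ?_ ?_ ?_ <;> simp <;> linarith
    · refine eqOn_halfStrip (s := -1) hac hcd hdb (by norm_num) hf hg h ?_ ?_ ?_ <;>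
        simp <;> linarith
  set u : ℂ := if 0 ≤ z.im then Complex.I else -Complex.I
  have hl : Tendsto (fun t : ℝ => z + t * u) (𝓝[>] 0) (𝓝 z) := by
    have : Continuous (fun t : ℝ => z + t * u) := by fun_prop
    simpa using (this.tendsto 0).mono_left nhdsWithin_le_nhds
  refine tendsto_nhds_unique (hfz.tendsto.comp hl) ((hgz.tendsto.comp hl).congr' ?_)
  filter_upwards [self_mem_nhdsWithin] with t ht using (key t ht).symm

/-! ### Polar coordinates and integrability of power weights. -/

section Polar

variable {m : ℕ}

theorem nontrivial_eucl (hm : 1 ≤ m) : Nontrivial (Eucl m) := by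
  have : Nonempty (Fin m) := ⟨⟨0, hm⟩⟩
  infer_instance

/-- Integration in polar coordinates. -/
theorem integral_polar (hm : 1 ≤ m) {F : Type*} [NormedAddCommGroup F] [NormedSpace ℝ F]
    {f : Eucl m → F} (hf : Integrable f) :
    ∫ x, f x = ∫ r in Ioi (0 : ℝ), r ^ (m - 1) • ∫ ω, f (r • (ω : Eucl m)) ∂(sphereMeasure m) := by
  have := nontrivial_eucl hm
  have hfr : Module.finrank ℝ (Eucl m) = m := finrank_euclideanSpace_fin
  have mp := (volume : Measure (Eucl m)).measurePreserving_homeomorphUnitSphereProd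
  have hemb := (homeomorphUnitSphereProd (Eucl m)).measurableEmbedding
  set g : Metric.sphere (0 : Eucl m) 1 × Ioi (0 : ℝ) → F := fun p => f (p.2.1 • (p.1 : Eucl m))
  have hg : ∀ x : ({0}ᶜ : Set (Eucl m)), g (homeomorphUnitSphereProd (Eucl m) x) = f x := by
    intro x
    have := congrArg Subtype.val ((homeomorphUnitSphereProd (Eucl m)).symm_apply_apply x)
    rw [homeomorphUnitSphereProd_symm_apply_coe] at this
    simp only [g, this]
  have hi : Integrable g ((sphereMeasure m).prod
      (Measure.volumeIoiPow (Module.finrank ℝ (Eucl m) - 1))) := by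
    rw [← mp.integrable_comp_emb hemb]
    have e : g ∘ homeomorphUnitSphereProd (Eucl m) = fun x : ({0}ᶜ : Set (Eucl m)) => f x := funext hg
    rw [e]
    exact (integrableOn_iff_comap_subtypeVal (measurableSet_singleton _).compl).1 hf.integrableOn
  calc ∫ x, f x = ∫ x : ({0}ᶜ : Set (Eucl m)), f x ∂(volume.comap Subtype.val) := by
        rw [integral_subtype_comap (measurableSet_singleton _).compl f, restrict_compl_singleton]
    _ = ∫ p, g p ∂(sphereMeasure m).prod
          (Measure.volumeIoiPow (Module.finrank ℝ (Eucl m) - 1)) := by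
        rw [← mp.integral_comp hemb]
        exact integral_congr_ae (Eventually.of_forall fun x => (hg x).symm)
    _ = ∫ r : Ioi (0 : ℝ), ∫ ω, f (r.1 • (ω : Eucl m)) ∂(sphereMeasure m)
          ∂(Measure.volumeIoiPow (Module.finrank ℝ (Eucl m) - 1)) := integral_prod_symm _ hi
    _ = _ := by
        simp only [Measure.volumeIoiPow, ENNReal.ofReal, hfr]
        rw [integral_withDensity_eq_integral_smul,
          integral_subtype_comap measurableSet_Ioi fun r => Real.toNNReal (r ^ (m - 1)) •
            ∫ ω, f (r • (ω : Eucl m)) ∂(sphereMeasure m)]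
        · refine setIntegral_congr_fun measurableSet_Ioi fun r hr => ?_
          rw [NNReal.smul_def, Real.coe_toNNReal _ (pow_nonneg (le_of_lt hr) _)]
        · exact (measurable_subtype_coe.pow_const _).real_toNNReal

/-- Integration in polar coordinates over a radial region. -/
theorem setIntegral_polar (hm : 1 ≤ m) {F : Type*} [NormedAddCommGroup F] [NormedSpace ℝ F]
    {f : Eucl m → F} {s : Set ℝ} (hs : MeasurableSet s)
    (hf : IntegrableOn f {x | ‖x‖ ∈ s}) :
    ∫ x in {x | ‖x‖ ∈ s}, f x = ∫ r in Ioi (0 : ℝ) ∩ s, r ^ (m - 1) •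
      ∫ ω, f (r • (ω : Eucl m)) ∂(sphereMeasure m) := by
  have hs' : MeasurableSet {x : Eucl m | ‖x‖ ∈ s} := measurable_norm hs
  rw [← integral_indicator hs', integral_polar hm ((integrable_indicator_iff hs').2 hf),
    ← setIntegral_indicator hs]
  refine setIntegral_congr_fun measurableSet_Ioi fun r hr => ?_
  have hn : ∀ ω : Metric.sphere (0 : Eucl m) 1, ‖r • (ω : Eucl m)‖ = r := fun ω => by
    rw [norm_smul, norm_eq_of_mem_sphere, mul_one, Real.norm_of_nonneg (le_of_lt hr)]
  by_cases h : r ∈ s <;> simp [indicator, hn, h]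

theorem ae_norm_pos (hm : 1 ≤ m) : ∀ᵐ x : Eucl m, 0 < ‖x‖ := by
  have := nontrivial_eucl hm
  filter_upwards [compl_mem_ae_iff.2 (measure_singleton (0 : Eucl m))] with x hx
  exact norm_pos_iff.2 hx

theorem integrableOn_norm_rpow_closedBall (hm : 1 ≤ m) {a : ℝ} (ha : -m < a) :
    IntegrableOn (fun x : Eucl m => ‖x‖ ^ a) (Metric.closedBall 0 1) := by
  have := nontrivial_eucl hm
  have h : IntegrableOn (fun x : Eucl m => ‖x‖ ^ a) (Metric.ball 0 2) := by
    rw [integrableOn_fun_norm_addHaar volume (f := fun r => r ^ a)]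
    have e : ∀ r ∈ Ioo (0 : ℝ) 2, r ^ (a + (m - 1)) =
        r ^ (Module.finrank ℝ (Eucl m) - 1) • r ^ a := by
      intro r hr
      rw [finrank_euclideanSpace_fin, smul_eq_mul, Real.rpow_add hr.1, mul_comm,
        ← Real.rpow_natCast r (m - 1), Nat.cast_sub hm, Nat.cast_one]
    refine IntegrableOn.congr_fun ?_ e measurableSet_Ioo
    rw [← intervalIntegrable_iff_integrableOn_Ioo_of_le (by norm_num)]
    exact intervalIntegral.intervalIntegrable_rpow' (by linarith)
  exact h.mono_set (Metric.closedBall_subset_ball (by norm_num))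

theorem one_add_norm_rpow_le {E : Type*} [SeminormedAddCommGroup E] (a : ℝ) {z : E} (hz : 1 ≤ ‖z‖) :
    (1 + ‖z‖) ^ a ≤ 2 ^ |a| * ‖z‖ ^ a ∧ ‖z‖ ^ a ≤ 2 ^ |a| * (1 + ‖z‖) ^ a := by
  have h0 : 0 < ‖z‖ := by linarith
  have h1 : (1 : ℝ) ≤ 2 ^ |a| := Real.one_le_rpow (by norm_num) (abs_nonneg a)
  rcases le_total 0 a with h | h
  · rw [abs_of_nonneg h, ← Real.mul_rpow (by norm_num) h0.le] at *
    refine ⟨Real.rpow_le_rpow (by linarith) (by linarith) h, ?_⟩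
    have : ‖z‖ ^ a ≤ (1 + ‖z‖) ^ a := Real.rpow_le_rpow h0.le (by linarith) h
    have h2 : 0 ≤ (1 + ‖z‖) ^ a := by positivity
    nlinarith
  · rw [abs_of_nonpos h] at *
    constructor
    · have : (1 + ‖z‖) ^ a ≤ ‖z‖ ^ a := Real.rpow_le_rpow_of_nonpos h0 (by linarith) h
      have h2 : 0 ≤ ‖z‖ ^ a := by positivity
      nlinarith
    · have e : (2 : ℝ) ^ (-a) * (1 + ‖z‖) ^ a = ((1 + ‖z‖) / 2) ^ a := by
        rw [Real.div_rpow (by positivity) (by norm_num), Real.rpow_neg (by norm_num)]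
        field_simp
      rw [e]
      exact Real.rpow_le_rpow_of_nonpos (by positivity) (by linarith) h

theorem integrableOn_norm_rpow_compl (m : ℕ) {a : ℝ} (ha : a < -m) :
    IntegrableOn (fun x : Eucl m => ‖x‖ ^ a) (Metric.closedBall 0 1)ᶜ := by
  have h := integrable_one_add_norm (E := Eucl m) (μ := volume) (r := -a)
    (by rw [finrank_euclideanSpace_fin]; linarith)
  refine Integrable.mono' (h.integrableOn.const_mul (2 ^ |a|)) ?_ ?_
  · exact (measurable_norm.pow_const a).aestronglyMeasurable
  · refine (ae_restrict_iff' Metric.isClosed_closedBall.measurableSet.compl).2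
      (Eventually.of_forall fun x hx => ?_)
    have hx : 1 < ‖x‖ := by simpa using hx
    rw [neg_neg, Real.norm_of_nonneg (by positivity)]
    exact (one_add_norm_rpow_le a hx.le).2

/-- Peetre's inequality. -/
theorem one_add_norm_rpow_peetre {E : Type*} [SeminormedAddCommGroup E] (a : ℝ) (x z : E) :
    (1 + ‖z‖) ^ a ≤ (1 + ‖x‖) ^ a * (1 + ‖z + x‖) ^ |a| := by
  rcases le_total 0 a with h | h
  · rw [abs_of_nonneg h, ← Real.mul_rpow (by positivity) (by positivity)]
    refine Real.rpow_le_rpow (by positivity) ?_ h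
    have : ‖z‖ ≤ ‖z + x‖ + ‖x‖ := by simpa using norm_sub_le (z + x) x
    nlinarith [norm_nonneg x, norm_nonneg (z + x)]
  · have h1 : (1 + ‖x‖) ^ (-a) ≤ ((1 + ‖z‖) * (1 + ‖z + x‖)) ^ (-a) := by
      refine Real.rpow_le_rpow (by positivity) ?_ (by linarith)
      have : ‖x‖ ≤ ‖z + x‖ + ‖z‖ := by simpa using norm_sub_le (z + x) z
      nlinarith [norm_nonneg z, norm_nonneg (z + x)]
    rw [Real.mul_rpow (by positivity) (by positivity), Real.rpow_neg (by positivity),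
      Real.rpow_neg (by positivity : (0 : ℝ) ≤ 1 + ‖z‖)] at h1
    rw [abs_of_nonpos h]
    have hx : 0 < (1 + ‖x‖) ^ a := by positivity
    have hz : 0 < (1 + ‖z‖) ^ a := by positivity
    rw [inv_mul_eq_div, inv_eq_one_div, div_le_div_iff₀ hx hz] at h1
    linarith

end Polar

end RieszDist

/-! ### Regularizations are smooth and of temperate growth. -/

namespace RieszDist

open scoped LineDeriv ContDiff

section Taylor

variable {E : Type} [NormedAddCommGroup E] [NormedSpace ℝ E]

/-- Two applications of the mean value inequality on the ball of radius $\|h\|$ about $y$: first to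
the derivative, then to $f-f'(y)$. The constant is not optimal, which is harmless. -/
theorem norm_taylor_one_le {F : Type} [NormedAddCommGroup F] [NormedSpace ℝ F] {f : E → F}
    (hf : ContDiff ℝ ∞ f) (h y : E) {M : ℝ}
    (hM : ∀ z, ‖z - y‖ ≤ ‖h‖ → ‖iteratedFDeriv ℝ 2 f z‖ ≤ M) :
    ‖f (y + h) - f y - fderiv ℝ f y h‖ ≤ M * ‖h‖ ^ 2 := by
  have hd : Differentiable ℝ f := hf.differentiable (by simp)
  have hdd : Differentiable ℝ (fderiv ℝ f) :=
    (hf.fderiv_right (m := ∞) (by simp)).differentiable (by simp)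
  have hconv : Convex ℝ (Metric.closedBall y ‖h‖) := convex_closedBall y ‖h‖
  have hy : y ∈ Metric.closedBall y ‖h‖ := Metric.mem_closedBall_self (norm_nonneg h)
  have hyh : y + h ∈ Metric.closedBall y ‖h‖ := by simp
  have hM0 : 0 ≤ M := (norm_nonneg _).trans (hM y (by simp))
  have h1 : ∀ z ∈ Metric.closedBall y ‖h‖, ‖fderiv ℝ f z - fderiv ℝ f y‖ ≤ M * ‖h‖ := by
    intro z hz
    have := hconv.norm_image_sub_le_of_norm_fderiv_le (f := fderiv ℝ f) (C := M)
      (fun x _ => hdd x) (fun x hx => by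
        have := hM x (mem_closedBall_iff_norm.1 hx)
        rwa [← norm_iteratedFDeriv_fderiv, ← norm_iteratedFDeriv_fderiv,
          norm_iteratedFDeriv_zero] at this) hy hz
    exact this.trans (mul_le_mul_of_nonneg_left (mem_closedBall_iff_norm.1 hz) hM0)
  have h2 := hconv.norm_image_sub_le_of_norm_hasFDerivWithin_le
    (f := fun z => f z - fderiv ℝ f y z) (f' := fun z => fderiv ℝ f z - fderiv ℝ f y)
    (fun z _ => ((hd z).hasFDerivAt.sub (fderiv ℝ f y).hasFDerivAt).hasFDerivWithinAt) h1 hy hyh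
  have e : f (y + h) - fderiv ℝ f y (y + h) - (f y - fderiv ℝ f y y) =
      f (y + h) - f y - fderiv ℝ f y h := by rw [map_add]; abel
  rw [e, add_sub_cancel_left] at h2
  exact h2.trans_eq (by ring)

/-- The derivative in $y$ of the Taylor remainder of $f$ is the Taylor remainder of `fderiv ℝ f`.
The induction therefore changes the codomain, which is why $F$ is quantified inside. -/
theorem norm_iteratedFDeriv_taylor_one_le (n : ℕ) :
    ∀ {F : Type} [NormedAddCommGroup F] [NormedSpace ℝ F] {f : E → F} (_ : ContDiff ℝ ∞ f)
      (h y : E) {M : ℝ} (_ : ∀ z, ‖z - y‖ ≤ ‖h‖ → ‖iteratedFDeriv ℝ (n + 2) f z‖ ≤ M),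
    ‖iteratedFDeriv ℝ n (fun y => f (y + h) - f y - fderiv ℝ f y h) y‖ ≤ M * ‖h‖ ^ 2 := by
  induction n with
  | zero =>
    intro F _ _ f hf h y M hM
    rw [norm_iteratedFDeriv_zero]
    exact norm_taylor_one_le hf h y hM
  | succ n ih =>
    intro F _ _ f hf h y M hM
    have hf' : ContDiff ℝ ∞ (fderiv ℝ f) := hf.fderiv_right (by simp)
    have hd : Differentiable ℝ f := hf.differentiable (by simp)
    have hdd : Differentiable ℝ (fderiv ℝ f) := hf'.differentiable (by simp)
    have e : fderiv ℝ (fun y => f (y + h) - f y - fderiv ℝ f y h) =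
        fun y => fderiv ℝ f (y + h) - fderiv ℝ f y - fderiv ℝ (fderiv ℝ f) y h := by
      funext y
      have h1 : HasFDerivAt (fun y => f (y + h)) (fderiv ℝ f (y + h)) y :=
        (hasFDerivAt_comp_add_right h).2 (hd _).hasFDerivAt
      have h2 : HasFDerivAt (fun y => fderiv ℝ f y h) (fderiv ℝ (fderiv ℝ f) y h) y := by
        have h3 := (hdd y).hasFDerivAt.clm_apply (hasFDerivAt_const h y)
        -- Differentiating $y\mapsto f'(y)h$ yields $v\mapsto f''(y)(v)(h)$; symmetry turns this
        -- into $f''(y)(h)$.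
        have hs : IsSymmSndFDerivAt ℝ f y :=
          hf.contDiffAt.isSymmSndFDerivAt (by simpa using WithTop.coe_le_coe.2 (le_top : (2 : ℕ∞) ≤ ⊤))
        convert h3 using 1
        ext v
        simpa using hs h v
      exact ((h1.sub (hd y).hasFDerivAt).sub h2).fderiv
    rw [← norm_iteratedFDeriv_fderiv, e]
    refine ih hf' h y fun z hz => ?_
    rw [norm_iteratedFDeriv_fderiv]
    exact hM z hz

end Taylor

variable {m : ℕ}

theorem exists_decay {F : Type} [NormedAddCommGroup F] [NormedSpace ℝ F] [NormedSpace ℂ F]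
    [SMulCommClass ℝ ℂ F] (φ : 𝓢(Eucl m, F)) (k n : ℕ) :
    ∃ K : ℝ, 0 ≤ K ∧ ∀ i ≤ n, ∀ z, (1 + ‖z‖) ^ k * ‖iteratedFDeriv ℝ i φ z‖ ≤ K :=
  ⟨2 ^ k * (Finset.Iic (k, n)).sup (schwartzSeminormFamily ℂ (Eucl m) F) φ,
    mul_nonneg (by positivity) (apply_nonneg _ _), fun _ hi z =>
    SchwartzMap.one_add_le_sup_seminorm_apply (𝕜 := ℂ) (m := (k, n)) le_rfl hi φ z⟩

/-- A continuous seminorm on Schwartz space is controlled by finitely many weighted bounds. -/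
theorem exists_seminorm_bound (q : Seminorm ℂ 𝓢(Eucl m, ℂ)) (hq : Continuous q) :
    ∃ (k : ℕ) (C : ℝ), 0 ≤ C ∧ ∀ (Φ : 𝓢(Eucl m, ℂ)) (A : ℝ),
      (∀ i ≤ k, ∀ y, (1 + ‖y‖) ^ k * ‖iteratedFDeriv ℝ i Φ y‖ ≤ A) → q Φ ≤ C * A := by
  obtain ⟨s, C, -, h⟩ := Seminorm.bound_of_continuous (schwartz_withSeminorms ℂ (Eucl m) ℂ) q hq
  -- One index serves both purposes: it exceeds every weight exponent and every order of
  -- differentiation in the finite family $s$.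
  refine ⟨s.sup Prod.fst + s.sup Prod.snd, C, C.2, fun Φ A hA => (h Φ).trans ?_⟩
  have hA0 : 0 ≤ A := le_trans (by positivity) (hA 0 (Nat.zero_le _) 0)
  rw [smul_apply]
  refine mul_le_mul_of_nonneg_left (Seminorm.finset_sup_apply_le hA0 fun p hp => ?_) C.2
  refine SchwartzMap.seminorm_le_bound ℂ _ _ Φ hA0 fun y => le_trans ?_ (hA p.2 ?_ y)
  · refine mul_le_mul_of_nonneg_right ?_ (norm_nonneg _)
    calc ‖y‖ ^ p.1 ≤ (1 + ‖y‖) ^ p.1 := by gcongr; linarith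
      _ ≤ _ := by
        refine pow_le_pow_right₀ (by linarith [norm_nonneg y]) ?_
        exact (Finset.le_sup (f := Prod.fst) hp).trans (Nat.le_add_right _ _)
  · exact (Finset.le_sup (f := Prod.snd) hp).trans (Nat.le_add_left _ _)

theorem exists_bound (S : 𝓢'(Eucl m, ℂ)) : ∃ (k : ℕ) (C : ℝ), 0 ≤ C ∧
    ∀ (Φ : 𝓢(Eucl m, ℂ)) (A : ℝ),
      (∀ i ≤ k, ∀ y, (1 + ‖y‖) ^ k * ‖iteratedFDeriv ℝ i Φ y‖ ≤ A) → ‖S Φ‖ ≤ C * A := by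
  let L : 𝓢(Eucl m, ℂ) →L[ℂ] ℂ := S
  exact exists_seminorm_bound ((normSeminorm ℂ ℂ).comp L.toLinearMap)
    (continuous_norm.comp L.continuous)

theorem iteratedFDeriv_translate {F : Type} [NormedAddCommGroup F] [NormedSpace ℝ F]
    [NormedSpace ℂ F] [SMulCommClass ℝ ℂ F] (φ : 𝓢(Eucl m, F)) (x y : Eucl m) (n : ℕ) :
    iteratedFDeriv ℝ n (SchwartzMap.compSubConstCLM ℂ (-x) φ) y =
      iteratedFDeriv ℝ n φ (y + x) := by
  have : ⇑(SchwartzMap.compSubConstCLM ℂ (-x) φ) = fun y => φ (y + x) := by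
    funext y; simp
  rw [this, iteratedFDeriv_comp_add_right]

/-- A tempered distribution grows at most polynomially along translates. -/
theorem norm_regularization_le (S : 𝓢'(Eucl m, ℂ)) (φ : 𝓢(Eucl m, ℂ)) :
    ∃ (k : ℕ) (C : ℝ), ∀ x, ‖regularization S φ x‖ ≤ C * (1 + ‖x‖) ^ k := by
  obtain ⟨k, C, hC, h⟩ := exists_bound S
  obtain ⟨K, hK, hd⟩ := exists_decay φ k k
  refine ⟨k, C * K, fun x => (h _ (K * (1 + ‖x‖) ^ k) fun i hi y => ?_).trans_eq (by ring)⟩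
  rw [iteratedFDeriv_translate]
  have h1 : (1 + ‖y‖) ^ k ≤ (1 + ‖y + x‖) ^ k * (1 + ‖x‖) ^ k := by
    rw [← mul_pow]
    gcongr
    have : ‖y‖ ≤ ‖y + x‖ + ‖x‖ := by simpa using norm_sub_le (y + x) x
    nlinarith [norm_nonneg x, norm_nonneg (y + x)]
  calc _ ≤ (1 + ‖y + x‖) ^ k * (1 + ‖x‖) ^ k * ‖iteratedFDeriv ℝ i φ (y + x)‖ := by gcongr
    _ = (1 + ‖y + x‖) ^ k * ‖iteratedFDeriv ℝ i φ (y + x)‖ * (1 + ‖x‖) ^ k := by ring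
    _ ≤ _ := by gcongr; exact hd i hi _

/-- The differential of the regularization of `S` at the origin. -/
noncomputable def regularizationFDeriv (S : 𝓢'(Eucl m, ℂ)) (φ : 𝓢(Eucl m, ℂ)) (x : Eucl m) :
    Eucl m →L[ℝ] ℂ :=
  LinearMap.toContinuousLinearMap
    { toFun := fun h => regularization S (∂_{h} φ) x
      map_add' := fun a b => by
        simp only [regularization, LineDeriv.lineDerivOp_left_add, map_add]
      map_smul' := fun c a => by
        have : ∂_{c • a} φ = (c : ℂ) • ∂_{a} φ := by
          ext y
          simp [SchwartzMap.lineDerivOp_apply_eq_fderiv]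
        simp only [regularization, this, map_smul, RingHom.id_apply, Complex.real_smul,
          smul_eq_mul] }

theorem regularizationFDeriv_apply (S : 𝓢'(Eucl m, ℂ)) (φ : 𝓢(Eucl m, ℂ)) (x h : Eucl m) :
    regularizationFDeriv S φ x h = regularization S (∂_{h} φ) x := rfl

/-- The remainder $\varphi(\cdot+v)-\varphi-\partial_v\varphi$, translated by $x$, is $O(\|v\|^2)$
in every Schwartz seminorm, and $S$ is bounded by finitely many of them. -/
theorem hasFDerivAt_regularization (S : 𝓢'(Eucl m, ℂ)) (φ : 𝓢(Eucl m, ℂ)) (x : Eucl m) :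
    HasFDerivAt (regularization S φ) (regularizationFDeriv S φ x) x := by
  obtain ⟨k, C, hC, h⟩ := exists_bound S
  set φx : 𝓢(Eucl m, ℂ) := SchwartzMap.compSubConstCLM ℂ (-x) φ with hφx
  obtain ⟨K, hK, hd⟩ := exists_decay φx k (k + 2)
  have key : ∀ v : Eucl m, ‖v‖ ≤ 1 → ‖regularization S φ (x + v) - regularization S φ x -
      regularizationFDeriv S φ x v‖ ≤ C * (2 ^ k * K) * ‖v‖ ^ 2 := by
    intro v hv
    set Φ : 𝓢(Eucl m, ℂ) := SchwartzMap.compSubConstCLM ℂ (-(x + v)) φ - φx -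
      SchwartzMap.compSubConstCLM ℂ (-x) (∂_{v} φ) with hΦ
    have e : ⇑Φ = fun y => φx (y + v) - φx y - fderiv ℝ φx y v := by
      funext y
      have e1 : fderiv ℝ φx y = fderiv ℝ φ (y + x) := by
        have : ⇑φx = fun y => φ (y + x) := by funext y; simp [hφx]
        rw [this, fderiv_comp_add_right]
      rw [e1]
      have e3 : y + (x + v) = y + v + x := by abel
      simp only [hΦ, hφx, sub_apply, SchwartzMap.compSubConstCLM_apply, sub_neg_eq_add, e3,
        SchwartzMap.lineDerivOp_apply_eq_fderiv]
    have e2 : regularization S φ (x + v) - regularization S φ x -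
        regularizationFDeriv S φ x v = S Φ := by
      rw [regularizationFDeriv_apply, hΦ, map_sub, map_sub]; rfl
    rw [e2, mul_assoc]
    refine h Φ _ fun i hi y => ?_
    rw [e]
    -- Since $\|v\|\le1$, the weights at $y$ and at points $z$ with $\|z-y\|\le\|v\|$ are
    -- comparable: $1+\|y\|\le2(1+\|z\|)$.
    have hb := norm_iteratedFDeriv_taylor_one_le i (φx.smooth ⊤) v y (M := 2 ^ k * K / (1 + ‖y‖) ^ k)
      fun z hz => by
        rw [le_div_iff₀ (by positivity)]
        have h1 : (1 + ‖y‖) ^ k ≤ 2 ^ k * (1 + ‖z‖) ^ k := by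
          rw [← mul_pow]
          gcongr
          have : ‖y‖ ≤ ‖z‖ + ‖z - y‖ := by simpa using norm_sub_le z (z - y)
          linarith [norm_nonneg z]
        calc _ ≤ ‖iteratedFDeriv ℝ (i + 2) φx z‖ * (2 ^ k * (1 + ‖z‖) ^ k) := by gcongr
          _ = 2 ^ k * ((1 + ‖z‖) ^ k * ‖iteratedFDeriv ℝ (i + 2) φx z‖) := by ring
          _ ≤ 2 ^ k * K := by gcongr; exact hd _ (by lia) z
    calc _ ≤ (1 + ‖y‖) ^ k * (2 ^ k * K / (1 + ‖y‖) ^ k * ‖v‖ ^ 2) := by gcongr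
      _ = _ := by field_simp
  rw [hasFDerivAt_iff_isLittleO_nhds_zero]
  refine Asymptotics.IsBigO.trans_isLittleO (g := fun v : Eucl m => ‖v‖ ^ 2) ?_ ?_
  · refine Asymptotics.IsBigO.of_bound (C * (2 ^ k * K)) ?_
    filter_upwards [Metric.closedBall_mem_nhds (0 : Eucl m) one_pos] with v hv
    rw [norm_pow, norm_norm]
    exact key v (by simpa using hv)
  · exact Asymptotics.isLittleO_norm_pow_id one_lt_two

/-- Directional derivatives of a regularization are regularizations of $\partial_h\varphi$, so the
induction is over all $\varphi$ at once. -/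
theorem contDiff_regularization (S : 𝓢'(Eucl m, ℂ)) (n : ℕ) :
    ∀ φ : 𝓢(Eucl m, ℂ), ContDiff ℝ n (regularization S φ) := by
  induction n with
  | zero =>
    intro φ
    rw [Nat.cast_zero, contDiff_zero]
    exact continuous_iff_continuousAt.2 fun x => (hasFDerivAt_regularization S φ x).continuousAt
  | succ n ih =>
    intro φ
    push_cast
    rw [contDiff_succ_iff_hasFDerivAt]
    exact ⟨regularizationFDeriv S φ, contDiff_clm_apply_iff.2 fun h => ih (∂_{h} φ),
      hasFDerivAt_regularization S φ⟩

/-- Expanding in the standard basis expresses the differential through fixed linear maps applied to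
regularizations, so growth bounds for higher derivatives follow by induction. -/
theorem fderiv_regularization (S : 𝓢'(Eucl m, ℂ)) (φ : 𝓢(Eucl m, ℂ)) :
    fderiv ℝ (regularization S φ) = fun x => ∑ i : Fin m,
      ContinuousLinearMap.smulRightL ℝ (Eucl m) ℂ (EuclideanSpace.proj i : Eucl m →L[ℝ] ℝ)
        (regularization S (∂_{EuclideanSpace.single i (1 : ℝ)} φ) x) := by
  funext x
  rw [(hasFDerivAt_regularization S φ x).fderiv]
  ext v
  have hv : v = ∑ i : Fin m, v i • EuclideanSpace.single i (1 : ℝ) := by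
    simpa using ((EuclideanSpace.basisFun (Fin m) ℝ).sum_repr v).symm
  conv_lhs => rw [hv, map_sum]
  simp [regularizationFDeriv_apply]

/-- The regularization of a tempered distribution is smooth and of temperate growth. -/
theorem hasTemperateGrowth_regularization (S : 𝓢'(Eucl m, ℂ)) (φ : 𝓢(Eucl m, ℂ)) :
    (regularization S φ).HasTemperateGrowth := by
  refine ⟨contDiff_infty.2 fun n => contDiff_regularization S n φ, fun n => ?_⟩
  induction n generalizing φ with
  | zero => simpa using norm_regularization_le S φ
  | succ n ih =>
    choose k C hC using fun i : Fin m => ih (∂_{EuclideanSpace.single i (1 : ℝ)} φ)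
    set L : Fin m → ℂ →L[ℝ] (Eucl m →L[ℝ] ℂ) := fun i =>
      ContinuousLinearMap.smulRightL ℝ (Eucl m) ℂ (EuclideanSpace.proj i : Eucl m →L[ℝ] ℝ)
    refine ⟨∑ i, k i, ∑ i, ‖L i‖ * |C i|, fun x => ?_⟩
    have hs : ∀ i, ContDiffAt ℝ n
        (fun x => L i (regularization S (∂_{EuclideanSpace.single i (1 : ℝ)} φ) x)) x := fun i =>
      ((L i).contDiff.comp (contDiff_regularization S n _)).contDiffAt
    rw [← norm_iteratedFDeriv_fderiv, fderiv_regularization, iteratedFDeriv_fun_sum_apply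
      (fun i _ => hs i), Finset.sum_mul]
    refine (norm_sum_le _ _).trans (Finset.sum_le_sum fun i _ => ?_)
    refine ((L i).norm_iteratedFDeriv_comp_left
      (contDiff_regularization S n _).contDiffAt le_rfl).trans ?_
    rw [mul_assoc]
    refine mul_le_mul_of_nonneg_left ((hC i x).trans ?_) (norm_nonneg _)
    refine mul_le_mul (le_abs_self _) ?_ (by positivity) (abs_nonneg _)
    exact pow_le_pow_right₀ (by linarith [norm_nonneg x])
      (Finset.single_le_sum (f := k) (fun _ _ => Nat.zero_le _) (Finset.mem_univ i))

end RieszDist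

/-! ### Holomorphy of the finite part, and its form as an integral over space. -/

namespace RieszDist

open scoped LineDeriv Pointwise

variable {m : ℕ}

/-- The surface measure of a set is a multiple of the volume of the cone over it, and $x\mapsto-x$
preserves volume. -/
theorem measurePreserving_neg_sphere (m : ℕ) :
    MeasurePreserving (fun ω : Metric.sphere (0 : Eucl m) 1 => -ω)
      (sphereMeasure m) (sphereMeasure m) := by
  have hmeas : Measurable (fun ω : Metric.sphere (0 : Eucl m) 1 => -ω) :=
    continuous_neg.measurable
  refine ⟨hmeas, Measure.ext fun s hs => ?_⟩
  rw [Measure.map_apply hmeas hs, Measure.toSphere_apply' _ hs,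
    Measure.toSphere_apply' _ (hmeas hs)]
  congr 1
  rw [← Measure.measure_neg]
  congr 1
  ext x
  simp only [Set.mem_neg, Set.mem_smul, mem_image, mem_preimage]
  constructor
  · rintro ⟨r, hr, _, ⟨ω, hω, rfl⟩, hx⟩
    exact ⟨r, hr, _, ⟨-ω, hω, rfl⟩, by simpa [neg_eq_iff_eq_neg] using hx⟩
  · rintro ⟨r, hr, _, ⟨ω, hω, rfl⟩, hx⟩
    exact ⟨r, hr, _, ⟨-ω, by simpa using hω, rfl⟩, by simpa using hx⟩

theorem sphericalMean_neg (φ : 𝓢(Eucl m, ℂ)) (r : ℝ) :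
    sphericalMean φ (-r) = sphericalMean φ r := by
  have hemb : MeasurableEmbedding (fun ω : Metric.sphere (0 : Eucl m) 1 => -ω) :=
    (Homeomorph.neg (Metric.sphere (0 : Eucl m) 1)).measurableEmbedding
  have h := (measurePreserving_neg_sphere m).integral_comp hemb
    (fun ω : Metric.sphere (0 : Eucl m) 1 => φ (r • (ω : Eucl m)))
  simp only [sphericalMean, ← h]
  simp

/-- Spherical means are even in $r$. Hence every second possible pole of the finite part has zero
residue, and only $\lambda=-m-2l$ remains. -/
theorem iteratedDeriv_sphericalMean_odd (φ : 𝓢(Eucl m, ℂ)) {k : ℕ} (hk : Odd k) :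
    iteratedDeriv k (sphericalMean φ) 0 = 0 := by
  have h := iteratedDeriv_comp_neg k (sphericalMean φ) 0
  rw [funext (sphericalMean_neg φ), hk.neg_one_pow, neg_zero, neg_one_smul] at h
  exact self_eq_neg.1 h

/-- In the definition of the finite part, Taylor polynomials of higher degree may be used. -/
theorem finitePart_eq_of_le (μ : ℂ) (φ : 𝓢(Eucl m, ℂ)) {n : ℕ} (hn : ⌈-μ.re⌉₊ ≤ n) :
    IntegrableOn (fun r : ℝ => (r : ℂ) ^ μ * (sphericalMean φ r - ∑ k ∈ Finset.range n,
      iteratedDeriv k (sphericalMean φ) 0 / (k.factorial : ℂ) * (r : ℂ) ^ k)) (Ioc 0 1) ∧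
    finitePart μ (sphericalMean φ) =
      (∫ r in Ioc (0 : ℝ) 1, (r : ℂ) ^ μ * (sphericalMean φ r - ∑ k ∈ Finset.range n,
        iteratedDeriv k (sphericalMean φ) 0 / (k.factorial : ℂ) * (r : ℂ) ^ k)) +
      (∫ r in Ioi (1 : ℝ), (r : ℂ) ^ μ * sphericalMean φ r) +
      ∑ k ∈ Finset.range n,
        iteratedDeriv k (sphericalMean φ) 0 / (k.factorial : ℂ) / (μ + k + 1) := by
  induction n, hn using Nat.le_induction with
  | base => exact ⟨integrableOn_inner μ φ, rfl⟩
  | succ n hn ih =>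
    obtain ⟨hi, he⟩ := ih
    set c : ℂ := iteratedDeriv n (sphericalMean φ) 0 / (n.factorial : ℂ)
    -- In fact $\operatorname{Re}\mu+n\ge0$ because $n\ge\lceil-\operatorname{Re}\mu\rceil$. The
    -- additional Taylor term is thus integrable at $0$, and its integral is exactly the term added
    -- to the sum.
    have hre : -1 < (μ + n).re := by
      have h1 := Nat.le_ceil (-μ.re)
      have h2 : (⌈-μ.re⌉₊ : ℝ) ≤ n := by exact_mod_cast hn
      simp only [Complex.add_re, Complex.natCast_re]
      linarith
    have hpi : IntegrableOn (fun r : ℝ => c * (r : ℂ) ^ (μ + n)) (Ioc 0 1) := by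
      rw [← intervalIntegrable_iff_integrableOn_Ioc_of_le zero_le_one]
      exact (intervalIntegral.intervalIntegrable_cpow' hre).const_mul c
    have hpv : ∫ r in Ioc (0 : ℝ) 1, c * (r : ℂ) ^ (μ + n) = c / (μ + n + 1) := by
      rw [integral_const_mul, ← intervalIntegral.integral_of_le zero_le_one,
        integral_cpow (Or.inl hre)]
      have : μ + n + 1 ≠ 0 := fun h => by
        have := congrArg Complex.re h
        simp only [Complex.add_re, Complex.one_re, Complex.zero_re] at this hre
        linarith
      simp [Complex.zero_cpow this, div_eq_mul_inv]
    have hcongr : ∀ r ∈ Ioc (0 : ℝ) 1, (r : ℂ) ^ μ * (sphericalMean φ r -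
        ∑ k ∈ Finset.range n, iteratedDeriv k (sphericalMean φ) 0 / (k.factorial : ℂ) *
          (r : ℂ) ^ k) - c * (r : ℂ) ^ (μ + n) =
        (r : ℂ) ^ μ * (sphericalMean φ r - ∑ k ∈ Finset.range (n + 1),
          iteratedDeriv k (sphericalMean φ) 0 / (k.factorial : ℂ) * (r : ℂ) ^ k) := by
      intro r hr
      have hr0 : (r : ℂ) ≠ 0 := by exact_mod_cast hr.1.ne'
      rw [Finset.sum_range_succ, Complex.cpow_add _ _ hr0, Complex.cpow_natCast]
      ring
    refine ⟨(hi.sub hpi).congr_fun hcongr measurableSet_Ioc, ?_⟩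
    rw [he, ← setIntegral_congr_fun measurableSet_Ioc hcongr, integral_sub hi hpi, hpv,
      Finset.sum_range_succ]
    ring

theorem norm_outer_integrable (a : ℝ) (φ : 𝓢(Eucl m, ℂ)) :
    IntegrableOn (fun r : ℝ => r ^ a * ‖sphericalMean φ r‖) (Ioi 1) := by
  refine IntegrableOn.congr_fun (integrableOn_outer (a : ℂ) φ).norm (fun r hr => ?_)
    measurableSet_Ioi
  simp only [norm_mul]
  rw [Complex.norm_cpow_eq_rpow_re_of_pos (zero_lt_one.trans hr), Complex.ofReal_re]

/-- The finite part is holomorphic in the exponent, away from its poles. -/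
theorem differentiableAt_finitePart (φ : 𝓢(Eucl m, ℂ)) {μ₀ : ℂ}
    (h : ∀ k : ℕ, iteratedDeriv k (sphericalMean φ) 0 = 0 ∨ μ₀ + k + 1 ≠ 0) :
    DifferentiableAt ℂ (fun μ => finitePart μ (sphericalMean φ)) μ₀ := by
  -- One Taylor term beyond the necessary ones, so that the same formula represents the finite part
  -- for all $\mu$ with $\operatorname{Re}\mu>\operatorname{Re}\mu_0-1$.
  set N := ⌈-μ₀.re⌉₊ + 1 with hN
  have hN' : -μ₀.re + 1 ≤ N := by
    rw [hN]; push_cast; linarith [Nat.le_ceil (-μ₀.re)]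
  have hc := (contDiff_sphericalMean φ).continuous
  set g : ℝ → ℂ := fun r => sphericalMean φ r - ∑ k ∈ Finset.range N,
    iteratedDeriv k (sphericalMean φ) 0 / (k.factorial : ℂ) * (r : ℂ) ^ k with hg
  have hgc : Continuous g := by fun_prop
  have hgi : ∀ s : ℝ, -1 / 2 ≤ s + N → IntegrableOn (fun r : ℝ => r ^ s * ‖g r‖) (Ioc 0 1) := by
    intro s hs
    have hp : IntegrableOn (fun r : ℝ => ctrl 0 N φ * r ^ (s + N)) (Ioc 0 1) := by
      rw [← intervalIntegrable_iff_integrableOn_Ioc_of_le zero_le_one]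
      exact (intervalIntegral.intervalIntegrable_rpow' (by linarith)).const_mul _
    refine Integrable.mono' hp ?_ ((ae_restrict_iff' measurableSet_Ioc).2
      (Eventually.of_forall fun r hr => ?_))
    · exact ((measurable_id.pow_const s).aestronglyMeasurable).mul hgc.norm.aestronglyMeasurable
    · rw [Real.norm_of_nonneg (mul_nonneg (Real.rpow_nonneg hr.1.le _) (norm_nonneg _)),
        Real.rpow_add hr.1, Real.rpow_natCast]
      calc r ^ s * ‖g r‖ ≤ r ^ s * (ctrl 0 N φ * r ^ N) :=
            mul_le_mul_of_nonneg_left (norm_sub_taylor_le 0 N φ hr) (Real.rpow_nonneg hr.1.le _)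
        _ = _ := by ring
  have h0 : ∀ᵐ r ∂(volume.restrict (Ioc (0 : ℝ) 1)), 0 < r :=
    (ae_restrict_iff' measurableSet_Ioc).2 (Eventually.of_forall fun r hr => hr.1)
  have h1 : ∀ᵐ r ∂(volume.restrict (Ioi (1 : ℝ))), 0 < r :=
    (ae_restrict_iff' measurableSet_Ioi).2 (Eventually.of_forall fun r hr => zero_lt_one.trans hr)
  have d1 := differentiableAt_integral_cpow measurable_id h0 hgc.aestronglyMeasurable
    (hgi (μ₀.re - 1 / 2) (by linarith)) (hgi (μ₀.re + 1) (by linarith)) (z₀ := μ₀)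
    (by linarith) (by linarith)
  have d2 := differentiableAt_integral_cpow measurable_id h1 hc.aestronglyMeasurable
    (norm_outer_integrable (μ₀.re - 1) φ) (norm_outer_integrable (μ₀.re + 1) φ) (z₀ := μ₀)
    (by linarith) (by linarith)
  have d3 : DifferentiableAt ℂ (fun μ : ℂ => ∑ k ∈ Finset.range N,
      iteratedDeriv k (sphericalMean φ) 0 / (k.factorial : ℂ) / (μ + k + 1)) μ₀ := by
    refine DifferentiableAt.fun_sum fun k _ => ?_
    rcases h k with h | h
    · simp [h]
    · exact (differentiableAt_const _).div (by fun_prop) h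
  refine ((d1.add d2).add d3).congr_of_eventuallyEq ?_
  have hnear : {μ : ℂ | μ₀.re - 1 < μ.re} ∈ 𝓝 μ₀ :=
    (isOpen_lt continuous_const Complex.continuous_re).mem_nhds (by simp)
  filter_upwards [hnear] with μ hμ
  refine (finitePart_eq_of_le μ φ (n := N) (Nat.ceil_le.2 ?_)).2
  have : μ₀.re - 1 < μ.re := hμ
  linarith

/-- The $k$-th Taylor term has its pole at $\lambda=-m-k$. For even $k$ this is an excluded value,
for odd $k$ the coefficient vanishes. -/
theorem differentiableAt_radialDist (φ : 𝓢(Eucl m, ℂ)) {lam : ℂ}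
    (h : ∀ l : ℕ, lam ≠ -(m : ℂ) - 2 * l) :
    DifferentiableAt ℂ (fun z => radialDist m z φ) lam := by
  simp only [radialDist_apply]
  refine DifferentiableAt.const_mul ?_ _
  refine DifferentiableAt.comp (g := fun μ => finitePart μ (sphericalMean φ))
    (f := fun z : ℂ => z + m - 1) lam (differentiableAt_finitePart φ fun k => ?_) (by fun_prop)
  rcases Nat.even_or_odd' k with ⟨l, rfl | rfl⟩
  · right
    intro h0
    refine h l ?_
    push_cast at h0
    linear_combination h0
  · exact Or.inl (iteratedDeriv_sphericalMean_odd φ ⟨l, rfl⟩)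

theorem sphereArea_pos (hm : 1 ≤ m) : 0 < sphereArea m := by
  have := nontrivial_eucl hm
  rw [sphereArea, measureReal_def]
  refine ENNReal.toReal_pos ?_ (measure_ne_top _ _)
  exact (Measure.measure_univ_ne_zero).2 (Measure.toSphere_ne_zero _)

theorem cpow_radial (hm : 1 ≤ m) (lam : ℂ) {r : ℝ} (hr : 0 < r) :
    (r : ℂ) ^ (lam + m - 1) = ((r ^ (m - 1) : ℝ) : ℂ) * (r : ℂ) ^ lam := by
  have hr0 : (r : ℂ) ≠ 0 := by exact_mod_cast hr.ne'
  rw [add_sub_assoc, Complex.cpow_add _ _ hr0, mul_comm]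
  congr 1
  rw [Complex.ofReal_pow, ← Complex.cpow_natCast, Nat.cast_sub hm, Nat.cast_one]

theorem setIntegral_polar_cpow (hm : 1 ≤ m) (lam : ℂ) {g : Eucl m → ℂ} {s : Set ℝ}
    (hs : MeasurableSet s) (hg : IntegrableOn (fun x => (‖x‖ : ℂ) ^ lam * g x) {x | ‖x‖ ∈ s}) :
    ∫ x in {x | ‖x‖ ∈ s}, (‖x‖ : ℂ) ^ lam * g x = ∫ r in Ioi (0 : ℝ) ∩ s,
      (r : ℂ) ^ (lam + m - 1) * ∫ ω, g (r • (ω : Eucl m)) ∂(sphereMeasure m) := by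
  rw [setIntegral_polar hm hs hg]
  refine setIntegral_congr_fun (measurableSet_Ioi.inter hs) fun r hr => ?_
  have hn : ∀ ω : Metric.sphere (0 : Eucl m) 1, ‖r • (ω : Eucl m)‖ = r := fun ω => by
    rw [norm_smul, norm_eq_of_mem_sphere, mul_one, Real.norm_of_nonneg (le_of_lt hr.1)]
  simp only [hn, integral_const_mul, cpow_radial hm lam hr.1, Complex.real_smul, mul_assoc]

theorem schwartz_norm_rpow_integrable_compl (φ : 𝓢(Eucl m, ℂ)) (a : ℝ) :
    IntegrableOn (fun x : Eucl m => ‖x‖ ^ a * ‖φ x‖) (Metric.closedBall 0 1)ᶜ := by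
  obtain ⟨N, hN⟩ := exists_nat_ge a
  refine Integrable.mono' (φ.integrable_pow_mul volume N).integrableOn ?_
    ((ae_restrict_iff' Metric.isClosed_closedBall.measurableSet.compl).2
      (Eventually.of_forall fun x hx => ?_))
  · exact (measurable_norm.pow_const a).aestronglyMeasurable.mul
      φ.continuous.norm.aestronglyMeasurable
  · have hx : 1 < ‖x‖ := by simpa using hx
    rw [Real.norm_of_nonneg (by positivity), ← Real.rpow_natCast]
    gcongr
    exact hx.le

theorem schwartz_cpow_integrable_compl (hm : 1 ≤ m) (φ : 𝓢(Eucl m, ℂ)) (lam : ℂ) :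
    IntegrableOn (fun x : Eucl m => (‖x‖ : ℂ) ^ lam * φ x) (Metric.closedBall 0 1)ᶜ :=
  integrable_cpow_mul measurable_norm (ae_restrict_of_ae (ae_norm_pos hm))
    φ.continuous.aestronglyMeasurable (schwartz_norm_rpow_integrable_compl φ lam.re)
    (schwartz_norm_rpow_integrable_compl φ lam.re) le_rfl le_rfl

theorem sphereArea_mul_sphericalMean (hm : 1 ≤ m) (φ : 𝓢(Eucl m, ℂ)) (r : ℝ) :
    (sphereArea m : ℂ) * sphericalMean φ r = ∫ ω, φ (r • (ω : Eucl m)) ∂(sphereMeasure m) := by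
  have : (sphereArea m : ℂ) ≠ 0 := by exact_mod_cast (sphereArea_pos hm).ne'
  rw [sphericalMean, Complex.real_smul, Complex.ofReal_inv, mul_inv_cancel_left₀ this]

theorem sphereArea_mul_outer (hm : 1 ≤ m) (φ : 𝓢(Eucl m, ℂ)) (lam : ℂ) :
    (sphereArea m : ℂ) * ∫ r in Ioi (1 : ℝ), (r : ℂ) ^ (lam + m - 1) * sphericalMean φ r =
      ∫ x in (Metric.closedBall (0 : Eucl m) 1)ᶜ, (‖x‖ : ℂ) ^ lam * φ x := by
  have e : (Metric.closedBall (0 : Eucl m) 1)ᶜ = {x | ‖x‖ ∈ Ioi (1 : ℝ)} := by ext; simp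
  have hi := schwartz_cpow_integrable_compl hm φ lam
  rw [e] at hi ⊢
  rw [setIntegral_polar_cpow hm lam measurableSet_Ioi hi, Ioi_inter_Ioi, max_eq_right zero_le_one,
    ← integral_const_mul]
  refine setIntegral_congr_fun measurableSet_Ioi fun r _ => ?_
  rw [← sphereArea_mul_sphericalMean hm, mul_left_comm]

/-- The functional `Fp |x|^λ`, for `Re λ > -m-1`, on functions that need not be Schwartz. -/
noncomputable def rieszFunctional (lam : ℂ) (g : Eucl m → ℂ) : ℂ :=
  (∫ x in Metric.closedBall (0 : Eucl m) 1, (‖x‖ : ℂ) ^ lam * (g x - g 0)) +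
    (∫ x in (Metric.closedBall (0 : Eucl m) 1)ᶜ, (‖x‖ : ℂ) ^ lam * g x) +
    (sphereArea m : ℂ) * g 0 / (lam + m)

/-- Subtracting $g(0)$ gains one power of $\|x\|$, which moves the threshold for integrability at
the origin from $-m$ to $-m-1$. -/
theorem norm_rpow_sub_integrable (hm : 1 ≤ m) {g : Eucl m → ℂ} (hg : Continuous g) {M : ℝ}
    (hM : ∀ x, ‖x‖ ≤ 1 → ‖g x - g 0‖ ≤ M * ‖x‖) {a : ℝ} (ha : -m - 1 < a) :
    IntegrableOn (fun x : Eucl m => ‖x‖ ^ a * ‖g x - g 0‖) (Metric.closedBall 0 1) := by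
  refine Integrable.mono' ((integrableOn_norm_rpow_closedBall hm
    (show -(m : ℝ) < a + 1 by linarith)).const_mul M) ?_ ?_
  · exact (measurable_norm.pow_const a).aestronglyMeasurable.mul
      (hg.sub continuous_const).norm.aestronglyMeasurable
  · filter_upwards [ae_restrict_of_ae (ae_norm_pos hm),
      ae_restrict_mem Metric.isClosed_closedBall.measurableSet] with x hx0 hx
    rw [Real.norm_of_nonneg (by positivity), Real.rpow_add_one hx0.ne']
    calc _ ≤ ‖x‖ ^ a * (M * ‖x‖) := by gcongr; exact hM x (by simpa using hx)
      _ = _ := by ring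

theorem cpow_sub_integrable (hm : 1 ≤ m) {g : Eucl m → ℂ} (hg : Continuous g) {M : ℝ}
    (hM : ∀ x, ‖x‖ ≤ 1 → ‖g x - g 0‖ ≤ M * ‖x‖) {lam : ℂ} (ha : -m - 1 < lam.re) :
    IntegrableOn (fun x : Eucl m => (‖x‖ : ℂ) ^ lam * (g x - g 0)) (Metric.closedBall 0 1) :=
  integrable_cpow_mul measurable_norm (ae_restrict_of_ae (ae_norm_pos hm))
    (hg.sub continuous_const).aestronglyMeasurable (norm_rpow_sub_integrable hm hg hM ha)
    (norm_rpow_sub_integrable hm hg hM ha) le_rfl le_rfl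

theorem exists_lipschitz_zero {g : Eucl m → ℂ} (hg : ContDiff ℝ 1 g) :
    ∃ M : ℝ, ∀ x, ‖x‖ ≤ 1 → ‖g x - g 0‖ ≤ M * ‖x‖ := by
  obtain ⟨M, hM⟩ := (isCompact_closedBall (0 : Eucl m) 1).exists_bound_of_continuousOn
    (hg.continuous_fderiv (by simp)).continuousOn
  refine ⟨M, fun x hx => ?_⟩
  simpa using (convex_closedBall (0 : Eucl m) 1).norm_image_sub_le_of_norm_fderiv_le (f := g)
    (fun x _ => hg.differentiable (by simp) x) hM
    (Metric.mem_closedBall_self zero_le_one) (by simpa using hx : x ∈ Metric.closedBall 0 1)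

/-- For $\operatorname{Re}\lambda\ge-m$ one Taylor term suffices, and polar coordinates turn the
radial integrals into integrals over space. The right side also makes sense for regularizations,
which decay only polynomially. -/
theorem radialDist_eq_rieszFunctional (hm : 1 ≤ m) {lam : ℂ} (h : -m ≤ lam.re)
    (φ : 𝓢(Eucl m, ℂ)) : radialDist m lam φ = rieszFunctional lam φ := by
  obtain ⟨M, hM⟩ := exists_lipschitz_zero (φ.smooth 1)
  have hi := cpow_sub_integrable hm φ.continuous hM (lam := lam) (by linarith)
  have e : Metric.closedBall (0 : Eucl m) 1 = {x | ‖x‖ ∈ Iic (1 : ℝ)} := by ext; simp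
  have hs0 : (sphereArea m : ℂ) ≠ 0 := by exact_mod_cast (sphereArea_pos hm).ne'
  have h0 : sphericalMean φ 0 = φ 0 := by
    refine mul_left_cancel₀ hs0 ?_
    rw [sphereArea_mul_sphericalMean hm]
    simp [sphereArea]
  rw [radialDist_apply, (finitePart_eq_of_le (lam + m - 1) φ (n := 1) (Nat.ceil_le.2 (by
    simp; linarith))).2, mul_add, mul_add, sphereArea_mul_outer hm, rieszFunctional]
  congr 1
  · congr 1
    rw [e] at hi ⊢
    rw [setIntegral_polar_cpow hm lam measurableSet_Iic hi, ← integral_const_mul]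
    refine setIntegral_congr_fun measurableSet_Ioc fun r _ => ?_
    have hφ := integrable_rayDeriv φ 0 r
    simp only [rayDeriv, iteratedFDeriv_zero_apply] at hφ
    simp only [Finset.range_one, Finset.sum_singleton, iteratedDeriv_zero, Nat.factorial_zero,
      Nat.cast_one, div_one, pow_zero, mul_one, h0]
    rw [mul_left_comm, mul_sub, sphereArea_mul_sphericalMean hm,
      integral_sub hφ (integrable_const _)]
    simp [sphereArea]
  · simp [h0, mul_div_assoc]

end RieszDist

/-! ### Control of the kernels and decay of their regularizations. -/

namespace RieszDist

open scoped LineDeriv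

variable {m : ℕ}

/-- `S` is controlled by derivatives on the unit ball, and by the weight `‖x‖^a` outside of it. -/
def IsControlled (a : ℝ) (S : 𝓢'(Eucl m, ℂ)) : Prop :=
  ∃ (n : ℕ) (C : ℝ), 0 ≤ C ∧ ∀ (Φ : 𝓢(Eucl m, ℂ)) (A : ℝ),
    (∀ k ≤ n, ∀ z, ‖z‖ ≤ 1 → ‖iteratedFDeriv ℝ k Φ z‖ ≤ A) →
    ‖S Φ‖ ≤ C * (A + ∫ z in (Metric.closedBall (0 : Eucl m) 1)ᶜ, ‖z‖ ^ a * ‖Φ z‖)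

theorem IsControlled.smul {a : ℝ} {S : 𝓢'(Eucl m, ℂ)} (h : IsControlled a S) (c : ℂ) :
    IsControlled a (c • S) := by
  obtain ⟨n, C, hC, h⟩ := h
  refine ⟨n, ‖c‖ * C, by positivity, fun Φ A hA => ?_⟩
  have : (c • S) Φ = c * S Φ := rfl
  rw [this, norm_mul, mul_assoc]
  exact mul_le_mul_of_nonneg_left (h Φ A hA) (norm_nonneg c)

/-- Only derivatives on the unit ball enter here; this locality is what `IsControlled` requires and
what the global seminorm bounds do not give. -/
theorem norm_iteratedDeriv_sphericalMean_le_of_ball {φ : 𝓢(Eucl m, ℂ)} {n : ℕ} {A : ℝ}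
    (hA : ∀ k ≤ n, ∀ z, ‖z‖ ≤ 1 → ‖iteratedFDeriv ℝ k φ z‖ ≤ A) {k : ℕ} (hk : k ≤ n) {r : ℝ}
    (hr : r ∈ Icc (0 : ℝ) 1) : ‖iteratedDeriv k (sphericalMean φ) r‖ ≤ A := by
  rw [iteratedDeriv_sphericalMean]
  refine norm_mean_le ((norm_nonneg _).trans (hA k hk 0 (by simp))) fun ω =>
    (norm_rayDeriv_le φ k r ω).trans (hA k hk _ ?_)
  rw [norm_smul, norm_eq_of_mem_sphere, mul_one, Real.norm_of_nonneg hr.1]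
  exact hr.2

theorem norm_sub_taylor_le_of_ball {φ : 𝓢(Eucl m, ℂ)} {n : ℕ} {A : ℝ}
    (hA : ∀ k ≤ n, ∀ z, ‖z‖ ≤ 1 → ‖iteratedFDeriv ℝ k φ z‖ ≤ A) {r : ℝ}
    (hr : r ∈ Ioc (0 : ℝ) 1) :
    ‖sphericalMean φ r - ∑ k ∈ Finset.range n,
      iteratedDeriv k (sphericalMean φ) 0 / (k.factorial : ℂ) * (r : ℂ) ^ k‖ ≤ A * r ^ n := by
  have hA0 : 0 ≤ A := (norm_nonneg _).trans (hA 0 (Nat.zero_le _) 0 (by simp))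
  cases n with
  | zero =>
    simpa using norm_iteratedDeriv_sphericalMean_le_of_ball hA le_rfl ⟨hr.1.le, hr.2⟩
  | succ n =>
    have hd : ∀ (k : ℕ), ∀ y ∈ Icc (0 : ℝ) 1,
        iteratedDerivWithin k (sphericalMean φ) (Icc 0 1) y =
          iteratedDeriv k (sphericalMean φ) y := fun k y hy =>
      iteratedDerivWithin_eq_iteratedDeriv (uniqueDiffOn_Icc zero_lt_one)
        ((contDiff_sphericalMean φ).of_le (by exact_mod_cast le_top)).contDiffAt hy
    have h := taylor_mean_remainder_bound (f := sphericalMean φ) (a := 0) (b := 1)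
      (C := A) (x := r) (n := n) zero_le_one
      ((contDiff_sphericalMean φ).of_le (by exact_mod_cast le_top)).contDiffOn
      ⟨hr.1.le, hr.2⟩ (fun y hy => by
        rw [hd _ y hy]; exact norm_iteratedDeriv_sphericalMean_le_of_ball hA le_rfl hy)
    rw [taylor_within_apply] at h
    have e : ∑ k ∈ Finset.range (n + 1),
        iteratedDeriv k (sphericalMean φ) 0 / (k.factorial : ℂ) * (r : ℂ) ^ k =
        ∑ k ∈ Finset.range (n + 1), ((k.factorial : ℝ)⁻¹ * (r - 0) ^ k) •
          iteratedDerivWithin k (sphericalMean φ) (Icc 0 1) 0 := by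
      refine Finset.sum_congr rfl fun k _ => ?_
      rw [hd k 0 ⟨le_rfl, zero_le_one⟩, Complex.real_smul]
      push_cast
      ring
    rw [e]
    refine h.trans ?_
    rw [sub_zero]
    refine div_le_self (mul_nonneg hA0 (pow_nonneg hr.1.le _)) ?_
    exact_mod_cast n.factorial_pos

/-- The regularized integral over $(0,1]$ and the pole terms depend only on finitely many
derivatives in the unit ball. What remains is an absolutely convergent integral against
$|x|^\lambda$ outside it. -/
theorem isControlled_radialDist (hm : 1 ≤ m) (lam : ℂ) :
    IsControlled lam.re (radialDist m lam) := by
  set ν : ℂ := lam + m - 1 with hν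
  set n := ⌈-ν.re⌉₊ with hn
  set D : ℝ := 1 + ∑ k ∈ Finset.range n, ‖(k.factorial : ℂ)‖⁻¹ * ‖ν + k + 1‖⁻¹ with hD
  have hD0 : 0 ≤ D := by positivity
  have hs := (sphereArea_pos hm).le
  refine ⟨n, sphereArea m * D + 1, by positivity, fun Φ A hA => ?_⟩
  have hA0 : 0 ≤ A := (norm_nonneg _).trans (hA 0 (Nat.zero_le _) 0 (by simp))
  set J := ∫ z in (Metric.closedBall (0 : Eucl m) 1)ᶜ, ‖z‖ ^ lam.re * ‖Φ z‖ with hJ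
  have hJ0 : 0 ≤ J := by positivity
  have h1 : ‖∫ r in Ioc (0 : ℝ) 1, (r : ℂ) ^ ν * (sphericalMean Φ r - ∑ k ∈ Finset.range n,
      iteratedDeriv k (sphericalMean Φ) 0 / (k.factorial : ℂ) * (r : ℂ) ^ k)‖ ≤ A := by
    have h := norm_setIntegral_le_of_norm_le_const (μ := volume) (s := Ioc (0 : ℝ) 1) (C := A)
      (f := fun r : ℝ => (r : ℂ) ^ ν * (sphericalMean Φ r - ∑ k ∈ Finset.range n,
        iteratedDeriv k (sphericalMean Φ) 0 / (k.factorial : ℂ) * (r : ℂ) ^ k))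
      (by simp) (fun r hr => ?_)
    · simpa using h
    · rw [norm_mul, Complex.norm_cpow_eq_rpow_re_of_pos hr.1]
      have h2 : r ^ ν.re * r ^ n ≤ 1 := by
        rw [← Real.rpow_natCast, ← Real.rpow_add hr.1]
        refine Real.rpow_le_one hr.1.le hr.2 ?_
        have := Nat.le_ceil (-ν.re)
        linarith
      calc _ ≤ r ^ ν.re * (A * r ^ n) :=
            mul_le_mul_of_nonneg_left (norm_sub_taylor_le_of_ball hA hr)
              (Real.rpow_nonneg hr.1.le _)
        _ = A * (r ^ ν.re * r ^ n) := by ring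
        _ ≤ A * 1 := by gcongr
        _ = A := mul_one A
  have h2 : ‖(sphereArea m : ℂ) * ∫ r in Ioi (1 : ℝ), (r : ℂ) ^ ν * sphericalMean Φ r‖ ≤ J := by
    rw [hν, sphereArea_mul_outer hm]
    refine (norm_integral_le_integral_norm _).trans (le_of_eq ?_)
    refine setIntegral_congr_fun Metric.isClosed_closedBall.measurableSet.compl fun x hx => ?_
    have hx : 1 < ‖x‖ := by simpa using hx
    simp only [norm_mul]
    rw [Complex.norm_cpow_eq_rpow_re_of_pos (zero_lt_one.trans hx)]
  have h3 : ‖∑ k ∈ Finset.range n,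
      iteratedDeriv k (sphericalMean Φ) 0 / (k.factorial : ℂ) / (ν + k + 1)‖ ≤
      (∑ k ∈ Finset.range n, ‖(k.factorial : ℂ)‖⁻¹ * ‖ν + k + 1‖⁻¹) * A := by
    rw [Finset.sum_mul]
    refine (norm_sum_le _ _).trans (Finset.sum_le_sum fun k hk => ?_)
    have h := norm_iteratedDeriv_sphericalMean_le_of_ball hA
      (le_of_lt (Finset.mem_range.1 hk)) (r := 0) ⟨le_rfl, zero_le_one⟩
    rw [norm_div, norm_div, div_eq_mul_inv, div_eq_mul_inv, mul_assoc, mul_comm]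
    gcongr
  have e : radialDist m lam Φ = (sphereArea m : ℂ) * ((∫ r in Ioc (0 : ℝ) 1, (r : ℂ) ^ ν *
      (sphericalMean Φ r - ∑ k ∈ Finset.range n,
        iteratedDeriv k (sphericalMean Φ) 0 / (k.factorial : ℂ) * (r : ℂ) ^ k)) +
      ∑ k ∈ Finset.range n,
        iteratedDeriv k (sphericalMean Φ) 0 / (k.factorial : ℂ) / (ν + k + 1)) +
      (sphereArea m : ℂ) * ∫ r in Ioi (1 : ℝ), (r : ℂ) ^ ν * sphericalMean Φ r := by
    rw [radialDist_apply, finitePart]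
    ring
  rw [e]
  calc _ ≤ sphereArea m * (D * A) + J := by
        refine (norm_add_le _ _).trans (add_le_add ?_ h2)
        rw [norm_mul, Complex.norm_real, Real.norm_of_nonneg hs]
        refine mul_le_mul_of_nonneg_left ?_ hs
        refine (norm_add_le _ _).trans ?_
        rw [hD, add_mul, one_mul]
        exact add_le_add h1 h3
    _ ≤ (sphereArea m * D + 1) * (A + J) := by
        have : 0 ≤ sphereArea m * D * J := by positivity
        nlinarith

theorem norm_iteratedFDeriv_lineDeriv_le (φ : 𝓢(Eucl m, ℂ)) (v z : Eucl m) (k : ℕ) :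
    ‖iteratedFDeriv ℝ k (∂_{v} φ : 𝓢(Eucl m, ℂ)) z‖ ≤ ‖v‖ * ‖iteratedFDeriv ℝ (k + 1) φ z‖ := by
  have e : ⇑(∂_{v} φ : 𝓢(Eucl m, ℂ)) = fun y => ContinuousLinearMap.apply ℝ ℂ v (fderiv ℝ φ y) := by
    funext y; simp [SchwartzMap.lineDerivOp_apply_eq_fderiv]
  have hc : ContDiffAt ℝ k (fderiv ℝ φ) z :=
    ((φ.smooth ⊤).fderiv_right (m := k) (by exact_mod_cast le_top)).contDiffAt
  rw [e, ← norm_iteratedFDeriv_fderiv]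
  refine ((ContinuousLinearMap.apply ℝ ℂ v).norm_iteratedFDeriv_comp_left hc le_rfl).trans ?_
  refine mul_le_mul_of_nonneg_right ?_ (norm_nonneg _)
  refine ContinuousLinearMap.opNorm_le_bound _ (norm_nonneg v) fun L => ?_
  rw [ContinuousLinearMap.apply_apply, mul_comm]
  exact L.le_opNorm v

theorem norm_iteratedFDeriv_laplacian_le (φ : 𝓢(Eucl m, ℂ)) (z : Eucl m) (k : ℕ) :
    ‖iteratedFDeriv ℝ k (Δ φ : 𝓢(Eucl m, ℂ)) z‖ ≤ m * ‖iteratedFDeriv ℝ (k + 2) φ z‖ := by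
  have e : ⇑(Δ φ : 𝓢(Eucl m, ℂ)) = fun y => ∑ i : Fin m,
      (∂_{EuclideanSpace.basisFun (Fin m) ℝ i} (∂_{EuclideanSpace.basisFun (Fin m) ℝ i} φ) :
        𝓢(Eucl m, ℂ)) y := by
    funext y
    rw [SchwartzMap.laplacian_eq_sum (EuclideanSpace.basisFun (Fin m) ℝ) φ]
    simp
  rw [e, iteratedFDeriv_fun_sum_apply fun i _ => (SchwartzMap.smooth _ k).contDiffAt]
  refine (norm_sum_le _ _).trans ?_
  refine (Finset.sum_le_sum fun i _ => (norm_iteratedFDeriv_lineDeriv_le _ _ z k).trans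
    (mul_le_mul_of_nonneg_left (norm_iteratedFDeriv_lineDeriv_le φ _ z (k + 1))
      (norm_nonneg _))).trans ?_
  simp

theorem exists_bound_negLaplacianDelta (m l : ℕ) : ∃ (n : ℕ) (C : ℝ), 0 ≤ C ∧
    ∀ (Φ : 𝓢(Eucl m, ℂ)) (A : ℝ), (∀ k ≤ n, ‖iteratedFDeriv ℝ k Φ 0‖ ≤ A) →
      ‖negLaplacianDelta m l Φ‖ ≤ C * A := by
  induction l with
  | zero =>
    refine ⟨0, 1, zero_le_one, fun Φ A hA => ?_⟩
    simpa [negLaplacianDelta] using hA 0 le_rfl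
  | succ l ih =>
    obtain ⟨n, C, hC, h⟩ := ih
    refine ⟨n + 2, C * m, by positivity, fun Φ A hA => ?_⟩
    have e : negLaplacianDelta m (l + 1) Φ = -(negLaplacianDelta m l (Δ Φ)) := by
      rw [negLaplacianDelta, Function.iterate_succ_apply', ← negLaplacianDelta,
        ← TemperedDistribution.laplacian_apply_apply]
      rfl
    rw [e, norm_neg, mul_assoc]
    exact h _ _ fun k hk => (norm_iteratedFDeriv_laplacian_le Φ 0 k).trans
      (mul_le_mul_of_nonneg_left (hA _ (by lia)) (Nat.cast_nonneg m))

/-- In the exceptional case the kernel is supported at the origin, so any weight is admissible at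
infinity; otherwise the weight is that of $|x|^{-m-2\beta}$. -/
theorem isControlled_laplacePowDelta (hm : 1 ≤ m) (β : ℂ) :
    IsControlled (-m - 2 * β.re) (laplacePowDelta m β) := by
  unfold laplacePowDelta normRadialDist
  refine IsControlled.smul ?_ _
  split_ifs with h
  · refine IsControlled.smul ?_ _
    obtain ⟨n, C, hC, hb⟩ := exists_bound_negLaplacianDelta m h.choose
    refine ⟨n, C, hC, fun Φ A hA => (hb Φ A fun k hk => hA k hk 0 (by simp)).trans ?_⟩
    refine mul_le_mul_of_nonneg_left (le_add_of_nonneg_right ?_) hC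
    positivity
  · refine IsControlled.smul ?_ _
    have := isControlled_radialDist hm (-(m : ℂ) - 2 * β)
    simpa using this

/-- Consequences of the control for functions dominated by a translate of a Schwartz function. -/
theorem IsControlled.exists_le {a : ℝ} {S : 𝓢'(Eucl m, ℂ)} (h : IsControlled a S)
    (φ : 𝓢(Eucl m, ℂ)) : ∃ (n : ℕ) (C : ℝ), 0 ≤ C ∧
      ∀ (x : Eucl m) (Φ : 𝓢(Eucl m, ℂ)) (M : ℝ), 0 ≤ M →
        (∀ k ≤ n, ∀ z, ‖iteratedFDeriv ℝ k Φ z‖ ≤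
          M * ∑ j ∈ Finset.range (k + 1), ‖iteratedFDeriv ℝ j φ (z + x)‖) →
        ‖S Φ‖ ≤ C * M * (1 + ‖x‖) ^ a := by
  obtain ⟨n, C, hC, h⟩ := h
  obtain ⟨N, hN⟩ := exists_nat_ge |a|
  obtain ⟨K, hK, hd⟩ := exists_decay φ N n
  set I : ℝ := ∫ w : Eucl m, (1 + ‖w‖) ^ |a| * ‖φ w‖ with hI
  have hI0 : 0 ≤ I := by positivity
  have hIi : Integrable fun w : Eucl m => (1 + ‖w‖) ^ |a| * ‖φ w‖ := by
    -- The power $N$ absorbs the weight, the power $m+1$ makes the rest integrable.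
    obtain ⟨K', hK', hd'⟩ := exists_decay φ (N + m + 1) 0
    refine Integrable.mono' ((integrable_one_add_norm (E := Eucl m) (μ := volume) (r := m + 1)
      (by rw [finrank_euclideanSpace_fin]; linarith)).const_mul K') ?_ ?_
    · exact (Continuous.rpow_const (by fun_prop) fun x => Or.inr (abs_nonneg a)).mul
        φ.continuous.norm |>.aestronglyMeasurable
    · refine Eventually.of_forall fun w => ?_
      rw [Real.norm_of_nonneg (by positivity), Real.rpow_neg (by positivity), ← div_eq_mul_inv,
        le_div_iff₀ (by positivity)]
      have h1 : (1 + ‖w‖) ^ |a| ≤ (1 + ‖w‖) ^ N := by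
        rw [← Real.rpow_natCast]
        exact Real.rpow_le_rpow_of_exponent_le (by linarith [norm_nonneg w]) hN
      have h2 : (1 + ‖w‖) ^ (m + 1 : ℝ) = (1 + ‖w‖) ^ (m + 1) := by
        rw [← Real.rpow_natCast]; norm_cast
      have h3 := hd' 0 le_rfl w
      rw [norm_iteratedFDeriv_zero] at h3
      rw [h2]
      calc _ ≤ (1 + ‖w‖) ^ N * ‖φ w‖ * (1 + ‖w‖) ^ (m + 1) := by gcongr
        _ = (1 + ‖w‖) ^ (N + m + 1) * ‖φ w‖ := by ring
        _ ≤ K' := h3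
  refine ⟨n, C * ((n + 1) * K * 2 ^ |a| + 2 ^ |a| * I), by positivity, fun x Φ M hM hΦ => ?_⟩
  -- For $\|z\|\le1$ the decay of $\varphi$ at $z+x$ is decay in $x$: by Peetre
  -- $(1+\|z+x\|)^a\le2^{|a|}(1+\|x\|)^a$.
  have hpt : ∀ k ≤ n, ∀ z, ‖z‖ ≤ 1 → ‖iteratedFDeriv ℝ k Φ z‖ ≤
      M * ((n + 1) * K * 2 ^ |a|) * (1 + ‖x‖) ^ a := by
    intro k hk z hz
    have hx : 0 < 1 + ‖z + x‖ := by positivity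
    have h2 : ∀ j ∈ Finset.range (k + 1), ‖iteratedFDeriv ℝ j φ (z + x)‖ ≤
        K * (2 ^ |a| * (1 + ‖x‖) ^ a) := by
      intro j hj
      have h3 := hd j (by have := Finset.mem_range.1 hj; lia) (z + x)
      have h4 : (1 + ‖z + x‖) ^ (-a) ≤ (1 + ‖z + x‖) ^ N := by
        rw [← Real.rpow_natCast]
        exact Real.rpow_le_rpow_of_exponent_le (by linarith [norm_nonneg (z + x)])
          ((neg_le_abs a).trans hN)
      have h5 : (1 + ‖z + x‖) ^ a ≤ 2 ^ |a| * (1 + ‖x‖) ^ a := by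
        have := one_add_norm_rpow_peetre a (-x) (z + x)
        rw [norm_neg, add_neg_cancel_right] at this
        refine this.trans ?_
        rw [mul_comm]
        gcongr
        linarith
      calc _ = (1 + ‖z + x‖) ^ a * ((1 + ‖z + x‖) ^ (-a) * ‖iteratedFDeriv ℝ j φ (z + x)‖) := by
            rw [← mul_assoc, ← Real.rpow_add hx]; simp
        _ ≤ (1 + ‖z + x‖) ^ a * ((1 + ‖z + x‖) ^ N * ‖iteratedFDeriv ℝ j φ (z + x)‖) := by gcongr
        _ ≤ (2 ^ |a| * (1 + ‖x‖) ^ a) * K := by gcongr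
        _ = _ := mul_comm _ _
    refine (hΦ k hk z).trans ?_
    have h6 := Finset.sum_le_card_nsmul _ _ _ h2
    rw [Finset.card_range, nsmul_eq_mul] at h6
    have h7 : ((k + 1 : ℕ) : ℝ) ≤ n + 1 := by exact_mod_cast Nat.succ_le_succ hk
    calc _ ≤ M * ((n + 1) * (K * (2 ^ |a| * (1 + ‖x‖) ^ a))) := by
          refine mul_le_mul_of_nonneg_left (h6.trans ?_) hM
          gcongr
      _ = _ := by ring
  -- Outside the ball Peetre's inequality extracts $(1+\|x\|)^a$ from $\|z\|^a$. The loss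
  -- $(1+\|z+x\|)^{|a|}$ is absorbed by $\varphi(z+x)$, and translation invariance removes $x$.
  have hint : ∫ z in (Metric.closedBall (0 : Eucl m) 1)ᶜ, ‖z‖ ^ a * ‖Φ z‖ ≤
      M * (2 ^ |a| * I) * (1 + ‖x‖) ^ a := by
    have hbi := (hIi.comp_add_right x).const_mul (M * 2 ^ |a| * (1 + ‖x‖) ^ a)
    calc _ ≤ ∫ z in (Metric.closedBall (0 : Eucl m) 1)ᶜ, M * 2 ^ |a| * (1 + ‖x‖) ^ a *
          ((1 + ‖z + x‖) ^ |a| * ‖φ (z + x)‖) := by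
          refine setIntegral_mono_on (schwartz_norm_rpow_integrable_compl Φ a) hbi.integrableOn
            Metric.isClosed_closedBall.measurableSet.compl fun z hz => ?_
          have hz : 1 < ‖z‖ := by simpa using hz
          have h1 := (one_add_norm_rpow_le a hz.le).2
          have h2 := one_add_norm_rpow_peetre a x z
          have h3 := hΦ 0 (Nat.zero_le _) z
          simp only [norm_iteratedFDeriv_zero, zero_add, Finset.range_one,
            Finset.sum_singleton] at h3
          calc _ ≤ (2 ^ |a| * ((1 + ‖x‖) ^ a * (1 + ‖z + x‖) ^ |a|)) * (M * ‖φ (z + x)‖) := by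
                refine mul_le_mul (h1.trans ?_) h3 (norm_nonneg _) (by positivity)
                gcongr
            _ = _ := by ring
      _ ≤ ∫ z, M * 2 ^ |a| * (1 + ‖x‖) ^ a * ((1 + ‖z + x‖) ^ |a| * ‖φ (z + x)‖) :=
          setIntegral_le_integral hbi (Eventually.of_forall fun z => by positivity)
      _ = _ := by
          rw [integral_const_mul,
            integral_add_right_eq_self (fun z => (1 + ‖z‖) ^ |a| * ‖φ z‖) x]
          ring
  refine (h Φ _ hpt).trans ?_
  calc _ ≤ C * (M * ((n + 1) * K * 2 ^ |a|) * (1 + ‖x‖) ^ a +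
        M * (2 ^ |a| * I) * (1 + ‖x‖) ^ a) := by gcongr
    _ = _ := by ring

/-- Decay of the regularization. -/
theorem IsControlled.norm_regularization_le {a : ℝ} {S : 𝓢'(Eucl m, ℂ)} (h : IsControlled a S)
    (φ : 𝓢(Eucl m, ℂ)) : ∃ C : ℝ, 0 ≤ C ∧ ∀ x, ‖regularization S φ x‖ ≤ C * (1 + ‖x‖) ^ a := by
  obtain ⟨n, C, hC, h⟩ := h.exists_le φ
  refine ⟨C, hC, fun x => ?_⟩
  refine (h x (SchwartzMap.compSubConstCLM ℂ (-x) φ) 1 zero_le_one fun k hk z => ?_).trans_eq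
    (by rw [mul_one])
  rw [iteratedFDeriv_translate, one_mul]
  exact Finset.single_le_sum (f := fun j => ‖iteratedFDeriv ℝ j φ (z + x)‖)
    (fun _ _ => norm_nonneg _) (Finset.self_mem_range_succ k)

end RieszDist

/-! ### The Fourier transform of $|x|^\lambda$ through Gaussians and Mellin transforms. -/

namespace RieszDist

open scoped FourierTransform

/-- The Mellin transform of a superposition of exponentials. -/
theorem Gamma_mul_integral_cpow {X : Type*} [MeasurableSpace X] {ν : Measure X} [SFinite ν]
    {w : X → ℝ} {g : X → ℂ} (hw : Measurable w) (hw0 : ∀ᵐ x ∂ν, 0 < w x)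
    (hg : AEStronglyMeasurable g ν) {s : ℂ} (hs : 0 < s.re)
    (hi : Integrable (fun x => w x ^ (-s.re) * ‖g x‖) ν) :
    Complex.Gamma s * ∫ x, (w x : ℂ) ^ (-s) * g x ∂ν =
      mellin (fun t : ℝ => ∫ x, Complex.exp (-(w x * t)) * g x ∂ν) s := by
  set F : X → ℝ → ℂ := fun x t => (t : ℂ) ^ (s - 1) * Complex.exp (-(w x * t)) * g x with hF
  have hnorm : ∀ x, ∀ t ∈ Ioi (0 : ℝ), ‖F x t‖ =
      t ^ (s.re - 1) * Real.exp (-(w x * t)) * ‖g x‖ := by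
    intro x t ht
    rw [hF]
    simp only [norm_mul]
    rw [Complex.norm_cpow_eq_rpow_re_of_pos ht, Complex.norm_exp]
    simp
  have hreal : ∀ x, 0 < w x → ∫ t in Ioi (0 : ℝ), t ^ (s.re - 1) * Real.exp (-(w x * t)) =
      w x ^ (-s.re) * Real.Gamma s.re := fun x hx => by
    rw [Real.integral_rpow_mul_exp_neg_mul_Ioi hs hx, one_div, Real.inv_rpow hx.le,
      Real.rpow_neg hx.le]
  have hreali : ∀ x, 0 < w x → IntegrableOn
      (fun t => t ^ (s.re - 1) * Real.exp (-(w x * t))) (Ioi (0 : ℝ)) := fun x hx => by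
    -- The integral of a non-integrable function is $0$ by convention, so its positive value proves
    -- integrability.
    refine Integrable.of_integral_ne_zero ?_
    rw [hreal x hx]
    have := Real.Gamma_pos_of_pos hs
    positivity
  have hmeas : AEStronglyMeasurable (Function.uncurry F)
      (ν.prod (volume.restrict (Ioi (0 : ℝ)))) := by
    refine AEStronglyMeasurable.mul (Measurable.aestronglyMeasurable ?_) hg.comp_fst
    have h1 : Measurable fun p : X × ℝ => ((p.2 : ℝ) : ℂ) ^ (s - 1) :=
      (Complex.measurable_ofReal.comp measurable_snd).pow_const _
    have h2 : Measurable fun p : X × ℝ => Complex.exp (-(w p.1 * p.2)) := by fun_prop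
    exact h1.mul h2
  have hint : Integrable (Function.uncurry F) (ν.prod (volume.restrict (Ioi (0 : ℝ)))) := by
    rw [integrable_prod_iff hmeas]
    constructor
    · filter_upwards [hw0] with x hx
      have hm1 : Measurable fun t : ℝ => (t : ℂ) ^ (s - 1) :=
        Complex.measurable_ofReal.pow_const _
      have hm2 : Measurable fun t : ℝ => Complex.exp (-(w x * t)) := by fun_prop
      refine (integrable_norm_iff ((hm1.mul hm2).mul_const (g x)).aestronglyMeasurable).1 ?_
      exact IntegrableOn.congr_fun ((hreali x hx).mul_const ‖g x‖) (fun t ht => (hnorm x t ht).symm)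
        measurableSet_Ioi
    · refine Integrable.congr (hi.const_mul (Real.Gamma s.re)) ?_
      filter_upwards [hw0] with x hx
      refine Eq.trans ?_ (setIntegral_congr_fun measurableSet_Ioi (hnorm x)).symm
      rw [integral_mul_const, hreal x hx]
      ring
  -- This is $\Gamma(s)\,w^{-s}=\int_0^\infty t^{s-1}e^{-wt}\,dt$ inserted under the integral.
  have hL : Complex.Gamma s * ∫ x, (w x : ℂ) ^ (-s) * g x ∂ν =
      ∫ x, (∫ t in Ioi (0 : ℝ), F x t) ∂ν := by
    rw [← integral_const_mul]
    refine integral_congr_ae ?_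
    filter_upwards [hw0] with x hx
    simp only [hF]
    rw [integral_mul_const, Complex.integral_cpow_mul_exp_neg_mul_Ioi hs hx, one_div,
      Complex.inv_cpow _ _ (by rw [Complex.arg_ofReal_of_nonneg hx.le]; exact Real.pi_pos.ne),
      Complex.cpow_neg]
    ring
  rw [hL, integral_integral_swap hint, mellin]
  refine setIntegral_congr_fun measurableSet_Ioi fun t _ => ?_
  simp only [hF, mul_assoc, integral_const_mul, smul_eq_mul]

variable {m : ℕ}

/-- The multiplication formula $\int\widehat g\,f=\int g\,\widehat f$ for $g(v)=e^{-\pi t\|v\|^2}$,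
whose transform is $t^{-m/2}e^{-\pi\|\xi\|^2/t}$. -/
theorem integral_gaussian_mul_fourier {f : Eucl m → ℂ} (hf : Integrable f) {t : ℝ} (ht : 0 < t) :
    ∫ x, Complex.exp (-((Real.pi * ‖x‖ ^ 2 : ℝ) * t)) * 𝓕 f x =
      (t : ℂ) ^ (-(m : ℂ) / 2) *
        ∫ ξ, Complex.exp (-((Real.pi * ‖ξ‖ ^ 2 : ℝ) * (t⁻¹ : ℝ))) * f ξ := by
  have hb : 0 < ((Real.pi * t : ℝ) : ℂ).re := by
    rw [Complex.ofReal_re]; exact mul_pos Real.pi_pos ht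
  have hg : Integrable (fun v : Eucl m => Complex.exp (-((Real.pi * t : ℝ) : ℂ) * ‖v‖ ^ 2)) := by
    simpa using GaussianFourier.integrable_cexp_neg_mul_sq_norm_add hb 0 (0 : Eucl m)
  have h := VectorFourier.integral_fourierIntegral_smul_eq_flip (L := innerₗ (Eucl m))
    Real.continuous_fourierChar continuous_inner hg hf
  have h1 : ∀ ξ : Eucl m, VectorFourier.fourierIntegral Real.fourierChar volume (innerₗ (Eucl m))
      (fun v : Eucl m => Complex.exp (-((Real.pi * t : ℝ) : ℂ) * ‖v‖ ^ 2)) ξ =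
      (t : ℂ) ^ (-(m : ℂ) / 2) * Complex.exp (-((Real.pi * ‖ξ‖ ^ 2 : ℝ) * (t⁻¹ : ℝ))) := by
    intro ξ
    have h2 := fourier_gaussian_innerProductSpace hb ξ
    rw [finrank_euclideanSpace_fin] at h2
    refine h2.trans ?_
    have hpi : (Real.pi : ℂ) ≠ 0 := by exact_mod_cast Real.pi_ne_zero
    have ht0 : (t : ℂ) ≠ 0 := by exact_mod_cast ht.ne'
    congr 1
    · have : (Real.pi : ℂ) / ((Real.pi * t : ℝ) : ℂ) = (t : ℂ)⁻¹ := by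
        push_cast; field_simp
      rw [this, Complex.inv_cpow _ _ (by
        rw [Complex.arg_ofReal_of_nonneg ht.le]; exact Real.pi_pos.ne), neg_div, Complex.cpow_neg]
    · congr 1
      push_cast
      field_simp
  have h3 : ∀ x : Eucl m, VectorFourier.fourierIntegral Real.fourierChar volume
      (innerₗ (Eucl m)).flip f x = 𝓕 f x := by
    intro x
    rw [flip_innerₗ]
    rfl
  simp only [h1, h3, smul_eq_mul, mul_assoc, integral_const_mul] at h
  rw [h]
  refine integral_congr_ae (Eventually.of_forall fun x => ?_)
  simp only
  congr 2
  push_cast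
  ring

/-- The coefficient in the Fourier transform of `|x|^λ`. -/
noncomputable def rieszCoeff (m : ℕ) (lam : ℂ) : ℂ :=
  (Real.pi : ℂ) ^ (-(m : ℂ) / 2 - lam) *
    (Complex.Gamma ((m + lam) / 2) * (Complex.Gamma (-lam / 2))⁻¹)

theorem pi_mul_sq_cpow {r : ℝ} (hr : 0 < r) (s : ℂ) :
    ((Real.pi * r ^ 2 : ℝ) : ℂ) ^ s = (Real.pi : ℂ) ^ s * (r : ℂ) ^ (2 * s) := by
  rw [Complex.ofReal_mul, Complex.mul_cpow_ofReal_nonneg Real.pi_pos.le (by positivity)]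
  have hr0 : (r : ℂ) ≠ 0 := by exact_mod_cast hr.ne'
  rw [sq, Complex.ofReal_mul, Complex.mul_cpow_ofReal_nonneg hr.le hr.le, two_mul,
    Complex.cpow_add _ _ hr0]

theorem pi_mul_sq_rpow {r : ℝ} (hr : 0 < r) (s : ℝ) :
    (Real.pi * r ^ 2) ^ s = Real.pi ^ s * r ^ (2 * s) := by
  rw [Real.mul_rpow Real.pi_pos.le (by positivity), ← Real.rpow_natCast, ← Real.rpow_mul hr.le]
  simp

/-- The Fourier transform of `|x|^λ`, for `-m < Re λ < 0`. -/
theorem integral_norm_cpow_mul_fourier (hm : 1 ≤ m) {f : Eucl m → ℂ} (hf : Integrable f) {lam : ℂ}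
    (h1 : -m < lam.re) (h2 : lam.re < 0)
    (hi1 : Integrable (fun x => ‖x‖ ^ lam.re * ‖𝓕 f x‖))
    (hi2 : Integrable (fun x => ‖x‖ ^ (-m - lam.re) * ‖f x‖)) :
    ∫ x, (‖x‖ : ℂ) ^ lam * 𝓕 f x =
      rieszCoeff m lam * ∫ ξ, (‖ξ‖ : ℂ) ^ (-(m : ℂ) - lam) * f ξ := by
  have hpos := ae_norm_pos hm
  have hw : Measurable fun x : Eucl m => Real.pi * ‖x‖ ^ 2 := by fun_prop
  have hw0 : ∀ᵐ x : Eucl m, 0 < Real.pi * ‖x‖ ^ 2 := by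
    filter_upwards [hpos] with x hx
    exact mul_pos Real.pi_pos (by positivity)
  have hFc : Continuous (𝓕 f) := VectorFourier.fourierIntegral_continuous
    Real.continuous_fourierChar (by exact continuous_inner) hf
  have hpi : (Real.pi : ℂ) ≠ 0 := by exact_mod_cast Real.pi_ne_zero
  have hre1 : (-lam / 2).re = -lam.re / 2 := by simp
  have hre2 : ((m + lam) / 2).re = (m + lam.re) / 2 := by simp
  -- With $w=\pi\|x\|^2$ the exponents $s=-\lambda/2$ and $s=(m+\lambda)/2$ produce $\|x\|^\lambda$
  -- and $\|x\|^{-m-\lambda}$ up to powers of $\pi$.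
  have e1 := Gamma_mul_integral_cpow hw hw0 hFc.aestronglyMeasurable (s := -lam / 2)
    (by rw [hre1]; linarith) (by
      refine (hi1.const_mul (Real.pi ^ (lam.re / 2))).congr ?_
      filter_upwards [hpos] with x hx
      rw [hre1, pi_mul_sq_rpow hx]
      ring_nf)
  have e2 := Gamma_mul_integral_cpow hw hw0 hf.aestronglyMeasurable (s := (m + lam) / 2)
    (by rw [hre2]; linarith) (by
      refine (hi2.const_mul (Real.pi ^ (-(m + lam.re) / 2))).congr ?_
      filter_upwards [hpos] with x hx
      rw [hre2, pi_mul_sq_rpow hx]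
      ring_nf)
  -- The left function is $t^{-m/2}K(1/t)$. The factor shifts the Mellin variable to
  -- $-(m+\lambda)/2$, and the inversion changes its sign.
  have e3 : mellin (fun t : ℝ => ∫ x : Eucl m,
      Complex.exp (-((Real.pi * ‖x‖ ^ 2 : ℝ) * t)) * 𝓕 f x) (-lam / 2) =
      mellin (fun t : ℝ => ∫ x : Eucl m,
        Complex.exp (-((Real.pi * ‖x‖ ^ 2 : ℝ) * t)) * f x) ((m + lam) / 2) := by
    set K : ℝ → ℂ := fun t => ∫ x : Eucl m,
      Complex.exp (-((Real.pi * ‖x‖ ^ 2 : ℝ) * t)) * f x with hK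
    have : mellin (fun t : ℝ => ∫ x : Eucl m,
        Complex.exp (-((Real.pi * ‖x‖ ^ 2 : ℝ) * t)) * 𝓕 f x) (-lam / 2) =
        mellin (fun t : ℝ => (t : ℂ) ^ (-(m : ℂ) / 2) • K t⁻¹) (-lam / 2) := by
      refine setIntegral_congr_fun measurableSet_Ioi fun t ht => ?_
      simp only [integral_gaussian_mul_fourier hf ht, smul_eq_mul, hK]
    rw [this, mellin_cpow_smul, mellin_comp_inv K]
    congr 1
    ring
  have hG : Complex.Gamma (-lam / 2) ≠ 0 := by
    refine Complex.Gamma_ne_zero_of_re_pos ?_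
    rw [hre1]; linarith
  have c1 : ∫ x : Eucl m, ((Real.pi * ‖x‖ ^ 2 : ℝ) : ℂ) ^ (-(-lam / 2)) * 𝓕 f x =
      (Real.pi : ℂ) ^ (lam / 2) * ∫ x, (‖x‖ : ℂ) ^ lam * 𝓕 f x := by
    rw [← integral_const_mul]
    refine integral_congr_ae ?_
    filter_upwards [hpos] with x hx
    rw [pi_mul_sq_cpow hx]
    ring_nf
  have c2 : ∫ x : Eucl m, ((Real.pi * ‖x‖ ^ 2 : ℝ) : ℂ) ^ (-((m + lam) / 2)) * f x =
      (Real.pi : ℂ) ^ (-(m + lam) / 2) * ∫ x, (‖x‖ : ℂ) ^ (-(m : ℂ) - lam) * f x := by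
    rw [← integral_const_mul]
    refine integral_congr_ae ?_
    filter_upwards [hpos] with x hx
    rw [pi_mul_sq_cpow hx]
    ring_nf
  rw [c1] at e1
  rw [c2] at e2
  have e4 := e1.trans (e3.trans e2.symm)
  have hp : (Real.pi : ℂ) ^ (-(m : ℂ) / 2 - lam) * (Real.pi : ℂ) ^ (lam / 2) =
      (Real.pi : ℂ) ^ (-(m + lam) / 2) := by
    rw [← Complex.cpow_add _ _ hpi]
    congr 1
    ring
  have hp0 : (Real.pi : ℂ) ^ (lam / 2) ≠ 0 := by simp [Complex.cpow_eq_zero_iff, hpi]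
  rw [← hp] at e4
  refine mul_left_cancel₀ (mul_ne_zero hG hp0) ?_
  rw [rieszCoeff, mul_assoc (Complex.Gamma _), e4]
  set I : ℂ := ∫ x, (‖x‖ : ℂ) ^ (-(m : ℂ) - lam) * f x
  calc _ = (Real.pi : ℂ) ^ (-(m : ℂ) / 2 - lam) * (Real.pi : ℂ) ^ (lam / 2) *
        Complex.Gamma ((m + lam) / 2) * I := by ring
    _ = (Real.pi : ℂ) ^ (-(m : ℂ) / 2 - lam) * (Real.pi : ℂ) ^ (lam / 2) *
        Complex.Gamma ((m + lam) / 2) * I *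
          (Complex.Gamma (-lam / 2) * (Complex.Gamma (-lam / 2))⁻¹) := by
        rw [mul_inv_cancel₀ hG, mul_one]
    _ = _ := by ring

theorem integral_norm_cpow_mul_fourierInv (hm : 1 ≤ m) {f : Eucl m → ℂ} (hf : Integrable f)
    {lam : ℂ} (h1 : -m < lam.re) (h2 : lam.re < 0)
    (hi1 : Integrable (fun x => ‖x‖ ^ lam.re * ‖𝓕⁻ f x‖))
    (hi2 : Integrable (fun x => ‖x‖ ^ (-m - lam.re) * ‖f x‖)) :
    ∫ x, (‖x‖ : ℂ) ^ lam * 𝓕⁻ f x =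
      rieszCoeff m lam * ∫ ξ, (‖ξ‖ : ℂ) ^ (-(m : ℂ) - lam) * f ξ := by
  rw [← integral_norm_cpow_mul_fourier hm hf h1 h2 ?_ hi2,
    ← integral_neg_eq_self (fun x => (‖x‖ : ℂ) ^ lam * 𝓕 f x)]
  · simp [Real.fourierInv_eq_fourier_neg]
  · have := hi1.comp_neg
    simpa [Real.fourierInv_eq_fourier_neg] using this

/-- Since $1/\Gamma$ is entire, the only poles are those of $\Gamma((m+\lambda)/2)$, the same points
where $T_\lambda$ may have poles. -/
theorem differentiableAt_rieszCoeff {lam : ℂ} (h : ∀ l : ℕ, lam ≠ -(m : ℂ) - 2 * l) :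
    DifferentiableAt ℂ (rieszCoeff m) lam := by
  have hpi : (Real.pi : ℂ) ≠ 0 := by exact_mod_cast Real.pi_ne_zero
  unfold rieszCoeff
  refine DifferentiableAt.mul ?_ (DifferentiableAt.mul ?_ ?_)
  · exact DifferentiableAt.const_cpow (by fun_prop) (Or.inl hpi)
  · refine DifferentiableAt.comp (g := Complex.Gamma) (f := fun z : ℂ => (m + z) / 2) lam
      (Complex.differentiableAt_Gamma _ fun l h0 => h l ?_) (by fun_prop)
    linear_combination 2 * h0
  · exact DifferentiableAt.comp (g := fun z => (Complex.Gamma z)⁻¹) (f := fun z : ℂ => -z / 2) lam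
      (Complex.differentiable_one_div_Gamma _) (by fun_prop)

end RieszDist

/-! ### Fourier transforms of the kernels and their constants. -/

namespace RieszDist

open scoped FourierTransform LineDeriv

variable {m : ℕ}

theorem norm_rpow_integrable_ball (hm : 1 ≤ m) {g : Eucl m → ℂ} (hg : Continuous g) {a : ℝ}
    (ha : -m < a) : IntegrableOn (fun x => ‖x‖ ^ a * ‖g x‖) (Metric.closedBall 0 1) := by
  obtain ⟨M, hM⟩ := (isCompact_closedBall (0 : Eucl m) 1).exists_bound_of_continuousOn
    hg.continuousOn
  refine Integrable.mono' ((integrableOn_norm_rpow_closedBall hm ha).mul_const M) ?_ ?_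
  · exact (measurable_norm.pow_const a).aestronglyMeasurable.mul hg.norm.aestronglyMeasurable
  · refine (ae_restrict_iff' Metric.isClosed_closedBall.measurableSet).2
      (Eventually.of_forall fun x hx => ?_)
    rw [Real.norm_of_nonneg (by positivity)]
    gcongr
    exact hM x hx

theorem schwartz_norm_rpow_integrable (hm : 1 ≤ m) (φ : 𝓢(Eucl m, ℂ)) {a : ℝ} (ha : -m < a) :
    Integrable (fun x => ‖x‖ ^ a * ‖φ x‖) := by
  rw [← integrableOn_univ, ← union_compl_self (Metric.closedBall (0 : Eucl m) 1)]
  exact (norm_rpow_integrable_ball hm φ.continuous ha).union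
    (schwartz_norm_rpow_integrable_compl φ a)

theorem setIntegral_norm_cpow_closedBall (hm : 1 ≤ m) {lam : ℂ} (h : -m < lam.re) :
    IntegrableOn (fun x : Eucl m => (‖x‖ : ℂ) ^ lam) (Metric.closedBall 0 1) ∧
    ∫ x in Metric.closedBall (0 : Eucl m) 1, (‖x‖ : ℂ) ^ lam =
      (sphereArea m : ℂ) / (lam + m) := by
  have hi : IntegrableOn (fun x : Eucl m => (‖x‖ : ℂ) ^ lam * 1) (Metric.closedBall 0 1) := by
    have h1 := norm_rpow_integrable_ball hm (g := fun _ => 1) continuous_const h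
    exact integrable_cpow_mul measurable_norm (ae_restrict_of_ae (ae_norm_pos hm))
      aestronglyMeasurable_const h1 h1 le_rfl le_rfl
  have e : Metric.closedBall (0 : Eucl m) 1 = {x | ‖x‖ ∈ Iic (1 : ℝ)} := by ext; simp
  refine ⟨by simpa using hi, ?_⟩
  have h2 := setIntegral_polar_cpow hm lam (g := fun _ => 1) measurableSet_Iic (e ▸ hi)
  rw [← e] at h2
  simp only [mul_one] at h2
  rw [h2]
  have hre : -1 < (lam + m - 1).re := by simp; linarith
  have hne : lam + m ≠ 0 := fun h0 => by
    have := congrArg Complex.re h0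
    simp at this
    linarith
  change ∫ r in Ioc (0 : ℝ) 1, _ = _
  rw [integral_mul_const, ← intervalIntegral.integral_of_le zero_le_one,
    integral_cpow (Or.inl hre)]
  simp [hne, sphereArea, Complex.zero_cpow, div_eq_mul_inv, mul_comm]

/-- For $\operatorname{Re}\lambda>-m$ nothing needs regularizing: the subtracted integral of
$g(0)|x|^\lambda$ over the unit ball is exactly the pole term $\sigma_m g(0)/(\lambda+m)$. -/
theorem rieszFunctional_eq_integral (hm : 1 ≤ m) {lam : ℂ} (h : -m < lam.re) {g : Eucl m → ℂ}
    (hg : Continuous g)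
    (hi : IntegrableOn (fun x => ‖x‖ ^ lam.re * ‖g x‖) (Metric.closedBall 0 1)ᶜ) :
    Integrable (fun x => (‖x‖ : ℂ) ^ lam * g x) ∧
      rieszFunctional lam g = ∫ x, (‖x‖ : ℂ) ^ lam * g x := by
  have hb := norm_rpow_integrable_ball hm hg h
  have h1 : IntegrableOn (fun x => (‖x‖ : ℂ) ^ lam * g x) (Metric.closedBall 0 1) :=
    integrable_cpow_mul measurable_norm (ae_restrict_of_ae (ae_norm_pos hm))
      hg.aestronglyMeasurable hb hb le_rfl le_rfl
  have h2 : IntegrableOn (fun x => (‖x‖ : ℂ) ^ lam * g x) (Metric.closedBall 0 1)ᶜ :=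
    integrable_cpow_mul measurable_norm (ae_restrict_of_ae (ae_norm_pos hm))
      hg.aestronglyMeasurable hi hi le_rfl le_rfl
  have h3 : Integrable (fun x => (‖x‖ : ℂ) ^ lam * g x) := by
    rw [← integrableOn_univ, ← union_compl_self (Metric.closedBall (0 : Eucl m) 1)]
    exact h1.union h2
  obtain ⟨h4, h5⟩ := setIntegral_norm_cpow_closedBall hm h
  refine ⟨h3, ?_⟩
  rw [← integral_add_compl Metric.isClosed_closedBall.measurableSet h3, rieszFunctional]
  simp only [mul_sub]
  rw [integral_sub h1 (h4.mul_const _), integral_mul_const, h5]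
  ring

theorem integral_fourier_eq (φ : 𝓢(Eucl m, ℂ)) : ∫ ξ, 𝓕 φ ξ = φ 0 := by
  have h : (𝓕⁻ (𝓕 φ)) 0 = φ 0 := by rw [FourierTransform.fourierInv_fourier_eq]
  rw [← h, SchwartzMap.fourierInv_coe, Real.fourierInv_eq]
  simp

/-- In the strip $-m<\operatorname{Re}\lambda<0$ this is the classical formula applied to $\mathcal
F\varphi$. The integral on the right is holomorphic for $\operatorname{Re}\lambda<0$, so the
identity continues to the left past the poles on the real axis. -/
theorem radialDist_eq_integral_fourier (hm : 1 ≤ m) {lam : ℂ} (h0 : lam.re < 0)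
    (h : ∀ l : ℕ, lam ≠ -(m : ℂ) - 2 * l) (φ : 𝓢(Eucl m, ℂ)) :
    radialDist m lam φ =
      rieszCoeff m lam * ∫ ξ, (‖ξ‖ : ℂ) ^ (-(m : ℂ) - lam) * 𝓕 φ ξ := by
  have hm' : (1 : ℝ) ≤ m := by exact_mod_cast hm
  have hd : ∀ z : ℂ, z.re < 0 → DifferentiableAt ℂ
      (fun z : ℂ => ∫ ξ : Eucl m, (‖ξ‖ : ℂ) ^ (-(m : ℂ) - z) * 𝓕 φ ξ) z := by
    intro z hz
    refine DifferentiableAt.comp (g := fun w : ℂ => ∫ ξ : Eucl m, (‖ξ‖ : ℂ) ^ w * 𝓕 φ ξ)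
      (f := fun z : ℂ => -(m : ℂ) - z) z ?_ (by fun_prop)
    exact differentiableAt_integral_cpow measurable_norm (ae_norm_pos hm)
      (𝓕 φ).continuous.aestronglyMeasurable
      (schwartz_norm_rpow_integrable hm (𝓕 φ) (a := -m - z.re / 2) (by linarith))
      (schwartz_norm_rpow_integrable hm (𝓕 φ) (a := -m - z.re + 1) (by linarith))
      (by simp; linarith) (by simp)
  have hne : ∀ z : ℂ, z.im ≠ 0 → ∀ l : ℕ, z ≠ -(m : ℂ) - 2 * l := by
    rintro z hz l rfl
    simp at hz
  refine eq_of_eqOn_strip (f := fun z => radialDist m z φ)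
    (g := fun z => rieszCoeff m z * ∫ ξ : Eucl m, (‖ξ‖ : ℂ) ^ (-(m : ℂ) - z) * 𝓕 φ ξ)
    (a := min (-m) (lam.re - 1)) (b := 0) (c := -m) (d := 0) (min_le_left _ _)
    (by linarith) le_rfl (fun z _ _ hz => differentiableAt_radialDist φ (hne z hz))
    (fun z _ hz0 hz => (differentiableAt_rieszCoeff (hne z hz)).mul (hd z hz0))
    (fun z hz1 hz2 => ?_) ((min_le_right _ _).trans_lt (by linarith)) h0
    (differentiableAt_radialDist φ h).continuousAt
    ((differentiableAt_rieszCoeff h).mul (hd lam h0)).continuousAt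
  rw [radialDist_eq_rieszFunctional hm hz1.le,
    (rieszFunctional_eq_integral hm hz1 φ.continuous
      (schwartz_norm_rpow_integrable_compl φ z.re)).2]
  have hinv : 𝓕⁻ (⇑(𝓕 φ : 𝓢(Eucl m, ℂ))) = φ := by
    rw [← SchwartzMap.fourierInv_coe, FourierTransform.fourierInv_fourier_eq]
  have key := integral_norm_cpow_mul_fourierInv hm (𝓕 φ).integrable hz1 hz2
    (by rw [hinv]; exact schwartz_norm_rpow_integrable hm φ hz1)
    (schwartz_norm_rpow_integrable hm (𝓕 φ) (by linarith))
  rwa [hinv] at key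

theorem fourier_laplacian_apply (φ : 𝓢(Eucl m, ℂ)) (ξ : Eucl m) :
    𝓕 (Δ φ : 𝓢(Eucl m, ℂ)) ξ = -(2 * Real.pi) ^ 2 * (‖ξ‖ : ℂ) ^ 2 * 𝓕 φ ξ := by
  rw [SchwartzMap.laplacian_eq_fourierMultiplierCLM, SchwartzMap.fourierMultiplierCLM_apply,
    ← FourierTransform.fourierInv_smul, FourierTransform.fourier_fourierInv_eq, smul_apply,
    SchwartzMap.smulLeftCLM_apply_apply (Function.hasTemperateGrowth_norm_sq (Eucl m)),
    Complex.real_smul, Complex.real_smul, ← mul_assoc]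
  simp

theorem negLaplacianDelta_eq_integral_fourier (l : ℕ) :
    ∀ φ : 𝓢(Eucl m, ℂ), negLaplacianDelta m l φ =
      (2 * Real.pi : ℂ) ^ (2 * l) * ∫ ξ, (‖ξ‖ : ℂ) ^ (2 * l) * 𝓕 φ ξ := by
  induction l with
  | zero => intro φ; simp [negLaplacianDelta, integral_fourier_eq]
  | succ l ih =>
    intro φ
    have e : negLaplacianDelta m (l + 1) φ = -(negLaplacianDelta m l (Δ φ)) := by
      rw [negLaplacianDelta, Function.iterate_succ_apply', ← negLaplacianDelta,
        ← TemperedDistribution.laplacian_apply_apply]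
      rfl
    rw [e, ih, ← mul_neg, ← integral_neg, ← integral_const_mul, ← integral_const_mul]
    refine integral_congr_ae (Eventually.of_forall fun ξ => ?_)
    simp only [fourier_laplacian_apply]
    ring

theorem two_pi_cpow (s : ℂ) : (2 * Real.pi : ℂ) ^ s = 2 ^ s * (Real.pi : ℂ) ^ s := by
  have := Complex.mul_cpow_ofReal_nonneg zero_le_two Real.pi_pos.le s
  exact_mod_cast this

/-- For `Re β ≥ 0` the Fourier transform of `(-Δ)^β δ` is `(2π|ξ|)^(2β)`. -/
theorem laplacePowDelta_eq_integral_fourier (hm : 1 ≤ m) {β : ℂ} (hβ : 0 ≤ β.re)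
    (φ : 𝓢(Eucl m, ℂ)) : laplacePowDelta m β φ =
      (2 * Real.pi : ℂ) ^ (2 * β) * ∫ ξ, (‖ξ‖ : ℂ) ^ (2 * β) * 𝓕 φ ξ := by
  have hm' : (1 : ℝ) ≤ m := by exact_mod_cast hm
  have hpi : (Real.pi : ℂ) ≠ 0 := by exact_mod_cast Real.pi_ne_zero
  have hpc : ∀ s : ℂ, (Real.pi : ℂ) ^ s ≠ 0 := fun s => by simp [Complex.cpow_eq_zero_iff, hpi]
  have h2c : ∀ s : ℂ, (2 : ℂ) ^ s ≠ 0 := fun s => by simp [Complex.cpow_eq_zero_iff]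
  have hG : Complex.Gamma (((m : ℂ) + 2 * β) / 2) ≠ 0 := by
    refine Complex.Gamma_ne_zero_of_re_pos ?_
    simp
    linarith
  unfold laplacePowDelta normRadialDist
  split_ifs with h
  -- The exceptional branch means $\beta=l\in\mathbb N_0$, where the constants cancel and
  -- $(-\Delta)^l\delta$ has the polynomial symbol.
  · have hl := h.choose_spec
    set l := h.choose
    have hβl : β = l := by linear_combination (-1 / 2) * hl
    have e : ∀ (c d : ℂ) (S : 𝓢'(Eucl m, ℂ)), (c • d • S) φ = c * d * S φ := fun c d S => by
      rw [mul_assoc]; rfl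
    rw [e, negLaplacianDelta_eq_integral_fourier]
    have e1 : (m : ℂ) / 2 + l = (m + 2 * β) / 2 := by rw [hβl]; ring
    have e2 : (m : ℂ) / 2 - l = (m - 2 * β) / 2 := by rw [hβl]; ring
    have e3 : ∀ z : ℂ, z ^ (2 * l) = z ^ (2 * β) := fun z => by
      rw [hβl, ← Complex.cpow_natCast]; push_cast; rfl
    rw [e1, e2]
    simp only [e3]
    have := hpc ((m - 2 * β) / 2)
    have := h2c (2 * β)
    field_simp
  · have e : ∀ (c d : ℂ) (S : 𝓢'(Eucl m, ℂ)), (c • d • S) φ = c * d * S φ := fun c d S => by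
      rw [mul_assoc]; rfl
    push Not at h
    rw [e, radialDist_eq_integral_fourier hm (by simp; linarith) h, rieszCoeff, two_pi_cpow]
    have e1 : (-(m : ℂ) - 2 * β + m) / 2 = -β := by ring
    have e2 : -(m : ℂ) / 2 - (-(m : ℂ) - 2 * β) = m / 2 + 2 * β := by ring
    have e3 : ((m : ℂ) + (-(m : ℂ) - 2 * β)) / 2 = -β := by ring
    have e4 : -(-(m : ℂ) - 2 * β) / 2 = (m + 2 * β) / 2 := by ring
    have e5 : -(m : ℂ) - (-(m : ℂ) - 2 * β) = 2 * β := by ring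
    -- The factor $\Gamma(-\beta)$ from `rieszCoeff` cancels the normalization of $T^*$; it is not
    -- at a pole because $\beta\notin\mathbb N_0$ in this branch.
    have hG2 : Complex.Gamma (-β) ≠ 0 := Complex.Gamma_ne_zero fun l h0 => h l (by
      linear_combination 2 * h0)
    rw [e1, e2, e3, e4, e5]
    have hp : (Real.pi : ℂ) ^ (2 * β) * (Real.pi : ℂ) ^ ((m - 2 * β) / 2) =
        (Real.pi : ℂ) ^ (-β) * (Real.pi : ℂ) ^ (m / 2 + 2 * β) := by
      rw [← Complex.cpow_add _ _ hpi, ← Complex.cpow_add _ _ hpi]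
      congr 1
      ring
    have h7 := hpc ((m - 2 * β) / 2)
    set I := ∫ ξ : Eucl m, (‖ξ‖ : ℂ) ^ (2 * β) * 𝓕 φ ξ
    rw [eq_div_of_mul_eq h7 hp]
    field_simp

/-- The normalizing constant of the Riesz kernel. -/
noncomputable def rieszConst (m : ℕ) (α : ℂ) : ℂ :=
  (2 : ℂ) ^ (-(2 * α)) * (Complex.Gamma (((m : ℂ) - 2 * α) / 2) /
    (Real.pi : ℂ) ^ (((m : ℂ) + 2 * α) / 2)) * ((Real.pi : ℂ) ^ α / Complex.Gamma α)

theorem ne_neg_nat_of_re_nonneg {α : ℂ} (h : 0 ≤ α.re) (h0 : α ≠ 0) (l : ℕ) : α ≠ -l := by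
  rintro rfl
  rcases Nat.eq_zero_or_pos l with rfl | hl
  · simp at h0
  · have : (0 : ℝ) < l := by exact_mod_cast hl
    simp at h
    linarith

/-- The conditions on $\alpha$ rule out the exceptional branch, so the kernel of
$(-\Delta)^{-\alpha}$ is a multiple of $\mathrm{Fp}\,|x|^{-m+2\alpha}$. -/
theorem laplacePowDelta_neg_apply (m : ℕ) {α : ℂ} (h : 0 ≤ α.re) (h0 : α ≠ 0)
    (φ : 𝓢(Eucl m, ℂ)) : laplacePowDelta m (-α) φ =
      rieszConst m α * radialDist m (-(m : ℂ) + 2 * α) φ := by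
  have e0 : -(m : ℂ) - 2 * (-α) = -(m : ℂ) + 2 * α := by ring
  have hn : ¬ ∃ l : ℕ, -(m : ℂ) + 2 * α = -(m : ℂ) - 2 * l := by
    rintro ⟨l, hl⟩
    exact ne_neg_nat_of_re_nonneg h h0 l (by linear_combination hl / 2)
  have e : ∀ (c d : ℂ) (S : 𝓢'(Eucl m, ℂ)), (c • d • S) φ = c * d * S φ := fun c d S => by
    rw [mul_assoc]; rfl
  unfold laplacePowDelta normRadialDist
  rw [e0, dif_neg hn, e, rieszConst]
  congr 3
  · congr 1; ring
  · congr 2 <;> ring_nf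
  · congr 1; ring
  · congr 1; ring

theorem rieszConst_mul_rieszCoeff {α : ℂ} (h : 0 ≤ α.re) (h0 : α ≠ 0)
    (hα : ∀ n : ℕ, α ≠ ((m : ℂ) + 2 * n) / 2) :
    rieszConst m α * rieszCoeff m (-(m : ℂ) + 2 * α) * (2 * Real.pi : ℂ) ^ (2 * α) = 1 := by
  have hpi : (Real.pi : ℂ) ≠ 0 := by exact_mod_cast Real.pi_ne_zero
  have hpc : ∀ s : ℂ, (Real.pi : ℂ) ^ s ≠ 0 := fun s => by simp [Complex.cpow_eq_zero_iff, hpi]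
  have h2c : ∀ s : ℂ, (2 : ℂ) ^ s ≠ 0 := fun s => by simp [Complex.cpow_eq_zero_iff]
  have hG1 : Complex.Gamma α ≠ 0 := Complex.Gamma_ne_zero (ne_neg_nat_of_re_nonneg h h0)
  -- The excluded values $\alpha=m/2+n$ are the poles of this factor; there `Complex.Gamma` has the
  -- default value $0$ and the product would vanish.
  have hG2 : Complex.Gamma ((m - 2 * α) / 2) ≠ 0 := Complex.Gamma_ne_zero fun n hn =>
    hα n (by linear_combination -hn)
  have e1 : ((m : ℂ) + (-(m : ℂ) + 2 * α)) / 2 = α := by ring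
  have e2 : -(-(m : ℂ) + 2 * α) / 2 = (m - 2 * α) / 2 := by ring
  have e3 : -(m : ℂ) / 2 - (-(m : ℂ) + 2 * α) = (m : ℂ) / 2 - 2 * α := by ring
  rw [rieszConst, rieszCoeff, two_pi_cpow, e1, e2, e3, Complex.cpow_neg]
  have hp : (Real.pi : ℂ) ^ α * (Real.pi : ℂ) ^ ((m : ℂ) / 2 - 2 * α) * (Real.pi : ℂ) ^ (2 * α) =
      (Real.pi : ℂ) ^ ((m + 2 * α) / 2) := by
    rw [← Complex.cpow_add _ _ hpi, ← Complex.cpow_add _ _ hpi]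
    congr 1
    ring
  rw [← hp]
  have h3 := hpc α
  have h4 := hpc ((m : ℂ) / 2 - 2 * α)
  have h5 := hpc (2 * α)
  have h6 := h2c (2 * α)
  field_simp

end RieszDist

/-! ### The Riesz kernel inverts $(-\Delta)^\alpha$ on regularizations. -/

namespace RieszDist

open scoped FourierTransform RealInnerProductSpace

variable {m : ℕ}

theorem norm_rpow_integrable_compl_of_le {g : Eucl m → ℂ} (hg : Continuous g) {C a s : ℝ}
    (hC : ∀ x, ‖g x‖ ≤ C * (1 + ‖x‖) ^ a) (hs : s + a < -m) :
    IntegrableOn (fun x => ‖x‖ ^ s * ‖g x‖) (Metric.closedBall 0 1)ᶜ := by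
  have hC0 : 0 ≤ C := by simpa using (norm_nonneg _).trans (hC 0)
  refine Integrable.mono' ((integrableOn_norm_rpow_compl m hs).const_mul (C * 2 ^ |a|)) ?_
    ((ae_restrict_iff' Metric.isClosed_closedBall.measurableSet.compl).2
      (Eventually.of_forall fun x hx => ?_))
  · exact (measurable_norm.pow_const s).aestronglyMeasurable.mul hg.norm.aestronglyMeasurable
  · have hx : 1 < ‖x‖ := by simpa using hx
    have hx0 : 0 < ‖x‖ := zero_lt_one.trans hx
    rw [Real.norm_of_nonneg (by positivity)]
    calc _ ≤ ‖x‖ ^ s * (C * (2 ^ |a| * ‖x‖ ^ a)) := by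
          gcongr
          refine (hC x).trans ?_
          gcongr
          exact (one_add_norm_rpow_le a hx.le).1
      _ = _ := by rw [Real.rpow_add hx0]; ring

theorem fourier_translate (φ : 𝓢(Eucl m, ℂ)) (x ξ : Eucl m) :
    𝓕 (SchwartzMap.compSubConstCLM ℂ (-x) φ) ξ = Real.fourierChar ⟪ξ, x⟫ • 𝓕 φ ξ := by
  have e : ⇑(SchwartzMap.compSubConstCLM ℂ (-x) φ) = φ ∘ fun y => y + x := by
    funext y; simp
  have h := congrFun (VectorFourier.fourierIntegral_comp_add_right Real.fourierChar volume
    (innerₗ (Eucl m)) φ x) ξ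
  rw [SchwartzMap.fourier_coe, e, SchwartzMap.fourier_coe]
  refine h.trans ?_
  rw [innerₗ_apply_apply, real_inner_comm]
  rfl

/-- The regularization of `(-Δ)^α δ` in terms of the Fourier transform. -/
theorem regularization_laplacePowDelta (hm : 1 ≤ m) {α : ℂ} (hα : 0 ≤ α.re) (φ : 𝓢(Eucl m, ℂ)) :
    regularization (laplacePowDelta m α) φ =
      𝓕⁻ (fun ξ : Eucl m => (2 * Real.pi : ℂ) ^ (2 * α) * ((‖ξ‖ : ℂ) ^ (2 * α) * 𝓕 φ ξ)) := by
  funext x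
  rw [regularization, laplacePowDelta_eq_integral_fourier hm hα, Real.fourierInv_eq,
    ← integral_const_mul]
  refine integral_congr_ae (Eventually.of_forall fun ξ => ?_)
  simp only [fourier_translate, Circle.smul_def, smul_eq_mul]
  ring

theorem symbol_integrable (hm : 1 ≤ m) {α : ℂ} (φ : 𝓢(Eucl m, ℂ)) {s : ℝ}
    (hs : -m < s + 2 * α.re) :
    Integrable (fun ξ : Eucl m => ‖ξ‖ ^ s *
      ‖(2 * Real.pi : ℂ) ^ (2 * α) * ((‖ξ‖ : ℂ) ^ (2 * α) * 𝓕 φ ξ)‖) := by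
  refine ((schwartz_norm_rpow_integrable hm (𝓕 φ) hs).const_mul
    ‖(2 * Real.pi : ℂ) ^ (2 * α)‖).congr ?_
  filter_upwards [ae_norm_pos hm] with ξ hξ
  rw [norm_mul, norm_mul, Complex.norm_cpow_eq_rpow_re_of_pos hξ, Real.rpow_add hξ]
  have : (2 * α).re = 2 * α.re := by simp
  rw [this]
  ring

/-- The lower bound for $\operatorname{Re}z$ comes from the single subtraction at the origin, the
upper one from the decay of $g$, and $z=-m$ is the pole of the third term. -/
theorem differentiableAt_rieszFunctional (hm : 1 ≤ m) {g : Eucl m → ℂ} (hg : ContDiff ℝ 1 g)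
    {C a : ℝ} (hC : ∀ x, ‖g x‖ ≤ C * (1 + ‖x‖) ^ a) {z : ℂ} (h1 : -m - 1 < z.re)
    (h2 : z.re + a < -m) (h3 : z ≠ -m) :
    DifferentiableAt ℂ (fun z => rieszFunctional z g) z := by
  obtain ⟨M, hM⟩ := exists_lipschitz_zero hg
  unfold rieszFunctional
  refine DifferentiableAt.add (DifferentiableAt.add ?_ ?_) ?_
  · exact differentiableAt_integral_cpow measurable_norm (ae_restrict_of_ae (ae_norm_pos hm))
      (hg.continuous.sub continuous_const).aestronglyMeasurable
      (norm_rpow_sub_integrable hm hg.continuous hM (a := (-m - 1 + z.re) / 2) (by linarith))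
      (norm_rpow_sub_integrable hm hg.continuous hM (a := z.re + 1) (by linarith))
      (by linarith) (by linarith)
  · exact differentiableAt_integral_cpow measurable_norm (ae_restrict_of_ae (ae_norm_pos hm))
      hg.continuous.aestronglyMeasurable
      (norm_rpow_integrable_compl_of_le hg.continuous hC (s := z.re - 1) (by linarith))
      (norm_rpow_integrable_compl_of_le hg.continuous hC (s := (z.re + (-m - a)) / 2)
        (by linarith)) (by linarith) (by linarith)
  · exact (differentiableAt_const _).div (by fun_prop) fun h => h3 (eq_neg_of_add_eq_zero_left h)

/-- The Riesz kernel inverts `(-Δ)^α`, on the level of the regularized integrals. -/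
theorem rieszConst_mul_rieszFunctional (hm : 1 ≤ m) {α : ℂ} (h : 0 ≤ α.re) (h0 : α ≠ 0)
    (hα : ∀ n : ℕ, α ≠ ((m : ℂ) + 2 * n) / 2) (φ : 𝓢(Eucl m, ℂ)) :
    rieszConst m α * rieszFunctional (-(m : ℂ) + 2 * α)
      (regularization (laplacePowDelta m α) φ) = φ 0 := by
  have hm' : (1 : ℝ) ≤ m := by exact_mod_cast hm
  set ψ := regularization (laplacePowDelta m α) φ with hψ
  have hψ1 : ContDiff ℝ 1 ψ := contDiff_regularization (laplacePowDelta m α) 1 φ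
  obtain ⟨C, -, hC⟩ := (isControlled_laplacePowDelta hm α).norm_regularization_le φ
  set f : Eucl m → ℂ := fun ξ =>
    (2 * Real.pi : ℂ) ^ (2 * α) * ((‖ξ‖ : ℂ) ^ (2 * α) * 𝓕 φ ξ) with hf
  have hψf : ψ = 𝓕⁻ f := regularization_laplacePowDelta hm h φ
  have hfi : ∀ s : ℝ, -m < s + 2 * α.re → Integrable fun ξ => ‖ξ‖ ^ s * ‖f ξ‖ :=
    fun s hs => symbol_integrable hm φ hs
  have hfm : AEStronglyMeasurable f := by
    have h1 : Measurable fun ξ : Eucl m => (‖ξ‖ : ℂ) ^ (2 * α) :=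
      (Complex.measurable_ofReal.comp measurable_norm).pow_const _
    exact ((h1.mul (𝓕 φ).continuous.measurable).const_mul _).aestronglyMeasurable
  have hf1 : Integrable f := by
    have := hfi 0 (by linarith)
    simp only [Real.rpow_zero, one_mul] at this
    exact (integrable_norm_iff hfm).1 this
  have hd : ∀ z : ℂ, z.re < 2 * α.re → DifferentiableAt ℂ
      (fun z : ℂ => ∫ ξ : Eucl m, (‖ξ‖ : ℂ) ^ (-(m : ℂ) - z) * f ξ) z := by
    intro z hz
    refine DifferentiableAt.comp (g := fun w : ℂ => ∫ ξ : Eucl m, (‖ξ‖ : ℂ) ^ w * f ξ)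
      (f := fun z : ℂ => -(m : ℂ) - z) z ?_ (by fun_prop)
    exact differentiableAt_integral_cpow measurable_norm (ae_norm_pos hm) hfm
      (hfi (-m - (z.re + 2 * α.re) / 2) (by linarith)) (hfi (-m - z.re + 1) (by linarith))
      (by simp; linarith) (by simp)
  have hne : ∀ z : ℂ, z.im ≠ 0 → ∀ l : ℕ, z ≠ -(m : ℂ) - 2 * l := by
    rintro z hz l rfl
    simp at hz
  have hne' : ∀ l : ℕ, -(m : ℂ) + 2 * α ≠ -(m : ℂ) - 2 * l := fun l hl =>
    ne_neg_nat_of_re_nonneg h h0 l (by linear_combination hl / 2)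
  have hre : (-(m : ℂ) + 2 * α).re = -m + 2 * α.re := by simp
  have hG : ∀ z : ℂ, -m - 1 < z.re → z.re < 2 * α.re → z ≠ -m →
      DifferentiableAt ℂ (fun z => rieszFunctional z ψ) z := fun z h1 h2 h3 =>
    differentiableAt_rieszFunctional hm hψ1 hC h1 (by linarith) h3
  -- The formula for Schwartz functions is not available for $\psi$, so the continuation is redone.
  -- The strip reaches left of $-m$ because $\operatorname{Re}\alpha=0$ puts the target on the line
  -- $\operatorname{Re}z=-m$, and it ends at $2\operatorname{Re}\alpha$, where the decay of $\psi$
  -- ceases to suffice.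
  have key : rieszFunctional (-(m : ℂ) + 2 * α) ψ = rieszCoeff m (-(m : ℂ) + 2 * α) *
      ∫ ξ : Eucl m, (‖ξ‖ : ℂ) ^ (-(m : ℂ) - (-(m : ℂ) + 2 * α)) * f ξ := by
    refine eq_of_eqOn_strip (f := fun z => rieszFunctional z ψ)
      (g := fun z => rieszCoeff m z * ∫ ξ : Eucl m, (‖ξ‖ : ℂ) ^ (-(m : ℂ) - z) * f ξ)
      (a := -m - 1) (b := 2 * α.re) (c := -m) (d := 0) (by linarith) (by linarith) (by linarith)
      (fun z hz1 hz2 hz => hG z hz1 hz2 (by simpa using hne z hz 0))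
      (fun z _ hz0 hz => (differentiableAt_rieszCoeff (hne z hz)).mul (hd z hz0))
      (fun z hz1 hz2 => ?_) (by rw [hre]; linarith) (by rw [hre]; linarith)
      (hG _ (by rw [hre]; linarith) (by rw [hre]; linarith)
        (by simpa using hne' 0)).continuousAt
      ((differentiableAt_rieszCoeff hne').mul (hd _ (by rw [hre]; linarith))).continuousAt
    have hcompl := norm_rpow_integrable_compl_of_le hψ1.continuous hC (s := z.re) (by linarith)
    rw [(rieszFunctional_eq_integral hm hz1 hψ1.continuous hcompl).2]
    have hi1 : Integrable (fun x => ‖x‖ ^ z.re * ‖ψ x‖) := by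
      rw [← integrableOn_univ, ← union_compl_self (Metric.closedBall (0 : Eucl m) 1)]
      exact (norm_rpow_integrable_ball hm hψ1.continuous hz1).union hcompl
    rw [hψf] at hi1 ⊢
    exact integral_norm_cpow_mul_fourierInv hm hf1 hz1 hz2 hi1 (hfi _ (by linarith))
  -- Here the powers $|\xi|^{-2\alpha}$ and $|\xi|^{2\alpha}$ cancel, and Fourier inversion at $0$
  -- remains.
  have hint : ∫ ξ : Eucl m, (‖ξ‖ : ℂ) ^ (-(m : ℂ) - (-(m : ℂ) + 2 * α)) * f ξ =
      (2 * Real.pi : ℂ) ^ (2 * α) * φ 0 := by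
    rw [← integral_fourier_eq, ← integral_const_mul]
    refine integral_congr_ae ?_
    filter_upwards [ae_norm_pos hm] with ξ hξ
    have hξ0 : (‖ξ‖ : ℂ) ≠ 0 := by exact_mod_cast hξ.ne'
    have e : -(m : ℂ) - (-(m : ℂ) + 2 * α) = -(2 * α) := by ring
    have hξc : (‖ξ‖ : ℂ) ^ (2 * α) ≠ 0 := by simp [Complex.cpow_eq_zero_iff, hξ0]
    rw [e, hf, Complex.cpow_neg]
    field_simp
  rw [key, hint]
  calc _ = rieszConst m α * rieszCoeff m (-(m : ℂ) + 2 * α) * (2 * Real.pi : ℂ) ^ (2 * α) *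
        φ 0 := by ring
    _ = _ := by rw [rieszConst_mul_rieszCoeff h h0 hα, one_mul]

end RieszDist

/-! ### Integrable products and limits along approximate units. -/

namespace RieszDist

open scoped FourierTransform RealInnerProductSpace

variable {m : ℕ}

/-- Leibniz' rule as an estimate. -/
theorem norm_iteratedFDeriv_mul_le_of_bounds {f g : Eucl m → ℂ} {k : ℕ} {z : Eucl m}
    (hf : ContDiff ℝ k f) (hg : ContDiff ℝ k g) {P : ℝ}
    (hP : ∀ j ≤ k, ‖iteratedFDeriv ℝ j g z‖ ≤ P) :
    ‖iteratedFDeriv ℝ k (fun x => f x * g x) z‖ ≤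
      2 ^ k * P * ∑ j ∈ Finset.range (k + 1), ‖iteratedFDeriv ℝ j f z‖ := by
  have hP0 : 0 ≤ P := (norm_nonneg _).trans (hP 0 (Nat.zero_le _))
  refine (norm_iteratedFDeriv_mul_le hf hg z le_rfl).trans ?_
  rw [Finset.mul_sum]
  refine Finset.sum_le_sum fun i _ => ?_
  have h1 : (k.choose i : ℝ) ≤ 2 ^ k := by exact_mod_cast Nat.choose_le_two_pow k i
  calc _ ≤ 2 ^ k * ‖iteratedFDeriv ℝ i f z‖ * P := by
        gcongr
        exact hP _ (Nat.sub_le k i)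
    _ = _ := by ring

/-- On the unit ball Leibniz' rule bounds the derivatives of $\psi\chi$ by those of $\chi$. Outside,
$\|z\|^b|\psi(z)|$ is integrable because $a+b<-m$, so only the supremum of $|\chi|$ matters. -/
theorem isIntegrableDist_of_isControlled {a b : ℝ} {S T : 𝓢'(Eucl m, ℂ)} (hS : IsControlled a S)
    (hT : IsControlled b T) (hab : a + b < -m) (φ : 𝓢(Eucl m, ℂ)) :
    IsIntegrableDist (TemperedDistribution.smulLeftCLM ℂ (regularization S φ) T) := by
  obtain ⟨C₀, hC₀, hdec⟩ := hS.norm_regularization_le φ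
  have ht := hasTemperateGrowth_regularization S φ
  set ψ := regularization S φ
  obtain ⟨n, C, hC, hb⟩ := hT
  obtain ⟨k, B, hB, hu⟩ := ht.norm_iteratedFDeriv_le_uniform n
  set I := ∫ z in (Metric.closedBall (0 : Eucl m) 1)ᶜ, ‖z‖ ^ b * ‖ψ z‖ with hI
  have hψc : Continuous ψ := ht.1.continuous
  have hIi := norm_rpow_integrable_compl_of_le hψc hdec (s := b) (by linarith)
  have hI0 : 0 ≤ I := by positivity
  refine ⟨n, C * (2 ^ n * ((n + 1) * (B * 2 ^ k)) + I), fun χ => ?_⟩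
  set P := ∑ j ∈ Finset.range (n + 1), SchwartzMap.seminorm ℂ 0 j χ with hP
  have hP0 : 0 ≤ P := Finset.sum_nonneg fun j _ => apply_nonneg _ _
  have hPj : ∀ j ≤ n, ∀ z, ‖iteratedFDeriv ℝ j χ z‖ ≤ P := fun j hj z =>
    (χ.norm_iteratedFDeriv_le_seminorm ℂ j z).trans
      (Finset.single_le_sum (f := fun j => SchwartzMap.seminorm ℂ 0 j χ)
        (fun j _ => apply_nonneg _ _) (Finset.mem_range.2 (Nat.lt_succ_of_le hj)))
  rw [TemperedDistribution.smulLeftCLM_apply_apply, mul_assoc]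
  have e : ⇑(SchwartzMap.smulLeftCLM ℂ ψ χ) = fun x => ψ x * χ x := by
    funext x; rw [SchwartzMap.smulLeftCLM_apply_apply ht, smul_eq_mul]
  refine (hb _ (2 ^ n * ((n + 1) * (B * 2 ^ k)) * P) fun j hj z hz => ?_).trans ?_
  · rw [e]
    refine (norm_iteratedFDeriv_mul_le_of_bounds (ht.1.of_le (by exact_mod_cast le_top))
      (χ.smooth j) (fun i hi => hPj i (hi.trans hj) z)).trans ?_
    have h1 : ∑ i ∈ Finset.range (j + 1), ‖iteratedFDeriv ℝ i ψ z‖ ≤ (n + 1) * (B * 2 ^ k) := by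
      have h2 := Finset.sum_le_card_nsmul (Finset.range (j + 1))
        (fun i => ‖iteratedFDeriv ℝ i ψ z‖) (B * 2 ^ k) fun i hi => by
          refine (hu i (by have := Finset.mem_range.1 hi; lia) z).trans ?_
          gcongr
          linarith
      rw [Finset.card_range, nsmul_eq_mul] at h2
      have h3 : ((j + 1 : ℕ) : ℝ) ≤ n + 1 := by exact_mod_cast Nat.succ_le_succ hj
      exact h2.trans (by gcongr)
    have h4 : (2 : ℝ) ^ j ≤ 2 ^ n := pow_le_pow_right₀ one_le_two hj
    calc _ ≤ 2 ^ n * P * ((n + 1) * (B * 2 ^ k)) := by gcongr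
      _ = _ := by ring
  · refine mul_le_mul_of_nonneg_left ?_ hC
    rw [add_mul (2 ^ n * ((n + 1) * (B * 2 ^ k))) I P]
    refine add_le_add (le_refl (2 ^ n * ((n + 1) * (B * 2 ^ k)) * P)) ?_
    rw [hI, ← integral_mul_const]
    refine setIntegral_mono_on (schwartz_norm_rpow_integrable_compl _ b) (hIi.mul_const P)
      Metric.isClosed_closedBall.measurableSet.compl fun z _ => ?_
    rw [e, norm_mul, ← mul_assoc]
    refine mul_le_mul_of_nonneg_left ?_ (by positivity)
    simpa using hPj 0 (Nat.zero_le _) z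

section ApproxUnit

variable {χ : ℕ → 𝓢(Eucl m, ℂ)}

theorem IsApproxUnit.exists_bound (h : IsApproxUnit χ) (n : ℕ) :
    ∃ P : ℝ, 0 ≤ P ∧ ∀ N, ∀ j ≤ n, ∀ z, ‖iteratedFDeriv ℝ j (χ N) z‖ ≤ P := by
  choose C hC using h.2.1
  refine ⟨∑ j ∈ Finset.range (n + 1), |C j|, by positivity, fun N j hj z => ?_⟩
  refine ((χ N).norm_iteratedFDeriv_le_seminorm ℂ j z).trans ((hC j N).trans ?_)
  exact (le_abs_self _).trans (Finset.single_le_sum (f := fun j => |C j|)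
    (fun j _ => abs_nonneg _) (Finset.mem_range.2 (Nat.lt_succ_of_le hj)))

theorem IsApproxUnit.eventually_eq_one (h : IsApproxUnit χ) (x : Eucl m) :
    ∀ᶠ N in atTop, χ N x = 1 :=
  (h.2.2 ‖x‖).mono fun _ hN => hN x le_rfl

theorem IsApproxUnit.tendsto_integral (h : IsApproxUnit χ) {ν : Measure (Eucl m)} {g : Eucl m → ℂ}
    (hg : Integrable g ν) : Tendsto (fun N => ∫ x, g x * χ N x ∂ν) atTop (𝓝 (∫ x, g x ∂ν)) := by
  obtain ⟨P, hP, hb⟩ := h.exists_bound 0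
  refine tendsto_integral_of_dominated_convergence (fun x => ‖g x‖ * P)
    (fun N => hg.1.mul (χ N).continuous.aestronglyMeasurable) (hg.norm.mul_const P)
    (fun N => Eventually.of_forall fun x => ?_) (Eventually.of_forall fun x => ?_)
  · rw [norm_mul]
    refine mul_le_mul_of_nonneg_left ?_ (norm_nonneg _)
    simpa using hb N 0 le_rfl x
  · refine tendsto_const_nhds.congr' ?_
    filter_upwards [h.eventually_eq_one x] with N hN
    rw [hN, mul_one]

/-- On the unit ball $\chi_N$ is eventually $1$, so the first and third terms are eventually
constant; the tail converges by domination. -/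
theorem IsApproxUnit.tendsto_rieszFunctional (h : IsApproxUnit χ) (hm : 1 ≤ m) {lam : ℂ}
    {g : Eucl m → ℂ} (hg : Continuous g)
    (hi : IntegrableOn (fun x => ‖x‖ ^ lam.re * ‖g x‖) (Metric.closedBall 0 1)ᶜ) :
    Tendsto (fun N => rieszFunctional lam (fun x => g x * χ N x)) atTop
      (𝓝 (rieszFunctional lam g)) := by
  have hi' : IntegrableOn (fun x => (‖x‖ : ℂ) ^ lam * g x) (Metric.closedBall 0 1)ᶜ :=
    integrable_cpow_mul measurable_norm (ae_restrict_of_ae (ae_norm_pos hm))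
      hg.aestronglyMeasurable hi hi le_rfl le_rfl
  have h1 := h.tendsto_integral hi'
  unfold rieszFunctional
  refine Tendsto.add (Tendsto.add ?_ ?_) ?_
  · refine tendsto_const_nhds.congr' ?_
    filter_upwards [h.2.2 1] with N hN
    refine setIntegral_congr_fun Metric.isClosed_closedBall.measurableSet fun x hx => ?_
    simp only [hN x (by simpa using hx), hN 0 (by simp), mul_one]
  · simpa only [mul_assoc] using h1
  · refine tendsto_const_nhds.congr' ?_
    filter_upwards [h.eventually_eq_one 0] with N hN
    rw [hN, mul_one]

/-- Controlled distributions are continuous along multiplication by approximate units. -/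
theorem IsApproxUnit.tendsto_apply (h : IsApproxUnit χ) {a : ℝ} {T : 𝓢'(Eucl m, ℂ)}
    (hT : IsControlled a T) (Φ : 𝓢(Eucl m, ℂ)) :
    Tendsto (fun N => T (SchwartzMap.smulLeftCLM ℂ (χ N) Φ)) atTop (𝓝 (T Φ)) := by
  obtain ⟨n, C, hC, hb⟩ := hT
  obtain ⟨P, hP, hχ⟩ := h.exists_bound 0
  have e : ∀ N x, (SchwartzMap.smulLeftCLM ℂ (χ N) Φ - Φ) x = Φ x * (χ N x - 1) := fun N x => by
    rw [sub_apply, SchwartzMap.smulLeftCLM_apply_apply (χ N).hasTemperateGrowth, smul_eq_mul]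
    ring
  have hint : Tendsto (fun N => ∫ z in (Metric.closedBall (0 : Eucl m) 1)ᶜ, ‖z‖ ^ a *
      ‖(SchwartzMap.smulLeftCLM ℂ (χ N) Φ - Φ) z‖) atTop
      (𝓝 (∫ z in (Metric.closedBall (0 : Eucl m) 1)ᶜ, (0 : ℝ))) := by
    refine tendsto_integral_of_dominated_convergence (fun x => ‖x‖ ^ a * ‖Φ x‖ * (P + 1))
      (fun N => (schwartz_norm_rpow_integrable_compl _ a).1)
      ((schwartz_norm_rpow_integrable_compl Φ a).mul_const _)
      (fun N => Eventually.of_forall fun x => ?_) (Eventually.of_forall fun x => ?_)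
    · rw [Real.norm_of_nonneg (by positivity), e, norm_mul, ← mul_assoc]
      refine mul_le_mul_of_nonneg_left ?_ (by positivity)
      refine (norm_sub_le _ _).trans ?_
      simpa using hχ N 0 le_rfl x
    · refine tendsto_const_nhds.congr' ?_
      filter_upwards [h.eventually_eq_one x] with N hN
      rw [e, hN]
      simp
  rw [tendsto_iff_norm_sub_tendsto_zero]
  simp only [integral_zero] at hint
  have hint' := hint.const_mul C
  rw [mul_zero] at hint'
  refine squeeze_zero' (Eventually.of_forall fun N => norm_nonneg _) ?_ hint'
  -- Radius $2$ makes the difference vanish on a neighbourhood of the closed unit ball. All its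
  -- derivatives there are then $0$, and the control applies with $A=0$.
  filter_upwards [h.2.2 2] with N hN
  have h0 := hb (SchwartzMap.smulLeftCLM ℂ (χ N) Φ - Φ) 0 fun k _ z hz => ?_
  · rwa [zero_add, map_sub] at h0
  · have he : (SchwartzMap.smulLeftCLM ℂ (χ N) Φ - Φ : Eucl m → ℂ) =ᶠ[𝓝 z] fun _ => 0 := by
      filter_upwards [Metric.ball_mem_nhds z one_pos] with y hy
      have hy' : ‖y‖ ≤ 2 := by
        have h1 := norm_le_norm_add_norm_sub' y z
        have h2 := mem_ball_iff_norm.1 hy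
        linarith
      have := e N y
      rw [hN y hy', sub_self, mul_zero] at this
      exact this
    have h2 := he.iteratedFDeriv (𝕜 := ℝ) k
    have h3 := h2.self_of_nhds
    refine le_of_eq ?_
    rw [norm_eq_zero]
    refine Eq.trans h3 ?_
    cases k with
    | zero => ext; simp
    | succ k => rw [iteratedFDeriv_const_of_ne (Nat.succ_ne_zero k)]; rfl

end ApproxUnit

end RieszDist

/-! ### Fubini for power weights, and uniform decay of $\varphi(\cdot+y)\chi$. -/

namespace RieszDist

open scoped FourierTransform RealInnerProductSpace

variable {m : ℕ}

theorem norm_rpow_mul_one_add_norm_rpow_integrable (hm : 1 ≤ m) {s a : ℝ} (hs : -m < s)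
    (hsa : s + a < -m) : Integrable (fun x : Eucl m => ‖x‖ ^ s * (1 + ‖x‖) ^ a) := by
  have hc : Continuous fun x : Eucl m => (((1 + ‖x‖) ^ a : ℝ) : ℂ) :=
    Complex.continuous_ofReal.comp <| (continuous_const.add continuous_norm).rpow_const fun x =>
      Or.inl (by change (1 : ℝ) + ‖x‖ ≠ 0; positivity)
  have hn : ∀ x : Eucl m, ‖(((1 + ‖x‖) ^ a : ℝ) : ℂ)‖ = (1 + ‖x‖) ^ a := fun x => by
    rw [Complex.norm_real, Real.norm_of_nonneg (by positivity)]
  have h1 := norm_rpow_integrable_ball hm hc hs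
  have h2 := norm_rpow_integrable_compl_of_le hc (C := 1) (a := a) (s := s)
    (fun x => by rw [hn, one_mul]) hsa
  simp only [hn] at h1 h2
  rw [← integrableOn_univ, ← union_compl_self (Metric.closedBall (0 : Eucl m) 1)]
  exact h1.union h2

/-- Fubini's theorem for two homogeneous weights. -/
theorem integral_integral_norm_cpow_swap (hm : 1 ≤ m) {lam ν : ℂ} {a b K : ℝ}
    (hl : -m < lam.re) (hla : lam.re + a < -m) (hν : -m < ν.re) (hνb : ν.re + b < -m)
    {F : Eucl m × Eucl m → ℂ} (hF : AEStronglyMeasurable F)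
    (hK : ∀ y x, ‖F (y, x)‖ ≤ K * ((1 + ‖y‖) ^ a * (1 + ‖x‖) ^ b)) :
    ∫ x, (‖x‖ : ℂ) ^ ν * ∫ y, (‖y‖ : ℂ) ^ lam * F (y, x) =
      ∫ y, (‖y‖ : ℂ) ^ lam * ∫ x, (‖x‖ : ℂ) ^ ν * F (y, x) := by
  have hmeas : ∀ μ : ℂ, Measurable fun x : Eucl m => (‖x‖ : ℂ) ^ μ := fun μ =>
    (Complex.measurable_ofReal.comp measurable_norm).pow_const _
  have hi : Integrable (fun p : Eucl m × Eucl m =>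
      (‖p.1‖ : ℂ) ^ lam * ((‖p.2‖ : ℂ) ^ ν * F p)) (volume.prod volume) := by
    refine Integrable.mono' (((norm_rpow_mul_one_add_norm_rpow_integrable hm hl hla).mul_prod
      (norm_rpow_mul_one_add_norm_rpow_integrable hm hν hνb)).const_mul K) ?_ ?_
    · exact ((hmeas lam).comp measurable_fst).aestronglyMeasurable.mul
        (((hmeas ν).comp measurable_snd).aestronglyMeasurable.mul hF)
    · have h1 : ∀ᵐ p : Eucl m × Eucl m ∂(volume.prod volume), 0 < ‖p.1‖ :=
        Measure.quasiMeasurePreserving_fst.ae (ae_norm_pos hm)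
      have h2 : ∀ᵐ p : Eucl m × Eucl m ∂(volume.prod volume), 0 < ‖p.2‖ :=
        Measure.quasiMeasurePreserving_snd.ae (ae_norm_pos hm)
      filter_upwards [h1, h2] with p hp1 hp2
      rw [norm_mul, norm_mul, Complex.norm_cpow_eq_rpow_re_of_pos hp1,
        Complex.norm_cpow_eq_rpow_re_of_pos hp2]
      calc _ ≤ ‖p.1‖ ^ lam.re * (‖p.2‖ ^ ν.re * (K * ((1 + ‖p.1‖) ^ a * (1 + ‖p.2‖) ^ b))) := by
            gcongr
            exact hK p.1 p.2
        _ = _ := by ring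
  have h := integral_integral_swap (f := fun y x => (‖y‖ : ℂ) ^ lam * ((‖x‖ : ℂ) ^ ν * F (y, x))) hi
  simp only [← integral_const_mul]
  rw [h]
  refine integral_congr_ae (Eventually.of_forall fun x => ?_)
  exact integral_congr_ae (Eventually.of_forall fun y => by simp only; ring)

/-- The product of a translate of `φ` with `χ`. -/
noncomputable def translateMul (φ χ : 𝓢(Eucl m, ℂ)) (y : Eucl m) : 𝓢(Eucl m, ℂ) :=
  SchwartzMap.smulLeftCLM ℂ χ (SchwartzMap.compSubConstCLM ℂ (-y) φ)

theorem translateMul_coe (φ χ : 𝓢(Eucl m, ℂ)) (y : Eucl m) :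
    ⇑(translateMul φ χ y) = fun x => SchwartzMap.compSubConstCLM ℂ (-y) φ x * χ x := by
  funext x
  rw [translateMul, SchwartzMap.smulLeftCLM_apply_apply χ.hasTemperateGrowth, smul_eq_mul, mul_comm]

theorem translateMul_apply (φ χ : 𝓢(Eucl m, ℂ)) (y x : Eucl m) :
    translateMul φ χ y x = φ (x + y) * χ x := by
  rw [translateMul_coe]
  simp

theorem norm_iteratedFDeriv_translateMul_le {φ χ : 𝓢(Eucl m, ℂ)} {x y : Eucl m} {i : ℕ} {P : ℝ}
    (hP : ∀ j ≤ i, ‖iteratedFDeriv ℝ j χ x‖ ≤ P) :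
    ‖iteratedFDeriv ℝ i (translateMul φ χ y) x‖ ≤
      2 ^ i * P * ∑ j ∈ Finset.range (i + 1), ‖iteratedFDeriv ℝ j φ (x + y)‖ := by
  rw [translateMul_coe]
  refine (norm_iteratedFDeriv_mul_le_of_bounds (SchwartzMap.smooth _ i) (χ.smooth i) hP).trans_eq ?_
  simp only [iteratedFDeriv_translate]

/-- The factors live near $x=-y$ and $x=0$, so their product is small for large $y$:
$1+\|y\|\le(1+\|x\|)(1+\|x+y\|)$. -/
theorem exists_decay_translateMul (φ χ : 𝓢(Eucl m, ℂ)) (N k : ℕ) :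
    ∃ K : ℝ, 0 ≤ K ∧ ∀ y, ∀ i ≤ k, ∀ x,
      (1 + ‖x‖) ^ k * ‖iteratedFDeriv ℝ i (translateMul φ χ y) x‖ ≤ K * (1 + ‖y‖) ^ (-(N : ℝ)) := by
  -- Of the decay of $\chi$, the power $k$ pays for the weight in $x$ and the power $N$ for the
  -- factor $1+\|x\|$ in the inequality above.
  obtain ⟨K₁, hK₁, h₁⟩ := exists_decay χ (N + k) k
  obtain ⟨K₂, hK₂, h₂⟩ := exists_decay φ N k
  refine ⟨2 ^ k * K₁ * ((k + 1) * K₂), by positivity, fun y i hi x => ?_⟩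
  have h := norm_iteratedFDeriv_translateMul_le (φ := φ) (χ := χ) (x := x) (y := y) (i := i)
    (P := K₁ / (1 + ‖x‖) ^ (N + k)) fun j hj => by
      rw [le_div_iff₀ (by positivity), mul_comm]
      exact h₁ j (hj.trans hi) x
  have hs : ∑ j ∈ Finset.range (i + 1), ‖iteratedFDeriv ℝ j φ (x + y)‖ ≤
      (k + 1) * (K₂ / (1 + ‖x + y‖) ^ N) := by
    have h2 := Finset.sum_le_card_nsmul (Finset.range (i + 1))
      (fun j => ‖iteratedFDeriv ℝ j φ (x + y)‖) (K₂ / (1 + ‖x + y‖) ^ N) fun j hj => by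
        rw [le_div_iff₀ (by positivity), mul_comm]
        exact h₂ j (by have := Finset.mem_range.1 hj; lia) _
    rw [Finset.card_range, nsmul_eq_mul] at h2
    have h3 : ((i + 1 : ℕ) : ℝ) ≤ k + 1 := by exact_mod_cast Nat.succ_le_succ hi
    exact h2.trans (by gcongr)
  have hpow : (2 : ℝ) ^ i ≤ 2 ^ k := pow_le_pow_right₀ one_le_two hi
  have hpe : (1 + ‖y‖) ^ N ≤ (1 + ‖x‖) ^ N * (1 + ‖x + y‖) ^ N := by
    rw [← mul_pow]
    refine pow_le_pow_left₀ (by positivity) ?_ N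
    have : ‖y‖ ≤ ‖x + y‖ + ‖x‖ := by
      have := norm_sub_le (x + y) x
      rwa [add_sub_cancel_left] at this
    nlinarith [norm_nonneg x, norm_nonneg (x + y)]
  rw [Real.rpow_neg (by positivity), Real.rpow_natCast, ← div_eq_mul_inv,
    le_div_iff₀ (by positivity)]
  calc (1 + ‖x‖) ^ k * ‖iteratedFDeriv ℝ i (translateMul φ χ y) x‖ * (1 + ‖y‖) ^ N
      ≤ (1 + ‖x‖) ^ k * (2 ^ k * (K₁ / (1 + ‖x‖) ^ (N + k)) *
          ((k + 1) * (K₂ / (1 + ‖x + y‖) ^ N))) * ((1 + ‖x‖) ^ N * (1 + ‖x + y‖) ^ N) := by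
        gcongr
        exact h.trans (by gcongr)
    _ = _ := by
        rw [pow_add]
        field_simp

/-- Continuity of the Fourier transform on Schwartz space carries the bounds over with the same
dependence on $y$. The joint decay in $y$ and $\xi$ is the majorant for Fubini. -/
theorem exists_decay_fourier_translateMul (φ χ : 𝓢(Eucl m, ℂ)) (N : ℕ) :
    ∃ K : ℝ, 0 ≤ K ∧ ∀ y ξ, ‖𝓕 (translateMul φ χ y) ξ‖ ≤
      K * ((1 + ‖y‖) ^ (-(N : ℝ)) * (1 + ‖ξ‖) ^ (-(N : ℝ))) := by
  let L : 𝓢(Eucl m, ℂ) →L[ℂ] 𝓢(Eucl m, ℂ) :=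
    FourierTransform.fourierCLM ℂ 𝓢(Eucl m, ℂ)
  let p : Seminorm ℂ 𝓢(Eucl m, ℂ) :=
    (Finset.Iic (N, 0)).sup (schwartzSeminormFamily ℂ (Eucl m) ℂ)
  have hp : Continuous p := by
    exact Seminorm.continuous_finsetSup fun i _ =>
      (schwartz_withSeminorms ℂ (Eucl m) ℂ).continuous_seminorm i
  obtain ⟨k, C, hC, h⟩ := exists_seminorm_bound (p.comp L.toLinearMap) (hp.comp L.continuous)
  obtain ⟨K, hK, hd⟩ := exists_decay_translateMul φ χ N k
  refine ⟨2 ^ N * (C * K), by positivity, fun y ξ => ?_⟩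
  have h1 := SchwartzMap.one_add_le_sup_seminorm_apply (𝕜 := ℂ) (m := (N, 0)) le_rfl le_rfl
    (𝓕 (translateMul φ χ y)) ξ
  rw [norm_iteratedFDeriv_zero] at h1
  have h2 : p (𝓕 (translateMul φ χ y)) ≤ C * (K * (1 + ‖y‖) ^ (-(N : ℝ))) :=
    h (translateMul φ χ y) _ (hd y)
  rw [Real.rpow_neg (by positivity : 0 ≤ 1 + ‖ξ‖), Real.rpow_natCast, ← mul_assoc,
    ← div_eq_mul_inv, le_div_iff₀ (by positivity), mul_comm]
  calc _ ≤ 2 ^ N * p (𝓕 (translateMul φ χ y)) := h1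
    _ ≤ 2 ^ N * (C * (K * (1 + ‖y‖) ^ (-(N : ℝ)))) := by gcongr
    _ = _ := by ring

theorem fourier_translateMul_apply (φ χ : 𝓢(Eucl m, ℂ)) (y ξ : Eucl m) :
    𝓕 (translateMul φ χ y) ξ =
      ∫ x, (Real.fourierChar (-⟪x, ξ⟫) : ℂ) * (φ (x + y) * χ x) := by
  rw [SchwartzMap.fourier_coe, Real.fourier_eq]
  simp only [translateMul_apply, Circle.smul_def, smul_eq_mul]

theorem stronglyMeasurable_fourier_translateMul (φ χ : 𝓢(Eucl m, ℂ)) :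
    StronglyMeasurable fun p : Eucl m × Eucl m => 𝓕 (translateMul φ χ p.1) p.2 := by
  simp only [fourier_translateMul_apply]
  refine StronglyMeasurable.integral_prod_right' (f := fun q : (Eucl m × Eucl m) × Eucl m =>
    (Real.fourierChar (-⟪q.2, q.1.2⟫) : ℂ) * (φ (q.2 + q.1.1) * χ q.2)) ?_
  refine Continuous.stronglyMeasurable ?_
  have h1 := φ.continuous
  have h2 := χ.continuous
  have h3 : Continuous fun x : ℝ => (Real.fourierChar x : ℂ) :=
    continuous_subtype_val.comp Real.continuous_fourierChar
  fun_prop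

end RieszDist

/-! ### The limits for both signs of $\operatorname{Re}\beta$, and the theorem. -/

namespace RieszDist

open scoped FourierTransform RealInnerProductSpace

variable {m : ℕ}

theorem neg_lt_re_neg_add_two_mul (m : ℕ) {α : ℂ} (h : 0 < α.re) :
    -(m : ℝ) < (-(m : ℂ) + 2 * α).re := by
  simpa using h

theorem regularization_laplacePowDelta_neg (hm : 1 ≤ m) {α : ℂ} (h : 0 < α.re)
    (φ : 𝓢(Eucl m, ℂ)) (x : Eucl m) : regularization (laplacePowDelta m (-α)) φ x =
      rieszConst m α * ∫ y, (‖y‖ : ℂ) ^ (-(m : ℂ) + 2 * α) * φ (x + y) := by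
  have h0 : α ≠ 0 := by rintro rfl; simp at h
  have hre := neg_lt_re_neg_add_two_mul m h
  rw [regularization, laplacePowDelta_neg_apply m h.le h0, radialDist_eq_rieszFunctional hm hre.le,
    (rieszFunctional_eq_integral hm hre (SchwartzMap.continuous _)
      (schwartz_norm_rpow_integrable_compl _ _)).2]
  simp [add_comm]

theorem fourier_smulLeftCLM_regularization (hm : 1 ≤ m) {α : ℂ} (h : 0 < α.re)
    (φ χ : 𝓢(Eucl m, ℂ)) (ξ : Eucl m) :
    𝓕 (SchwartzMap.smulLeftCLM ℂ (regularization (laplacePowDelta m (-α)) φ) χ) ξ =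
      rieszConst m α * ∫ y, (‖y‖ : ℂ) ^ (-(m : ℂ) + 2 * α) * 𝓕 (translateMul φ χ y) ξ := by
  set lam : ℂ := -(m : ℂ) + 2 * α with hlam
  have hre : -(m : ℝ) < lam.re := neg_lt_re_neg_add_two_mul m h
  obtain ⟨N, hN⟩ := exists_nat_gt (lam.re + m)
  obtain ⟨K, hK, hd⟩ := exists_decay_translateMul φ χ N (max N (m + 1))
  have hm' : (1 : ℝ) ≤ m := by exact_mod_cast hm
  have hF : Continuous fun p : Eucl m × Eucl m =>
      (Real.fourierChar (-⟪p.2, ξ⟫) : ℂ) * (φ (p.2 + p.1) * χ p.2) := by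
    have h1 := φ.continuous
    have h2 := χ.continuous
    have h3 : Continuous fun x : ℝ => (Real.fourierChar x : ℂ) :=
      continuous_subtype_val.comp Real.continuous_fourierChar
    fun_prop
  -- Only the $y$-variable carries a singular weight here, hence $\nu=0$; decay of order $m+1$ in
  -- $x$ is enough.
  have key := integral_integral_norm_cpow_swap hm (lam := lam) (ν := 0) (a := -N)
    (b := -(m + 1 : ℕ)) (K := K) hre (by linarith) (by simp; linarith) (by simp)
    hF.aestronglyMeasurable fun y x => by
      have h1 := hd y 0 (Nat.zero_le _) x
      rw [norm_iteratedFDeriv_zero, translateMul_apply] at h1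
      rw [norm_mul, Circle.norm_coe, one_mul, Real.rpow_neg (by positivity : 0 ≤ 1 + ‖x‖),
        Real.rpow_natCast, ← mul_assoc, ← div_eq_mul_inv, le_div_iff₀ (by positivity), mul_comm]
      refine le_trans ?_ h1
      gcongr
      · linarith [norm_nonneg x]
      · exact le_max_right _ _
  simp only [Complex.cpow_zero, one_mul] at key
  simp only [fourier_translateMul_apply]
  rw [← key, SchwartzMap.fourier_coe, Real.fourier_eq, ← integral_const_mul]
  refine integral_congr_ae (Eventually.of_forall fun x => ?_)
  simp only
  rw [SchwartzMap.smulLeftCLM_apply_apply (hasTemperateGrowth_regularization _ φ),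
    regularization_laplacePowDelta_neg hm h, Circle.smul_def, smul_eq_mul, smul_eq_mul,
    mul_left_comm, mul_assoc, ← integral_mul_const, ← integral_const_mul, ← integral_const_mul]
  refine integral_congr_ae (Eventually.of_forall fun y => ?_)
  simp only
  ring

/-- On the Fourier side $(-\Delta)^\alpha\delta$ is integration against $(2\pi|\xi|)^{2\alpha}$, so
moving it under the $y$-integral is Fubini for the weights $|y|^{-m+2\alpha}$ and $|\xi|^{2\alpha}$.
-/
theorem laplacePowDelta_smulLeftCLM_regularization (hm : 1 ≤ m) {α : ℂ} (h : 0 < α.re)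
    (φ χ : 𝓢(Eucl m, ℂ)) :
    laplacePowDelta m α
        (SchwartzMap.smulLeftCLM ℂ (regularization (laplacePowDelta m (-α)) φ) χ) =
      rieszConst m α *
        ∫ y, (‖y‖ : ℂ) ^ (-(m : ℂ) + 2 * α) * laplacePowDelta m α (translateMul φ χ y) := by
  set lam : ℂ := -(m : ℂ) + 2 * α with hlam
  have hre : -(m : ℝ) < lam.re := neg_lt_re_neg_add_two_mul m h
  have hre' : lam.re = -m + 2 * α.re := by simp [hlam]
  have h2 : (2 * α).re = 2 * α.re := by simp
  have hm' : (1 : ℝ) ≤ m := by exact_mod_cast hm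
  obtain ⟨N, hN⟩ := exists_nat_gt (2 * α.re + m)
  obtain ⟨K, hK, hd⟩ := exists_decay_fourier_translateMul φ χ N
  have key := integral_integral_norm_cpow_swap hm (lam := lam) (ν := 2 * α) (a := -N) (b := -N)
    (K := K) hre (by linarith) (by linarith) (by linarith)
    (stronglyMeasurable_fourier_translateMul φ χ).aestronglyMeasurable hd
  simp only at key
  simp only [laplacePowDelta_eq_integral_fourier hm h.le,
    fourier_smulLeftCLM_regularization hm h, ← hlam]
  simp only [mul_left_comm _ (rieszConst m α), integral_const_mul]
  simp only [mul_left_comm _ ((2 * Real.pi : ℂ) ^ (2 * α)) (∫ _, _), integral_const_mul]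
  rw [key]

theorem tendsto_smulLeftCLM_regularization_neg (hm : 1 ≤ m) {α : ℂ} (h : 0 < α.re)
    (hα : ∀ n : ℕ, α ≠ ((m : ℂ) + 2 * n) / 2) (φ : 𝓢(Eucl m, ℂ)) {χ : ℕ → 𝓢(Eucl m, ℂ)}
    (hχ : IsApproxUnit χ) :
    Tendsto (fun N => laplacePowDelta m α
      (SchwartzMap.smulLeftCLM ℂ (regularization (laplacePowDelta m (-α)) φ) (χ N))) atTop
      (𝓝 (φ 0)) := by
  have hm' : (1 : ℝ) ≤ m := by exact_mod_cast hm
  have h0 : α ≠ 0 := by rintro rfl; simp at h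
  have hT := isControlled_laplacePowDelta hm α
  set T := laplacePowDelta m α with hTdef
  simp only [hTdef, laplacePowDelta_smulLeftCLM_regularization hm h]
  rw [← rieszConst_mul_rieszFunctional hm h.le h0 hα φ]
  refine Tendsto.const_mul _ ?_
  have hre : -(m : ℝ) < (-(m : ℂ) + 2 * α).re := neg_lt_re_neg_add_two_mul m h
  have hre' : (-(m : ℂ) + 2 * α).re = -m + 2 * α.re := by simp
  have hc : ∀ S : 𝓢'(Eucl m, ℂ), Continuous (regularization S φ) := fun S =>
    (contDiff_regularization S 0 φ).continuous
  obtain ⟨C₀, -, hdec⟩ := hT.norm_regularization_le φ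
  rw [(rieszFunctional_eq_integral hm hre (hc T)
    (norm_rpow_integrable_compl_of_le (hc T) hdec (by linarith))).2]
  obtain ⟨n, C, hC, hb⟩ := hT.exists_le φ
  obtain ⟨P, hP, hPb⟩ := hχ.exists_bound n
  have hmeas : Measurable fun x : Eucl m => (‖x‖ : ℂ) ^ (-(m : ℂ) + 2 * α) :=
    (Complex.measurable_ofReal.comp measurable_norm).pow_const _
  -- For fixed $N$ the distribution applied to $\varphi(\cdot+y)\chi_N$ is the regularization of
  -- $\chi_NT$ at $y$, hence continuous in $y$. The majorant, uniform in $N$, is locally integrable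
  -- and of order $-2m$ at infinity.
  refine tendsto_integral_of_dominated_convergence
    (fun y => C * (2 ^ n * P) * (‖y‖ ^ (-(m : ℂ) + 2 * α).re * (1 + ‖y‖) ^ (-m - 2 * α.re)))
    (fun N => hmeas.aestronglyMeasurable.mul
      (hc (TemperedDistribution.smulLeftCLM ℂ (χ N) T)).aestronglyMeasurable)
    ((norm_rpow_mul_one_add_norm_rpow_integrable hm hre (by linarith)).const_mul _)
    (fun N => ?_) (Eventually.of_forall fun y => ?_)
  · filter_upwards [ae_norm_pos hm] with y hy
    rw [norm_mul, Complex.norm_cpow_eq_rpow_re_of_pos hy]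
    have h1 := hb y (translateMul φ (χ N) y) (2 ^ n * P) (by positivity) fun k hk z => by
      refine (norm_iteratedFDeriv_translateMul_le fun j hj => hPb N j (hj.trans hk) z).trans ?_
      have : (2 : ℝ) ^ k ≤ 2 ^ n := pow_le_pow_right₀ one_le_two hk
      gcongr
    calc _ ≤ ‖y‖ ^ (-(m : ℂ) + 2 * α).re * (C * (2 ^ n * P) * (1 + ‖y‖) ^ (-m - 2 * α.re)) := by
          gcongr
      _ = _ := by ring
  · exact (hχ.tendsto_apply hT _).const_mul _

/-- Since $\psi\chi_N$ is Schwartz, the finite part agrees with `rieszFunctional` on it; the latter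
passes to the limit $\psi$. -/
theorem tendsto_smulLeftCLM_regularization (hm : 1 ≤ m) {α : ℂ} (h : 0 ≤ α.re) (h0 : α ≠ 0)
    (hα : ∀ n : ℕ, α ≠ ((m : ℂ) + 2 * n) / 2) (φ : 𝓢(Eucl m, ℂ)) {χ : ℕ → 𝓢(Eucl m, ℂ)}
    (hχ : IsApproxUnit χ) :
    Tendsto (fun N => laplacePowDelta m (-α)
      (SchwartzMap.smulLeftCLM ℂ (regularization (laplacePowDelta m α) φ) (χ N))) atTop
      (𝓝 (φ 0)) := by
  have hm' : (1 : ℝ) ≤ m := by exact_mod_cast hm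
  have hre : (-(m : ℂ) + 2 * α).re = -m + 2 * α.re := by simp
  have hc := (contDiff_regularization (laplacePowDelta m α) 0 φ).continuous
  obtain ⟨C₀, -, hdec⟩ := (isControlled_laplacePowDelta hm α).norm_regularization_le φ
  have e : ∀ N, laplacePowDelta m (-α)
      (SchwartzMap.smulLeftCLM ℂ (regularization (laplacePowDelta m α) φ) (χ N)) =
      rieszConst m α * rieszFunctional (-(m : ℂ) + 2 * α)
        (fun x => regularization (laplacePowDelta m α) φ x * χ N x) := fun N => by
    have e1 : ⇑(SchwartzMap.smulLeftCLM ℂ (regularization (laplacePowDelta m α) φ) (χ N)) =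
        fun x => regularization (laplacePowDelta m α) φ x * χ N x := by
      funext x
      rw [SchwartzMap.smulLeftCLM_apply_apply (hasTemperateGrowth_regularization _ φ), smul_eq_mul]
    rw [laplacePowDelta_neg_apply m h h0,
      radialDist_eq_rieszFunctional hm (by rw [hre]; linarith), e1]
  simp only [e]
  rw [← rieszConst_mul_rieszFunctional hm h h0 hα φ]
  exact (hχ.tendsto_rieszFunctional hm hc
    (norm_rpow_integrable_compl_of_le hc hdec (by linarith))).const_mul _

theorem laplacePowDelta_zero_apply (hm : 1 ≤ m) (φ : 𝓢(Eucl m, ℂ)) :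
    laplacePowDelta m 0 φ = φ 0 := by
  rw [laplacePowDelta_eq_integral_fourier hm (by simp)]
  simp [integral_fourier_eq]

/-- The control exponents $-m-2\operatorname{Re}\beta$ and $-m+2\operatorname{Re}\beta$ sum to
$-2m<-m$ for every $\beta$. The value at $1$ depends on which of the two kernels is the Riesz
kernel, hence the case distinction. -/
theorem isConvolution_laplacePowDelta (hm : 1 ≤ m) {β : ℂ}
    (hβ : ∀ n : ℕ, β ≠ ((m : ℂ) + 2 * n) / 2 ∧ β ≠ -(((m : ℂ) + 2 * n) / 2)) :
    IsConvolution (laplacePowDelta m β) (laplacePowDelta m (-β)) (TemperedDistribution.delta 0) := by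
  have hm' : (1 : ℝ) ≤ m := by exact_mod_cast hm
  intro φ
  have ht := hasTemperateGrowth_regularization (laplacePowDelta m β) φ
  refine ⟨ht, isIntegrableDist_of_isControlled (isControlled_laplacePowDelta hm β)
    (isControlled_laplacePowDelta hm (-β)) (by simp; linarith) φ, fun χ hχ => ?_⟩
  simp only [TemperedDistribution.smulLeftCLM_apply_apply, TemperedDistribution.delta_apply]
  rcases lt_or_ge β.re 0 with hneg | hpos
  · have h := tendsto_smulLeftCLM_regularization_neg hm (α := -β) (by simpa using hneg)
      (fun n hn => (hβ n).2 (neg_eq_iff_eq_neg.1 hn)) φ hχ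
    rwa [neg_neg] at h
  -- The value $0$ is separate because $(-\Delta)^0\delta=\delta$ belongs to the exceptional branch
  -- of $T^*$.
  · rcases eq_or_ne β 0 with rfl | h0
    · simp only [neg_zero, laplacePowDelta_zero_apply hm] at ht ⊢
      refine tendsto_const_nhds.congr' ?_
      filter_upwards [hχ.eventually_eq_one 0] with N hN
      rw [SchwartzMap.smulLeftCLM_apply_apply ht, hN, smul_eq_mul, mul_one, regularization,
        laplacePowDelta_zero_apply hm]
      simp
    · exact tendsto_smulLeftCLM_regularization hm hpos h0 (fun n => (hβ n).1) φ hχ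

end RieszDist

theorem corollary6p1 (m : ℕ) (hm : 1 ≤ m) (β : ℂ)
    (hβ : ∀ n : ℕ, β ≠ ((m : ℂ) + 2 * n) / 2 ∧ β ≠ -(((m : ℂ) + 2 * n) / 2)) :
    RieszDist.IsConvolution (RieszDist.laplacePowDelta m β) (RieszDist.laplacePowDelta m (-β))
        (TemperedDistribution.delta 0) ∧
      RieszDist.IsFundamentalSolution m β (RieszDist.rieszKernel m β) :=
  -- Both claims agree after unfolding `rieszKernel` and `IsLaplacePow`.
  ⟨RieszDist.isConvolution_laplacePowDelta hm hβ, RieszDist.isConvolution_laplacePowDelta hm hβ⟩
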